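/- **Conventions.** All rings are commutative. For a ring $A$, a complex $C$ of $A$-modules is *totally acyclic* if every $C_n$ is a finitely generated free $A$-module and both $C$ and $\operatorname{Hom}_A(C,A)$ are exact. For totally acyclic complexes $C,D$ write $\operatorname{Hom}_A(C,D)$ for the $A$-module of homotopy classes of chain maps $C\to D$ (morphisms in the homotopy category $\mathbf{K}_{\mathrm{tac}}(A)$), and let $(\Sigma^iD)_n=D_{n-i}$ with differential $(-1)^id^D$. A *complete resolution* of an $A$-module $M$ is a totally acyclic complex $X$ such that for some projective resolution $P$ of $M$ and some integer $i$ the truncations $\cdots\to X_{i+2}\to X_{i+1}\to 0$ and $\cdots\to P_{i+2}\to P_{i+1}\to 0$ are homotopy equivalent. Let $Q$ be a local noetherian ring, $f_1,\dots,f_c$ a $Q$-regular sequence, $R=Q/(f_1,\dots,f_c)$, and let $C,D\in\mathbf{K}_{\mathrm{tac}}(R)$. Let $TC$ denote a complete resolution over $Q$ of the $Q$-module $\operatorname{Im}(d_0^C\colon C_0\to C_{-1})$, and similarly $TD$. Lift $C$ to a sequence of maps of free $Q$-modules $\widetilde d_n\colon\widetilde C_n\to\widetilde C_{n-1}$ with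 $\widetilde C\otimes_QR\cong C$ (compatibly with the differentials), and write $\widetilde d_{n-1}\widetilde d_n=\sum_{k=1}^cf_k\,\widetilde t_{k,n}$. The maps $\widetilde t_k\otimes_QR$ define chain maps $t_k\colon C\to\Sigma^2C$, which commute with one another up to homotopy. The ring of cohomology operators $R[\chi_1,\dots,\chi_c]$ is the polynomial ring over $R$; it acts on $\bigoplus_{i\ge0}\operatorname{Hom}_R(C,\Sigma^iD)$ by letting $\chi_k$ send $\alpha\in\operatorname{Hom}_R(C,\Sigma^iD)$ to $\Sigma^2(\alpha)\circ t_k\in\operatorname{Hom}_R(C,\Sigma^{i+2}D)$. **Theorem 4.4.** Complete resolutions $TC$ and $TD$ as above exist. For every choice of $TC$, $TD$ and of the lift, with $\widetilde t_1,\dots,\widetilde t_c$, of $C$, the $Q$-module $\bigoplus_{i\ge0}\operatorname{Hom}_Q(TC,\Sigma^iTD)$ is annihilated by $(f_1,\dots,f_c)$, hence is an $R$-module, and $$\bigoplus_{i\ge0}\operatorname{Hom}_Q(TC,\Sigma^iTD)\ \text{ is a finitely generated } R\text{-module}$$ if and only if $$\bigoplus_{i\ge0}\operatorname{Hom}_R(C,\Sigma^iD)\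 \text{ is a finitely generated } R[\chi_1,\dots,\chi_c]\text{-module}.$$ -/

import Mathlib

open CategoryTheory TensorProduct DirectSum

universe u

namespace TotallyAcyclic

noncomputable section

/-! ## Quotients by regular sequences -/

/-- The `Q`-algebra `R` is the quotient of `Q` by the regular sequence `f 0, …, f (c - 1)`. -/
structure IsRegularQuotient {Q : Type u} [CommRing Q] {c : ℕ} (f : Fin c → Q)
    (R : Type u) [CommRing R] [Algebra Q R] : Prop where
  regular : RingTheory.Sequence.IsRegular Q (List.ofFn f)
  surjective : Function.Surjective (algebraMap Q R)
  ker_eq : RingHom.ker (algebraMap Q R) = Ideal.span (Set.range f)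

theorem IsRegularQuotient.quotient {Q : Type u} [CommRing Q] {c : ℕ} {f : Fin c → Q}
    (hf : RingTheory.Sequence.IsRegular Q (List.ofFn f)) :
    IsRegularQuotient f (Q ⧸ Ideal.span (Set.range f)) :=
  ⟨hf, Ideal.Quotient.mk_surjective, Ideal.mk_ker⟩

section RegularSequences

variable {Q : Type u} [CommRing Q]

/-- The map `(y k) ↦ ∑ k, f k • y k`. -/
def smulSum {n : ℕ} (f : Fin n → Q) (M : Type u) [AddCommGroup M] [Module Q M] :
    (Fin n → M) →ₗ[Q] M :=
  ∑ k, f k • LinearMap.proj k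

theorem smulSum_apply {n : ℕ} (f : Fin n → Q) {M : Type u} [AddCommGroup M] [Module Q M]
    (y : Fin n → M) : smulSum f M y = ∑ k, f k • y k := by
  simp [smulSum]

theorem range_smulSum {n : ℕ} (f : Fin n → Q) (M : Type u) [AddCommGroup M] [Module Q M] :
    LinearMap.range (smulSum f M) = Ideal.span (Set.range f) • (⊤ : Submodule Q M) := by
  apply le_antisymm
  · rintro _ ⟨y, rfl⟩
    rw [smulSum_apply]
    exact Submodule.sum_mem _ fun k _ =>
      Submodule.smul_mem_smul (Ideal.subset_span ⟨k, rfl⟩) trivial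
  · rw [Submodule.smul_le]
    rintro r hr m -
    obtain ⟨a, rfl⟩ := Ideal.mem_span_range_iff_exists_fun.1 hr
    refine ⟨fun k => a k • m, ?_⟩
    rw [smulSum_apply, Finset.sum_smul]
    exact Finset.sum_congr rfl fun k _ => by rw [smul_smul, mul_comm]

theorem mem_smul_top_of_sum_eq_zero_aux {M : Type u} [AddCommGroup M] [Module Q M] {n : ℕ}
    (f : Fin n → Q)
    (reg : ∀ (i : Fin n) (x : M),
      f i • x ∈ Ideal.span (f '' {j | j < i}) • (⊤ : Submodule Q M) →
        x ∈ Ideal.span (f '' {j | j < i}) • (⊤ : Submodule Q M))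
    (x : Fin n → M) (h : ∑ j, f j • x j = 0) (j : Fin n) :
    x j ∈ Ideal.span (Set.range f) • (⊤ : Submodule Q M) := by
  induction n with
  | zero => exact j.elim0
  | succ n ih =>
    have himg : f '' {j | j < Fin.last n} = Set.range (fun i : Fin n => f i.castSucc) := by
      ext y
      constructor
      · rintro ⟨k, hk, rfl⟩
        exact ⟨k.castLT (by simpa [Fin.lt_def] using hk), by simp⟩
      · rintro ⟨k, rfl⟩
        exact ⟨k.castSucc, Fin.castSucc_lt_last k, rfl⟩
    have hle : Ideal.span (Set.range (fun i : Fin n => f i.castSucc)) ≤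
        Ideal.span (Set.range f) :=
      Ideal.span_mono (by rintro _ ⟨k, rfl⟩; exact ⟨_, rfl⟩)
    have hle' := Submodule.smul_mono_left (N := (⊤ : Submodule Q M)) hle
    rw [Fin.sum_univ_castSucc] at h
    have hlast : x (Fin.last n) ∈
        Ideal.span (Set.range (fun i : Fin n => f i.castSucc)) • (⊤ : Submodule Q M) := by
      rw [← himg]
      apply reg
      rw [himg, ← neg_eq_of_add_eq_zero_right h]
      exact neg_mem (Submodule.sum_mem _ fun k _ =>
        Submodule.smul_mem_smul (Ideal.subset_span ⟨k, rfl⟩) trivial)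
    obtain ⟨y, hy⟩ : ∃ y : Fin n → M, ∑ k, f k.castSucc • y k = x (Fin.last n) := by
      rw [← range_smulSum] at hlast
      obtain ⟨y, hy⟩ := hlast
      exact ⟨y, by rw [← hy, smulSum_apply]⟩
    have h' : ∑ k : Fin n, f k.castSucc • (x k.castSucc + f (Fin.last n) • y k) = 0 := by
      rw [← h, ← hy, Finset.smul_sum, ← Finset.sum_add_distrib]
      exact Finset.sum_congr rfl fun k _ => by rw [smul_add, smul_comm]
    have hih := ih (fun k => f k.castSucc) (by
      intro i z hz
      have : (fun k : Fin n => f k.castSucc) '' {j | j < i} = f '' {j | j < i.castSucc} := by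
        ext w
        constructor
        · rintro ⟨k, hk, rfl⟩
          exact ⟨k.castSucc, hk, rfl⟩
        · rintro ⟨k, hk, rfl⟩
          have hk' : (k : ℕ) < n := lt_trans hk i.2
          exact ⟨k.castLT hk', hk, by simp⟩
      rw [this] at hz ⊢
      exact reg _ _ hz) _ h'
    refine Fin.lastCases (hle' hlast) (fun k => ?_) j
    have h2 : f (Fin.last n) • y k ∈ Ideal.span (Set.range f) • (⊤ : Submodule Q M) :=
      Submodule.smul_mem_smul (Ideal.subset_span ⟨_, rfl⟩) trivial
    simpa using sub_mem (hle' (hih k)) h2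

/-- A linear relation with coefficients in a regular sequence has, in a free module, all its
terms in the submodule generated by the sequence. -/
theorem mem_smul_top_of_sum_eq_zero {c : ℕ} {f : Fin c → Q}
    (hf : RingTheory.Sequence.IsRegular Q (List.ofFn f))
    {M : Type u} [AddCommGroup M] [Module Q M] [Module.Free Q M]
    (x : Fin c → M) (h : ∑ j, f j • x j = 0) (j : Fin c) :
    x j ∈ Ideal.span (Set.range f) • (⊤ : Submodule Q M) := by
  refine mem_smul_top_of_sum_eq_zero_aux f (fun i z hz => ?_) x h j
  have hM : RingTheory.Sequence.IsWeaklyRegular M (List.ofFn f) :=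
    ((TensorProduct.rid Q M).isWeaklyRegular_congr _).1
      (RingTheory.Sequence.IsWeaklyRegular.isWeaklyRegular_lTensor (M₂ := M)
        hf.toIsWeaklyRegular)
  have hi := hM.regular_mod_prev i (by simp)
  have hI : Ideal.ofList ((List.ofFn f).take i) = Ideal.span (f '' {j | j < i}) := by
    rw [Ideal.ofList]
    congr 1
    ext y
    simp only [Set.mem_ofPred_eq, List.mem_take_iff_getElem, List.getElem_ofFn, Set.mem_image]
    constructor
    · rintro ⟨k, hk, rfl⟩
      exact ⟨⟨k, by simp at hk; omega⟩, by rw [Fin.lt_def]; simp at hk ⊢; omega, rfl⟩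
    · rintro ⟨k, hk, rfl⟩
      rw [Fin.lt_def] at hk
      exact ⟨k, by simp; omega, rfl⟩
  rw [← hI] at hz ⊢
  rw [← Submodule.Quotient.mk_eq_zero] at hz ⊢
  apply hi
  simpa using hz

/-- A linear map out of a free module with values in `(f) Y` is a combination of the `f k`. -/
theorem exists_eq_sum_smul {c : ℕ} (f : Fin c → Q) {X Y : Type u} [AddCommGroup X] [Module Q X]
    [Module.Free Q X] [AddCommGroup Y] [Module Q Y] (g : X →ₗ[Q] Y)
    (hg : ∀ x, g x ∈ Ideal.span (Set.range f) • (⊤ : Submodule Q Y)) :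
    ∃ τ : Fin c → X →ₗ[Q] Y, g = ∑ k, f k • τ k := by
  obtain ⟨s, hs⟩ := Module.projective_lifting_property (smulSum f Y).rangeRestrict
    (g.codRestrict _ fun x => by rw [range_smulSum]; exact hg x)
    (LinearMap.surjective_rangeRestrict _)
  refine ⟨fun k => LinearMap.proj k ∘ₗ s, LinearMap.ext fun x => ?_⟩
  have := congrArg Subtype.val (LinearMap.congr_fun hs x)
  simpa [smulSum_apply] using this.symm

variable {R : Type u} [CommRing R] [Algebra Q R]

theorem IsRegularQuotient.one_tmul_eq_zero_iff {c : ℕ} {f : Fin c → Q}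
    (h : IsRegularQuotient f R) {M : Type u} [AddCommGroup M] [Module Q M] (y : M) :
    (1 : R) ⊗ₜ[Q] y = 0 ↔ y ∈ Ideal.span (Set.range f) • (⊤ : Submodule Q M) := by
  constructor
  · intro hy
    have hex := rTensor_exact M
      (f := (Ideal.span (Set.range f)).subtype) (g := Algebra.linearMap Q R)
      (by
        intro q
        have : q ∈ RingHom.ker (algebraMap Q R) ↔ q ∈ Ideal.span (Set.range f) := by
          rw [h.ker_eq]
        simpa [RingHom.mem_ker] using this) h.surjective
    obtain ⟨z, hz⟩ := (hex ((1 : Q) ⊗ₜ[Q] y)).1 (by simpa using hy)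
    have hz' := congrArg (TensorProduct.lid Q M) hz
    rw [TensorProduct.lid_tmul, one_smul] at hz'
    rw [← hz']
    clear hz hz' hex
    induction z using TensorProduct.induction_on with
    | zero => simp
    | tmul a m => simpa using Submodule.smul_mem_smul a.2 (Submodule.mem_top (x := m))
    | add a b ha hb => simpa using add_mem ha hb
  · intro hy
    induction hy using Submodule.smul_induction_on' with
    | smul r hr n hn =>
      have : algebraMap Q R r = 0 := by
        rw [← RingHom.mem_ker, h.ker_eq]; exact hr
      rw [← TensorProduct.smul_tmul, Algebra.smul_def, this, zero_mul, TensorProduct.zero_tmul]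
    | add a _ b _ ha hb => rw [TensorProduct.tmul_add, ha, hb, add_zero]

theorem IsRegularQuotient.baseChange_eq_zero {c : ℕ} {f : Fin c → Q}
    (h : IsRegularQuotient f R) {X Y : Type u} [AddCommGroup X] [Module Q X]
    [AddCommGroup Y] [Module Q Y] (g : X →ₗ[Q] Y)
    (hg : ∀ x, g x ∈ Ideal.span (Set.range f) • (⊤ : Submodule Q Y)) :
    g.baseChange R = 0 := by
  ext x
  simpa using (h.one_tmul_eq_zero_iff (g x)).2 (hg x)

theorem IsRegularQuotient.mem_of_baseChange_eq_zero {c : ℕ} {f : Fin c → Q}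
    (h : IsRegularQuotient f R) {X Y : Type u} [AddCommGroup X] [Module Q X]
    [AddCommGroup Y] [Module Q Y] (g : X →ₗ[Q] Y) (hg : g.baseChange R = 0) (x : X) :
    g x ∈ Ideal.span (Set.range f) • (⊤ : Submodule Q Y) := by
  rw [← h.one_tmul_eq_zero_iff (R := R), ← LinearMap.baseChange_tmul, hg, LinearMap.zero_apply]

theorem IsRegularQuotient.baseChange_eq_zero_of_sum {c : ℕ} {f : Fin c → Q}
    (h : IsRegularQuotient f R) {X Y : Type u} [AddCommGroup X] [Module Q X]
    [AddCommGroup Y] [Module Q Y] [Module.Free Q Y] (g : Fin c → X →ₗ[Q] Y)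
    (hg : ∑ k, f k • g k = 0) (k : Fin c) : (g k).baseChange R = 0 :=
  h.baseChange_eq_zero _ fun x =>
    mem_smul_top_of_sum_eq_zero h.regular (fun k => g k x)
      (by simpa using LinearMap.congr_fun hg x) k

end RegularSequences

/-! ## Totally acyclic complexes

Complexes are written with upper indices: a chain complex `C` is the cochain complex with
`C.X n = C_{-n}`.  Thus `Σ^i C` is `C⟦i⟧` and `d_0 : C_0 → C_{-1}` is `C.d 0 1`. -/

/-- `C` is a complex of finitely generated free modules such that `C` and `Hom(C, A)` are exact. -/
structure IsTotallyAcyclic {A : Type u} [CommRing A] (C : CochainComplex (ModuleCat.{u} A) ℤ) :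
    Prop where
  finite : ∀ n, Module.Finite A (C.X n)
  free : ∀ n, Module.Free A (C.X n)
  acyclic : C.Acyclic
  dual_exact : ∀ n : ℤ, Function.Exact
    (Module.Dual.transpose (R := A) (C.d (n + 1) (n + 2)).hom)
    (Module.Dual.transpose (R := A) (C.d n (n + 1)).hom)

/-- A complex, viewed in the homotopy category. -/
abbrev toK {A : Type u} [CommRing A] (C : CochainComplex (ModuleCat.{u} A) ℤ) :
    HomotopyCategory (ModuleCat.{u} A) (ComplexShape.up ℤ) :=
  (HomotopyCategory.quotient _ _).obj C

/-- `⨁_{i ≥ 0} Hom(C, Σ^i D)`, where `Hom` is the module of homotopy classes of chain maps. -/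
abbrev GradedHom {A : Type u} [CommRing A] (C D : CochainComplex (ModuleCat.{u} A) ℤ) : Type u :=
  ⨁ i : ℕ, (toK C ⟶ (toK D)⟦(i : ℤ)⟧)

/-- `C` is a complete resolution of `M`: it is totally acyclic, and for some projective
resolution `P` of `M` and some `i`, the truncations `⋯ → C_{i+2} → C_{i+1} → 0` and
`⋯ → P_{i+2} → P_{i+1} → 0` are homotopy equivalent.  The chain degrees `> i` are the cochain
degrees `≤ -i - 1`. -/
def IsCompleteResolution {A : Type u} [CommRing A] (C : CochainComplex (ModuleCat.{u} A) ℤ)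
    (M : ModuleCat.{u} A) : Prop :=
  IsTotallyAcyclic C ∧ ∃ (P : ProjectiveResolution M) (i : ℤ), Nonempty (HomotopyEquiv
    (C.stupidTrunc (ComplexShape.embeddingUpIntLE (-i - 1)))
    (P.cochainComplex.stupidTrunc (ComplexShape.embeddingUpIntLE (-i - 1))))

/-- The image of `d_0 : C_0 → C_{-1}`, as a module over `Q`. -/
def imageZero (Q : Type u) [CommRing Q] {R : Type u} [CommRing R] [Algebra Q R]
    (C : CochainComplex (ModuleCat.{u} R) ℤ) : ModuleCat.{u} Q :=
  (ModuleCat.restrictScalars (algebraMap Q R)).obj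
    (ModuleCat.of R (LinearMap.range (C.d 0 1).hom))

/-- `T` is a value at `C` of the functor `T` from totally acyclic complexes over `R` to totally
acyclic complexes over `Q`: a complete resolution over `Q` of the image of `d_0`. -/
def IsT (Q : Type u) [CommRing Q] {R : Type u} [CommRing R] [Algebra Q R]
    (C : CochainComplex (ModuleCat.{u} R) ℤ) (TC : CochainComplex (ModuleCat.{u} Q) ℤ) : Prop :=
  IsCompleteResolution TC (imageZero Q C)

/-! ## Eisenbud operators -/

section Operators

variable {Q : Type u} [CommRing Q] {R : Type u} [CommRing R] [Algebra Q R] {c : ℕ}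

/-- A lift of the complex `C` to `Q`: a sequence of maps `d` between free `Q`-modules whose base
change to `R` is `C`, with a decomposition `d ∘ d = ∑ k, f k • t k`.  Only the values `d i j`
with `j = i + 1` and `t k i j` with `j = i + 2` are relevant. -/
structure Lift (f : Fin c → Q) (C : CochainComplex (ModuleCat.{u} R) ℤ) where
  X : ℤ → ModuleCat.{u} Q
  free : ∀ n, Module.Free Q (X n)
  d : ∀ i j, X i →ₗ[Q] X j
  t : Fin c → ∀ i j, X i →ₗ[Q] X j
  e : ∀ n, (R ⊗[Q] X n) ≃ₗ[R] C.X n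
  comm : ∀ i j, i + 1 = j →
    (e j).toLinearMap ∘ₗ (d i j).baseChange R = (C.d i j).hom ∘ₗ (e i).toLinearMap
  d_comp_d : ∀ i j l, i + 1 = j → j + 1 = l → d j l ∘ₗ d i j = ∑ k, f k • t k i l

attribute [instance] Lift.free

theorem Lift.nonempty {f : Fin c → Q} (h : IsRegularQuotient f R)
    {C : CochainComplex (ModuleCat.{u} R) ℤ} (hC : ∀ n, Module.Free R (C.X n)) :
    Nonempty (Lift f C) := by
  let X (n : ℤ) : ModuleCat.{u} Q := ModuleCat.of Q (Module.Free.ChooseBasisIndex R (C.X n) →₀ Q)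
  have free (n : ℤ) : Module.Free Q (X n) :=
    inferInstanceAs (Module.Free Q (Module.Free.ChooseBasisIndex R (C.X n) →₀ Q))
  let e (n : ℤ) : (R ⊗[Q] X n) ≃ₗ[R] C.X n :=
    (TensorProduct.finsuppScalarRight Q R R _) ≪≫ₗ (Module.Free.chooseBasis R (C.X n)).repr.symm
  have hd (i j : ℤ) : ∃ d : X i →ₗ[Q] X j,
      (e j).toLinearMap ∘ₗ d.baseChange R = (C.d i j).hom ∘ₗ (e i).toLinearMap := by
    have hsurj : Function.Surjective (TensorProduct.mk Q R (X j) 1) := by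
      intro z
      induction z using TensorProduct.induction_on with
      | zero => exact ⟨0, by simp⟩
      | tmul r x =>
        obtain ⟨q, rfl⟩ := h.surjective r
        exact ⟨q • x, by simp [Algebra.algebraMap_eq_smul_one, TensorProduct.smul_tmul]⟩
      | add a b ha hb =>
        obtain ⟨a, rfl⟩ := ha
        obtain ⟨b, rfl⟩ := hb
        exact ⟨a + b, by simp [TensorProduct.tmul_add]⟩
    obtain ⟨d, hd⟩ := Module.projective_lifting_property (TensorProduct.mk Q R (X j) 1)
      (((e j).symm.toLinearMap ∘ₗ (C.d i j).hom ∘ₗ (e i).toLinearMap).restrictScalars Q ∘ₗ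
        TensorProduct.mk Q R (X i) 1) hsurj
    refine ⟨d, ?_⟩
    refine LinearMap.ext fun z => (e j).symm.injective ?_
    suffices H : d.baseChange R =
        (e j).symm.toLinearMap ∘ₗ (C.d i j).hom ∘ₗ (e i).toLinearMap by
      simpa using LinearMap.congr_fun H z
    ext x
    simpa using LinearMap.congr_fun hd (Finsupp.single x 1)
  choose d hd using hd
  have ht (i l : ℤ) : ∃ t : Fin c → X i →ₗ[Q] X l,
      ∀ j, i + 1 = j → j + 1 = l → d j l ∘ₗ d i j = ∑ k, f k • t k := by
    by_cases hil : i + 1 + 1 = l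
    · obtain ⟨t, ht⟩ := exists_eq_sum_smul f (d (i + 1) l ∘ₗ d i (i + 1))
        (h.mem_of_baseChange_eq_zero _ (by
          refine LinearMap.ext fun z => (e l).injective ?_
          have h1 := LinearMap.congr_fun (hd i (i + 1)) z
          have h2 := LinearMap.congr_fun (hd (i + 1) l) ((d i (i + 1)).baseChange R z)
          have h3 := LinearMap.congr_fun (congrArg ModuleCat.Hom.hom (C.d_comp_d i (i + 1) l))
            (e i z)
          simp only [LinearMap.comp_apply, LinearEquiv.coe_coe, ModuleCat.hom_comp] at h1 h2 h3
          rw [LinearMap.baseChange_comp, LinearMap.comp_apply, h2, h1, h3]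
          simp))
      exact ⟨t, by rintro j rfl -; exact ht⟩
    · exact ⟨0, by rintro j rfl hj; exact absurd hj hil⟩
  choose t ht using ht
  exact ⟨{ X := X, free := free, d := d, t := fun k i j => t i j k, e := e
           comm := fun i j _ => hd i j
           d_comp_d := fun i j l hij hjl => ht i l j hij hjl }⟩

variable {f : Fin c → Q} {C : CochainComplex (ModuleCat.{u} R) ℤ}

/-- A map between terms of the lift, reduced to `R`. -/
def Lift.reduce (L : Lift f C) {i j : ℤ} (g : L.X i →ₗ[Q] L.X j) : C.X i ⟶ C.X j :=
  ModuleCat.ofHom ((L.e j).toLinearMap ∘ₗ g.baseChange R ∘ₗ (L.e i).symm.toLinearMap)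

theorem Lift.reduce_comp (L : Lift f C) {i j l : ℤ} (g : L.X i →ₗ[Q] L.X j)
    (g' : L.X j →ₗ[Q] L.X l) : L.reduce (g' ∘ₗ g) = L.reduce g ≫ L.reduce g' := by
  ext x
  simp [Lift.reduce, LinearMap.baseChange_comp]

theorem Lift.reduce_d (L : Lift f C) {i j : ℤ} (h : i + 1 = j) :
    L.reduce (L.d i j) = C.d i j := by
  ext x
  have := LinearMap.congr_fun (L.comm i j h) ((L.e i).symm x)
  simpa [Lift.reduce] using this

theorem Lift.reduce_add (L : Lift f C) {i j : ℤ} (g g' : L.X i →ₗ[Q] L.X j) :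
    L.reduce (g + g') = L.reduce g + L.reduce g' := by
  ext x
  simp [Lift.reduce, LinearMap.baseChange_add]

theorem Lift.reduce_sub (L : Lift f C) {i j : ℤ} (g g' : L.X i →ₗ[Q] L.X j) :
    L.reduce (g - g') = L.reduce g - L.reduce g' := by
  ext x
  simp [Lift.reduce, LinearMap.baseChange_sub]

theorem Lift.reduce_eq_zero (h : IsRegularQuotient f R) (L : Lift f C) {i j : ℤ}
    (g : Fin c → L.X i →ₗ[Q] L.X j) (hg : ∑ k, f k • g k = 0) (k : Fin c) :
    L.reduce (g k) = 0 := by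
  ext x
  simp [Lift.reduce, h.baseChange_eq_zero_of_sum g hg k]

theorem Lift.d_comm_t (h : IsRegularQuotient f R) (L : Lift f C) (k : Fin c) {i i' j j' : ℤ}
    (hi : i + 1 = i') (hj : j + 1 = j') (hij : i + 2 = j) :
    L.reduce (L.d j j' ∘ₗ L.t k i j) = L.reduce (L.t k i' j' ∘ₗ L.d i i') := by
  rw [← sub_eq_zero, ← Lift.reduce_sub]
  refine L.reduce_eq_zero h (fun k => L.d j j' ∘ₗ L.t k i j - L.t k i' j' ∘ₗ L.d i i') ?_ k
  have h1 := L.d_comp_d i i' j hi (by omega)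
  have h2 := L.d_comp_d i' j j' (by omega) hj
  have h3 : L.d j j' ∘ₗ (L.d i' j ∘ₗ L.d i i') = (L.d j j' ∘ₗ L.d i' j) ∘ₗ L.d i i' := rfl
  rw [h1, h2, ← sub_eq_zero] at h3
  rw [← h3]
  ext x
  simp [smul_sub, Finset.sum_sub_distrib]

/-- The Eisenbud operator `t_k : C → Σ² C` of a lift, as a chain map. -/
def Lift.chainMap (h : IsRegularQuotient f R) (L : Lift f C) (k : Fin c) :
    ShiftedHom C C (2 : ℤ) where
  f i := L.reduce (L.t k i (i + 2))
  comm' i j hij := by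
    change i + 1 = j at hij
    have hc := L.d_comm_t h k (i := i) (i' := j) (j := i + 2) (j' := j + 2) hij
      (by omega) rfl
    rw [Lift.reduce_comp, Lift.reduce_comp, L.reduce_d hij, L.reduce_d (by omega)] at hc
    refine Eq.trans ?_ hc
    change L.reduce (L.t k i (i + 2)) ≫ ((2 : ℤ).negOnePow • C.d (i + 2) (j + 2)) = _
    rw [Int.negOnePow_even 2 (by decide), one_smul]

/-- The class of the Eisenbud operator `t_k : C → Σ² C` in the homotopy category. -/
def Lift.operator (h : IsRegularQuotient f R) (L : Lift f C) (k : Fin c) :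
    ShiftedHom (toK C) (toK C) (2 : ℤ) :=
  (L.chainMap h k).map (HomotopyCategory.quotient _ _)

theorem Lift.chainMap_comp_f (h : IsRegularQuotient f R) (L : Lift f C) (j k : Fin c) (i : ℤ) :
    ((L.chainMap h j).comp (L.chainMap h k) (show (2 : ℤ) + 2 = 4 by norm_num)).f i =
      L.reduce (L.t k (i + 2) (i + 4) ∘ₗ L.t j i (i + 2)) := by
  have key (l : ℤ) (hl : i + 2 + 2 = l) :
      L.reduce (L.t k (i + 2) (i + 2 + 2)) ≫ (C.XIsoOfEq hl).hom =
        L.reduce (L.t k (i + 2) l) := by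
    subst hl
    simp
  rw [Lift.reduce_comp, ← key (i + 4) (by omega)]
  simp only [ShiftedHom.comp, HomologicalComplex.comp_f, CochainComplex.shiftFunctor_map_f']
  rw [CochainComplex.shiftFunctorAdd'_inv_app_f']
  rfl

theorem Lift.exists_homotopy (h : IsRegularQuotient f R) (L : Lift f C) (k : Fin c) (i l : ℤ)
    (hl : i + 3 = l) : ∃ τ : Fin c → L.X i →ₗ[Q] L.X l,
      ∀ i' l', i + 1 = i' → l' + 1 = l →
        L.t k i' l ∘ₗ L.d i i' - L.d l' l ∘ₗ L.t k i l' = ∑ m, f m • τ m := by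
  obtain ⟨τ, hτ⟩ := exists_eq_sum_smul f
    (L.t k (i + 1) l ∘ₗ L.d i (i + 1) - L.d (i + 2) l ∘ₗ L.t k i (i + 2))
    (h.mem_of_baseChange_eq_zero _ (by
      have := L.d_comm_t h k (i := i) (i' := i + 1) (j := i + 2) (j' := l) rfl (by omega) rfl
      rw [eq_comm, ← sub_eq_zero, ← Lift.reduce_sub] at this
      refine LinearMap.ext fun z => (L.e l).injective ?_
      have := LinearMap.congr_fun (congrArg ModuleCat.Hom.hom this) (L.e i z)
      simpa [Lift.reduce] using this))
  refine ⟨τ, ?_⟩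
  rintro i' l' rfl hl'
  obtain rfl : l' = i + 2 := by omega
  exact hτ

/-- Eisenbud operators commute up to homotopy. -/
theorem Lift.operator_comm (h : IsRegularQuotient f R) (L : Lift f C) (j k : Fin c) :
    (L.operator h j).comp (L.operator h k) (show (2 : ℤ) + 2 = 4 by norm_num) =
      (L.operator h k).comp (L.operator h j) (show (2 : ℤ) + 2 = 4 by norm_num) := by
  unfold Lift.operator
  rw [← ShiftedHom.map_comp, ← ShiftedHom.map_comp]
  unfold ShiftedHom.map
  congr 1
  refine HomotopyCategory.eq_of_homotopy _ _ ?_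
  choose τ hτ using L.exists_homotopy h k
  let s (i l : ℤ) : C.X i ⟶ C.X (l + 4) :=
    if hl : i + 3 = l + 4 then L.reduce (τ i (l + 4) hl j) else 0
  have hs (i l : ℤ) (hl : i + 3 = l + 4) : s i l = L.reduce (τ i (l + 4) hl j) := dif_pos hl
  refine
    { hom := s
      zero := fun i l hil => dif_neg fun hl => hil (by change l + 1 = i; omega)
      comm := fun i => ?_ }
  have hd : ((C⟦(4 : ℤ)⟧).d (i - 1) i) = C.d (i - 1 + 4) (i + 4) := by
    change ((4 : ℤ).negOnePow • C.d (i - 1 + 4) (i + 4)) = _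
    rw [Int.negOnePow_even 4 (by decide), one_smul]
  refine (L.chainMap_comp_f h j k i).trans (Eq.trans ?_ (congrArg₂ (· + ·)
    (congrArg₂ (· + ·) (dNext_eq _ (show i + 1 = i + 1 from rfl))
      (prevD_eq _ (show (i - 1) + 1 = i by omega))) (L.chainMap_comp_f h k j i)).symm)
  rw [hd]
  suffices H : L.reduce (L.t k (i + 2) (i + 4) ∘ₗ L.t j i (i + 2)) -
      L.reduce (L.t j (i + 2) (i + 4) ∘ₗ L.t k i (i + 2)) =
      C.d i (i + 1) ≫ s (i + 1) i + s i (i - 1) ≫ C.d (i - 1 + 4) (i + 4) from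
    sub_eq_iff_eq_add.1 H
  rw [hs _ _ (by omega), hs _ _ (by omega)]
  rw [← L.reduce_d (i := i) rfl, ← L.reduce_d (i := i - 1 + 4) (j := i + 4) (by omega),
    ← Lift.reduce_comp, ← Lift.reduce_comp, ← Lift.reduce_add, ← Lift.reduce_sub, ← sub_eq_zero,
    ← Lift.reduce_sub]
  refine L.reduce_eq_zero h (fun m =>
    L.t k (i + 2) (i + 4) ∘ₗ L.t m i (i + 2) - L.t m (i + 2) (i + 4) ∘ₗ L.t k i (i + 2) -
      (τ (i + 1) (i + 4) (by omega) m ∘ₗ L.d i (i + 1) +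
        L.d (i - 1 + 4) (i + 4) ∘ₗ τ i (i - 1 + 4) (by omega) m)) ?_ j
  have h1 := L.d_comp_d i (i + 1) (i + 2) rfl (by omega)
  have h2 := L.d_comp_d (i + 2) (i - 1 + 4) (i + 4) (by omega) (by omega)
  have h3 := hτ (i + 1) (i + 4) (by omega) (i + 2) (i - 1 + 4) (by omega) (by omega)
  have h4 := hτ i (i - 1 + 4) (by omega) (i + 1) (i + 2) (by omega) (by omega)
  ext x
  have h1 := LinearMap.congr_fun h1 x
  have h2 := LinearMap.congr_fun h2 (L.t k i (i + 2) x)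
  have h3 := LinearMap.congr_fun h3 (L.d i (i + 1) x)
  have h4 := LinearMap.congr_fun h4 x
  have h1 := congrArg (L.t k (i + 2) (i + 4)) h1
  have h4 := congrArg (L.d (i - 1 + 4) (i + 4)) h4
  simp only [LinearMap.comp_apply, LinearMap.sub_apply, LinearMap.coe_sum, LinearMap.smul_apply,
    Finset.sum_apply, map_sum, map_smul, map_sub, LinearMap.add_apply, LinearMap.zero_apply,
    smul_sub, smul_add, Finset.sum_sub_distrib, Finset.sum_add_distrib] at h1 h2 h3 h4 ⊢
  rw [← h1, ← h2, ← h3, ← h4]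
  abel

/-! ## The ring of cohomology operators -/

/-- The action of `χ_k`: it sends `α : C → Σ^i D` to the composite
`C → Σ² C → Σ^{i + 2} D` of `t_k` and `Σ² α`. -/
def Lift.chi (h : IsRegularQuotient f R) (L : Lift f C)
    (D : CochainComplex (ModuleCat.{u} R) ℤ) (k : Fin c) :
    GradedHom C D →ₗ[R] GradedHom C D :=
  DirectSum.toModule R ℕ _ fun i =>
    DirectSum.lof R ℕ (fun i : ℕ => (toK C ⟶ (toK D)⟦(i : ℤ)⟧)) (i + 2) ∘ₗ
      { toFun := fun α : ShiftedHom (toK C) (toK D) (i : ℤ) =>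
          (L.operator h k).comp α (show (i : ℤ) + 2 = ((i + 2 : ℕ) : ℤ) by push_cast; rfl)
        map_add' := fun α β => by simp
        map_smul' := fun r α => by simp }

theorem Lift.chi_lof (h : IsRegularQuotient f R) (L : Lift f C)
    (D : CochainComplex (ModuleCat.{u} R) ℤ) (k : Fin c) (i : ℕ)
    (α : ShiftedHom (toK C) (toK D) (i : ℤ)) :
    L.chi h D k (DirectSum.lof R ℕ (fun i : ℕ => (toK C ⟶ (toK D)⟦(i : ℤ)⟧)) i α) =
      DirectSum.lof R ℕ (fun i : ℕ => (toK C ⟶ (toK D)⟦(i : ℤ)⟧)) (i + 2)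
        ((L.operator h k).comp α (show (i : ℤ) + 2 = ((i + 2 : ℕ) : ℤ) by push_cast; rfl)) := by
  simp [Lift.chi]

theorem Lift.chi_comm (h : IsRegularQuotient f R) (L : Lift f C)
    (D : CochainComplex (ModuleCat.{u} R) ℤ) (j k : Fin c) :
    L.chi h D j * L.chi h D k = L.chi h D k * L.chi h D j := by
  refine DirectSum.linearMap_ext R fun i => LinearMap.ext fun α => ?_
  simp only [LinearMap.comp_apply, Module.End.mul_apply, Lift.chi_lof]
  congr 1
  rw [← ShiftedHom.comp_assoc _ _ _ (show (2 : ℤ) + 2 = 4 by norm_num) _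
      (by push_cast; ring),
    ← ShiftedHom.comp_assoc _ _ _ (show (2 : ℤ) + 2 = 4 by norm_num) _ (by push_cast; ring),
    L.operator_comm]

/-- The ring homomorphism `R[χ_1, …, χ_c] → End(⨁_{i ≥ 0} Hom(C, Σ^i D))` with `χ_k ↦ chi k`. -/
def Lift.chiHom (h : IsRegularQuotient f R) (L : Lift f C)
    (D : CochainComplex (ModuleCat.{u} R) ℤ) :
    MvPolynomial (Fin c) R →ₐ[R] Module.End R (GradedHom C D) :=
  letI : CommRing (Algebra.adjoin R (Set.range (L.chi h D))) :=
    { (Algebra.adjoin R (Set.range (L.chi h D))).toRing with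
      mul_comm := (Algebra.isMulCommutative_adjoin R (by
        rintro _ ⟨j, rfl⟩ _ ⟨k, rfl⟩
        exact L.chi_comm h D j k)).is_comm.comm }
  (Algebra.adjoin R (Set.range (L.chi h D))).val.comp
    (MvPolynomial.aeval fun k => ⟨L.chi h D k, Algebra.subset_adjoin ⟨k, rfl⟩⟩)

/-- `⨁_{i ≥ 0} Hom(C, Σ^i D)` as a module over the ring of cohomology operators
`R[χ_1, …, χ_c]`. -/
def OperatorModule (_ : IsRegularQuotient f R) (_ : Lift f C)
    (D : CochainComplex (ModuleCat.{u} R) ℤ) : Type u :=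
  GradedHom C D

instance (h : IsRegularQuotient f R) (L : Lift f C) (D : CochainComplex (ModuleCat.{u} R) ℤ) :
    AddCommGroup (OperatorModule h L D) :=
  inferInstanceAs (AddCommGroup (GradedHom C D))

instance (h : IsRegularQuotient f R) (L : Lift f C) (D : CochainComplex (ModuleCat.{u} R) ℤ) :
    Module R (OperatorModule h L D) :=
  inferInstanceAs (Module R (GradedHom C D))

instance (h : IsRegularQuotient f R) (L : Lift f C) (D : CochainComplex (ModuleCat.{u} R) ℤ) :
    Module (MvPolynomial (Fin c) R) (OperatorModule h L D) :=
  Module.compHom (GradedHom C D) (L.chiHom h D).toRingHom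

theorem OperatorModule.C_smul (h : IsRegularQuotient f R) (L : Lift f C)
    (D : CochainComplex (ModuleCat.{u} R) ℤ) (r : R) (α : OperatorModule h L D) :
    MvPolynomial.C (σ := Fin c) r • α = r • α := by
  change (L.chiHom h D (MvPolynomial.C r)) α = _
  rw [← MvPolynomial.algebraMap_eq, AlgHom.commutes]
  rfl

theorem OperatorModule.X_smul (h : IsRegularQuotient f R) (L : Lift f C)
    (D : CochainComplex (ModuleCat.{u} R) ℤ) (k : Fin c) (α : OperatorModule h L D) :
    MvPolynomial.X (R := R) k • α = (L.chi h D k : GradedHom C D → GradedHom C D) α := by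
  change (L.chiHom h D (MvPolynomial.X k)) α = _
  simp [Lift.chiHom]

end Operators

end

end TotallyAcyclic

/-!
Write `R = Q / (f)`. A lift of `C` to `Q` is not a complex, but its square is `∑ k, f k • t k`. The
cone of `t j` over a sequence of maps whose square is `∑ k ≤ j, f k • t k` can be perturbed, by the
multiplication with `f j`, to a sequence whose square involves the `f k` with `k < j` only
(`CurvedComplex.step`), and `c` such cones turn the lift of `C` into a complex `T` over `Q`
(`CurvedComplex.resolve`). Exactness modulo `f 0, …, f j` becomes exactness modulo
`f 0, …, f (j - 1)` in each step, because `f j` is regular (`IsRegularStep.exact_cone`); applied to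
the sequence, its dual and its truncation, this shows that `T` is a complete resolution over `Q` of
the image of `d_0` (`Lift.isT_resolution`). Complete resolutions are unique up to homotopy
(`IsCompleteResolution.nonempty_iso`), and a ring element that annihilates a module annihilates its
complete resolution up to homotopy (`IsCompleteResolution.smul_id_eq_zero`). So `TC` and `TD` may be
taken to be these complexes, and the `f k` annihilate all maps between them.

Over `Q` each `Hom(TC, Σ^i TD)` is finitely generated (`IsTotallyAcyclic.finite_hom`), so that
finite generation of their sum means that they vanish for large `i`. Applied to the complexes of
homomorphisms with values in the lift of `D` and its cones, the argument above shows that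
`Hom(TC, Σ^i TD)` vanishes if and only if `Hom(TC ⊗ R, Σ^i D)` does (`hom_toComplex_eq_zero_iff`).

Over `R` the complex `TC ⊗ R` is obtained from `C` by taking successively the cones of `c` operators
(`CurvedComplex.exists_distinguished_step`). Operators are natural (`Lift.operator_comp`), so all
those on maps to `D` can be computed on `D`, and a cone gives an exact sequence of modules over the
ring of cohomology operators. As this ring is noetherian, the cone of one operator has finitely
generated maps to `D` if and only if the given complex does
(`eventuallyGenerated_iff_of_distinguished`). Finally all operators vanish on `TC ⊗ R`, since `TC`
is a complex over `Q`; so finite generation for `TC ⊗ R` is vanishing of `Hom(TC ⊗ R, Σ^i D)` for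
large `i`.
-/

namespace TotallyAcyclic

noncomputable section

/-! ### Maps out of totally acyclic complexes -/

open CochainComplex.HomComplex Cochain.InductionUp in
/-- A chain map that vanishes below some degree and from there on has values in terms to which
maps killing boundaries extend along the differential is null-homotopic. -/
theorem nonempty_homotopy_zero_of_extends {V : Type*} [Category* V] [Preadditive V]
    {K L : CochainComplex V ℤ} (f : K ⟶ L) (a : ℤ) (hf : ∀ n < a, f.f n = 0)
    (h : ∀ n, a ≤ n + 1 → ∀ v : K.X (n + 1) ⟶ L.X (n + 1), K.d n (n + 1) ≫ v = 0 →
      ∃ β : K.X (n + 2) ⟶ L.X (n + 1), K.d (n + 1) (n + 2) ≫ β = v) :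
    Nonempty (Homotopy f 0) := by
  have step (α : Cochain K L (-1)) (n m : ℤ) (hnm : n + 1 = m) (hm : a ≤ m)
      (hα : (δ (-1) 0 α).EqUpTo (Cochain.ofHom f) n) :
      ∃ (h : K.X (n + 2) ⟶ L.X (n + 1)),
        (δ (-1) 0 (α + Cochain.single h (-1))).EqUpTo (Cochain.ofHom f) m := by
    subst hnm
    let v := f.f (n + 1) - α.v (n + 1) n (by lia) ≫ L.d n (n + 1) -
      K.d (n + 1) (n + 2) ≫ α.v (n + 2) (n + 1) (by lia)
    have hv : K.d n (n + 1) ≫ v = 0 := by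
      have eq := hα n n (add_zero n) (by rfl)
      simp only [δ_v (-1) 0 (neg_add_cancel 1) α n n (add_zero _) (n - 1) (n + 1)
        (by lia) (by lia), Int.negOnePow_zero, one_smul, Cochain.ofHom_v] at eq
      simp only [v, Preadditive.comp_sub, HomologicalComplex.d_comp_d_assoc, Limits.zero_comp,
        ← f.comm, ← eq, Preadditive.add_comp, Category.assoc, L.d_comp_d, Limits.comp_zero,
        zero_add, sub_self]
    obtain ⟨β, hβ⟩ := h n hm v hv
    refine ⟨β, fun p q hpq hp => ?_⟩
    obtain rfl : p = q := by lia
    obtain hp | rfl := hp.lt_or_eq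
    · rw [δ_add, Cochain.add_v, hα p p (by lia) (by lia), add_eq_left,
        δ_v (-1) 0 (neg_add_cancel 1) _ p p hpq (p - 1) (p + 1) rfl rfl,
        Cochain.single_v_eq_zero _ _ _ _ _ (by lia),
        Cochain.single_v_eq_zero _ _ _ _ _ (by lia)]
      simp
    · rw [δ_v (-1) 0 (neg_add_cancel 1) _ (n + 1) (n + 1) (by lia) n (n + 2)
        (by lia) (by lia), Cochain.add_v,
        Cochain.single_v_eq_zero _ _ _ _ _ (by lia)]
      simp [hβ, v]
  let X (n : ℕ) : Set (Cochain K L (-1)) :=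
    Set.ofPred (fun α => (δ (-1) 0 α).EqUpTo (Cochain.ofHom f) (n + a - 1))
  let x₀ : X 0 := ⟨0, fun p q hpq hp => by
    obtain rfl : p = q := by lia
    simp [hf p (by lia)]⟩
  let φ (n : ℕ) (α : X n) : X (n + 1) :=
    ⟨_, (step α.1 (n + a - 1) ((n + 1 : ℕ) + a - 1) (by lia) (by lia) α.2).choose_spec⟩
  have hφ (k : ℕ) (x : X k) : (φ k x).1.EqUpTo x.1 (a + k) := fun p q hpq hp => by
    dsimp [φ]
    rw [add_eq_left, Cochain.single_v_eq_zero _ _ _ _ _ (by lia)]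
  refine ⟨(Cochain.equivHomotopy f 0).symm ⟨limitSequence φ hφ x₀, ?_⟩⟩
  rw [Cochain.ofHom_zero, add_zero]
  ext n
  let k₀ := (n - a + 1).toNat
  rw [← (sequence φ x₀ k₀).2 n n (add_zero n) (by lia),
    δ_v (-1) 0 (neg_add_cancel 1) _ n n (by lia) (n - 1) (n + 1) rfl (by lia),
    δ_v (-1) 0 (neg_add_cancel 1) _ n n (by lia) (n - 1) (n + 1) rfl (by lia),
    limitSequence_eqUpTo φ hφ x₀ k₀ n (n - 1) (by lia) (by lia),
    limitSequence_eqUpTo φ hφ x₀ k₀ (n + 1) n (by lia) (by lia)]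

attribute [local simp] CochainComplex.opEquivalence ChainComplex.cochainComplexEquivalence in
/-- The dual of `nonempty_homotopy_zero_of_extends`: maps into cycles lift along the
differential, above some degree in which the chain map vanishes. -/
theorem nonempty_homotopy_zero_of_lifts {V : Type*} [Category* V] [Preadditive V]
    {K L : CochainComplex V ℤ} (f : K ⟶ L) (a : ℤ) (hf : ∀ n, a < n → f.f n = 0)
    (h : ∀ n, ∀ v : K.X n ⟶ L.X n, v ≫ L.d n (n + 1) = 0 →
      ∃ β : K.X n ⟶ L.X (n - 1), β ≫ L.d (n - 1) n = v) :
    Nonempty (Homotopy f 0) := by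
  obtain ⟨H⟩ := nonempty_homotopy_zero_of_extends
    ((CochainComplex.opEquivalence V).functor.map f.op) (-a)
    (fun n hn => by
      have := hf (-n) (by lia)
      change (f.f (-n)).op = 0
      rw [this]; rfl) (fun n _ v hv => by
      have key : ∀ m l p : ℤ, m + 1 = l → l + 1 = p → ∀ v : K.X l ⟶ L.X l, v ≫ L.d l p = 0 →
          ∃ β : K.X l ⟶ L.X m, β ≫ L.d m l = v := by
        rintro m l p hm rfl v hv
        obtain rfl : m = l - 1 := by lia
        exact h _ v hv
      obtain ⟨β, hβ⟩ := key (-(n + 2)) (-(n + 1)) (-n) (by lia) (by lia) v.unop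
        (Quiver.Hom.op_inj (by exact hv))
      exact ⟨β.op, Quiver.Hom.unop_inj hβ⟩)
  exact ⟨CochainComplex.homotopyUnop (H.trans (.ofEq (by simp; rfl)))⟩

section

variable {A : Type u} [CommRing A]

/-- Maps from a term of a totally acyclic complex to a projective module extend along the
differential as soon as they kill the boundaries. The projective module need not be finitely
generated. -/
theorem IsTotallyAcyclic.exists_extension {T : CochainComplex (ModuleCat.{u} A) ℤ}
    (hT : IsTotallyAcyclic T) (n : ℤ) {Y : ModuleCat.{u} A} [Module.Projective A Y]
    (v : T.X (n + 1) ⟶ Y) (hv : T.d n (n + 1) ≫ v = 0) :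
    ∃ β : T.X (n + 2) ⟶ Y, T.d (n + 1) (n + 2) ≫ β = v := by
  classical
  obtain ⟨i, hi⟩ := (Module.projective_def' (R := A) (P := Y)).1 inferInstance
  -- The coordinates of `v` in a free module that has `Y` as a summand extend one by one.
  let w := i ∘ₗ v.hom
  have hw (y : Y) : ∃ ψ : T.X (n + 2) →ₗ[A] A,
      ψ ∘ₗ (T.d (n + 1) (n + 2)).hom = Finsupp.lapply y ∘ₗ w := by
    refine (hT.dual_exact n (Finsupp.lapply y ∘ₗ w)).1 ?_
    refine LinearMap.ext fun x => ?_
    have := LinearMap.congr_fun (congrArg ModuleCat.Hom.hom hv) x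
    simp only [ModuleCat.hom_comp, LinearMap.comp_apply, ModuleCat.hom_zero,
      LinearMap.zero_apply] at this
    simp [Module.Dual.transpose_apply, w, this]
  choose ψ hψ using hw
  -- Only finitely many coordinates of `w` are nonzero, as its source is finitely generated.
  obtain ⟨G, hG⟩ := (hT.finite (n + 1)).fg_top
  let S : Finset Y := G.biUnion fun x => (w x).support
  have hS (x : T.X (n + 1)) : w x = ∑ y ∈ S, Finsupp.single y (w x y) := by
    have hx : x ∈ (Finsupp.supported A A (S : Set Y)).comap w := by
      have : Submodule.span A (G : Set (T.X (n + 1))) ≤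
          (Finsupp.supported A A (S : Set Y)).comap w := by
        rw [Submodule.span_le]
        intro g hg
        rw [SetLike.mem_coe, Submodule.mem_comap, Finsupp.mem_supported]
        exact Finset.coe_subset.2 (Finset.subset_biUnion_of_mem (fun x => (w x).support) hg)
      exact this (hG ▸ Submodule.mem_top)
    rw [Submodule.mem_comap, Finsupp.mem_supported, Finset.coe_subset] at hx
    conv_lhs => rw [← Finsupp.sum_single (w x)]
    exact Finsupp.sum_of_support_subset _ hx _ (by simp)
  refine ⟨ModuleCat.ofHom (Finsupp.linearCombination A (id : Y → Y) ∘ₗ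
    ∑ y ∈ S, Finsupp.lsingle y ∘ₗ ψ y), ?_⟩
  ext x
  have h1 (y : Y) : ψ y ((T.d (n + 1) (n + 2)).hom x) = w x y := LinearMap.congr_fun (hψ y) x
  have h2 : Finsupp.linearCombination A (id : Y → Y) (w x) = v.hom x :=
    LinearMap.congr_fun hi (v.hom x)
  rw [← h2, hS x]
  simp [h1]

/-- A chain map from a totally acyclic complex to a complex of projective modules is
null-homotopic if it vanishes in all low degrees. -/
theorem IsTotallyAcyclic.map_eq_zero {T Z : CochainComplex (ModuleCat.{u} A) ℤ}
    (hT : IsTotallyAcyclic T) [∀ n, Module.Projective A (Z.X n)] (φ : T ⟶ Z) (a : ℤ)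
    (hφ : ∀ n < a, φ.f n = 0) : (HomotopyCategory.quotient _ _).map φ = 0 := by
  obtain ⟨H⟩ := nonempty_homotopy_zero_of_extends φ a hφ
    fun n _ v hv => hT.exists_extension n v hv
  rw [HomotopyCategory.eq_of_homotopy _ _ H, Functor.map_zero]

/-- A chain map between totally acyclic complexes that vanishes in one degree is
null-homotopic. -/
theorem IsTotallyAcyclic.map_eq_zero_of_f_eq_zero {X Y : CochainComplex (ModuleCat.{u} A) ℤ}
    (hX : IsTotallyAcyclic X) (hY : IsTotallyAcyclic Y) (φ : X ⟶ Y) (a : ℤ)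
    (hφ : φ.f a = 0) : (HomotopyCategory.quotient _ _).map φ = 0 := by
  have := hX.free
  have := hY.free
  -- Cutting `φ` at the degree `a` gives a sum of two chain maps.
  let φ₁ : X ⟶ Y :=
    { f := fun n => if n < a then φ.f n else 0
      comm' := by
        rintro i j (rfl : i + 1 = j)
        by_cases h : i + 1 < a
        · simp [h, show i < a by lia]
        · obtain hi | hi := eq_or_ne (i + 1) a
          · have := φ.comm i (i + 1)
            rw [hi, hφ, Limits.comp_zero] at this
            simp only [h, show i < a by lia, if_true, if_false, Limits.comp_zero]
            rw [hi]
            exact this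
          · simp [h, show ¬ i < a by lia] }
  have h₁ : (HomotopyCategory.quotient _ _).map φ₁ = 0 := by
    obtain ⟨H⟩ := nonempty_homotopy_zero_of_lifts φ₁ a
      (fun n hn => if_neg (by lia)) (fun n v hv => by
        have hex := (Y.exactAt_iff' (n - 1) n (n + 1) (by simp) (by simp)).1 (hY.acyclic n)
        exact ⟨hex.liftFromProjective v hv, hex.liftFromProjective_comp v hv⟩)
    rw [HomotopyCategory.eq_of_homotopy _ _ H, Functor.map_zero]
  have h₂ := hX.map_eq_zero (φ - φ₁) a fun n hn => by
    simp [φ₁, hn]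
  rw [Functor.map_sub, h₁, sub_zero] at h₂
  exact h₂

end

end

noncomputable section

/-! ### Brutal truncations and uniqueness of complete resolutions -/

section Truncation

open ComplexShape

variable {V : Type*} [Category* V] [Preadditive V] [Limits.HasZeroObject V]

theorem stupidTrunc_d {ι ι' : Type*} {c : ComplexShape ι} {c' : ComplexShape ι'}
    (e : c.Embedding c') [e.IsRelIff] (K : HomologicalComplex V c') {i j : ι} {i' j' : ι'}
    (hi : e.f i = i') (hj : e.f j = j') :
    (K.stupidTrunc e).d i' j' ≫ (K.stupidTruncXIso e hj).hom =
      (K.stupidTruncXIso e hi).hom ≫ K.d i' j' := by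
  subst hi hj
  have key {P P' S S' : V} (a : P ≅ P') (b : S ≅ S') (d : P' ⟶ S') :
      (a.hom ≫ d ≫ b.inv) ≫ (b ≪≫ Iso.refl _).hom = (a ≪≫ Iso.refl _).hom ≫ d := by simp
  exact (congrArg (· ≫ _) ((K.restriction e).extend_d_eq e rfl rfl)).trans (key _ _ _)

/-- The projection of a cochain complex to its brutal truncation in degrees `≤ N`. -/
def toStupidTrunc (X : CochainComplex V ℤ) (N : ℤ) :
    X ⟶ X.stupidTrunc (embeddingUpIntLE N) :=
  (embeddingUpIntLE N).liftExtend (𝟙 (X.restriction (embeddingUpIntLE N)))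
    fun _ hj => hj.false_of_isTruncLE.elim

theorem toStupidTrunc_f (X : CochainComplex V ℤ) (N : ℤ) {n : ℕ} {m : ℤ}
    (h : (embeddingUpIntLE N).f n = m) :
    (toStupidTrunc X N).f m = (X.stupidTruncXIso (embeddingUpIntLE N) h).inv := by
  refine ((embeddingUpIntLE N).liftExtend_f _ _ h).trans ?_
  subst h
  have key {P S : V} (a : P ≅ S) :
      (Iso.refl S).inv ≫ 𝟙 S ≫ a.inv = (a ≪≫ Iso.refl _).inv := by simp
  exact key _

theorem isIso_toStupidTrunc_f (X : CochainComplex V ℤ) {N m : ℤ} (h : m ≤ N) :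
    IsIso ((toStupidTrunc X N).f m) := by
  rw [toStupidTrunc_f X N (n := (N - m).toNat) (by simp; lia)]
  infer_instance

/-- The inclusion of the brutal truncation in degrees `≥ N` of a cochain complex. -/
def fromStupidTrunc (X : CochainComplex V ℤ) (N : ℤ) :
    X.stupidTrunc (embeddingUpIntGE N) ⟶ X where
  f n := if h : N ≤ n then
      (X.stupidTruncXIso (embeddingUpIntGE N) (i := (n - N).toNat) (by simp; lia)).hom
    else 0
  comm' := by
    rintro i j (rfl : i + 1 = j)
    by_cases hi : N ≤ i
    · rw [dif_pos hi, dif_pos (by lia : N ≤ i + 1), stupidTrunc_d]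
    · refine Limits.IsZero.eq_of_src (X.isZero_stupidTrunc_X _ _ fun n => ?_) _ _
      rw [embeddingUpIntGE_f]
      lia

theorem isIso_fromStupidTrunc_f (X : CochainComplex V ℤ) {N m : ℤ} (h : N ≤ m) :
    IsIso ((fromStupidTrunc X N).f m) := by
  dsimp [fromStupidTrunc]
  rw [dif_pos h]
  infer_instance

theorem isZero_stupidTrunc_GE (X : CochainComplex V ℤ) {N m : ℤ} (h : m < N) :
    Limits.IsZero ((X.stupidTrunc (embeddingUpIntGE N)).X m) :=
  X.isZero_stupidTrunc_X _ _ fun n => by rw [embeddingUpIntGE_f]; lia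

theorem isZero_stupidTrunc_LE (X : CochainComplex V ℤ) {N m : ℤ} (h : N < m) :
    Limits.IsZero ((X.stupidTrunc (embeddingUpIntLE N)).X m) :=
  X.isZero_stupidTrunc_X _ _ fun n => by rw [embeddingUpIntLE_f]; lia

/-- A complex is an extension of its brutal truncations below and above a degree. -/
def stupidShortComplex (X : CochainComplex V ℤ) (N : ℤ) :
    ShortComplex (CochainComplex V ℤ) where
  f := fromStupidTrunc X (N + 1)
  g := toStupidTrunc X N
  zero := by
    ext n
    by_cases h : n < N + 1
    · exact (isZero_stupidTrunc_GE X h).eq_of_src _ _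
    · exact (isZero_stupidTrunc_LE X (by lia)).eq_of_tgt _ _

/-- The extension of a complex by its brutal truncations is split in each degree. -/
def stupidSplitting (X : CochainComplex V ℤ) (N n : ℤ) :
    ((stupidShortComplex X N).map (HomologicalComplex.eval V _ n)).Splitting :=
  if h : n < N + 1 then
    .ofIsZeroOfIsIso _ (isZero_stupidTrunc_GE X h) (isIso_toStupidTrunc_f X (by lia))
  else
    .ofIsIsoOfIsZero _ (isIso_fromStupidTrunc_f X (by lia)) (isZero_stupidTrunc_LE X (by lia))

end Truncation

section

open Pretriangulated

variable {A : Type u} [CommRing A]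

/-- The quotient functor to the homotopy category commutes with shifts. -/
abbrev toKShiftIso (X : CochainComplex (ModuleCat.{u} A) ℤ) (n : ℤ) : toK (X⟦n⟧) ≅ (toK X)⟦n⟧ :=
  ((HomotopyCategory.quotient _ _).commShiftIso n).app X

theorem IsTotallyAcyclic.hom_eq_zero {T Z : CochainComplex (ModuleCat.{u} A) ℤ}
    (hT : IsTotallyAcyclic T) (hproj : ∀ n, Module.Projective A (Z.X n)) (a : ℤ)
    (hZ : ∀ n < a, Limits.IsZero (Z.X n)) (g : toK T ⟶ toK Z) : g = 0 := by
  obtain ⟨φ, rfl⟩ := (HomotopyCategory.quotient _ _).map_surjective g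
  exact hT.map_eq_zero φ a fun n hn => (hZ n hn).eq_of_tgt _ _

/-- A degreewise split short exact sequence of complexes is a distinguished triangle. -/
theorem exists_distinguished {V : Type*} [Category* V] [Preadditive V]
    [Limits.HasZeroObject V] [Limits.HasBinaryBiproducts V] (S : ShortComplex (CochainComplex V ℤ))
    (σ : ∀ n, (S.map (HomologicalComplex.eval V _ n)).Splitting) :
    Triangle.mk ((HomotopyCategory.quotient V (.up ℤ)).map S.f)
      ((HomotopyCategory.quotient V (.up ℤ)).map S.g)
      ((HomotopyCategory.quotient V (.up ℤ)).map (CochainComplex.homOfDegreewiseSplit S σ) ≫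
        ((HomotopyCategory.quotient V (.up ℤ)).commShiftIso (1 : ℤ)).hom.app S.X₁) ∈
      distTriang (HomotopyCategory V (ComplexShape.up ℤ)) :=
  (HomotopyCategory.distinguished_iff_iso_trianglehOfDegreewiseSplit
    (CochainComplex.trianglehOfDegreewiseSplit S σ)).2 ⟨_, _, ⟨Iso.refl _⟩⟩

theorem bijective_comp_of_distinguished {𝒯 : Type*} [Category* 𝒯] [Preadditive 𝒯]
    [Limits.HasZeroObject 𝒯] [HasShift 𝒯 ℤ] [∀ n : ℤ, (shiftFunctor 𝒯 n).Additive]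
    [Pretriangulated 𝒯] {X Y Z T : 𝒯} {f : X ⟶ Y} {g : Y ⟶ Z} {δ : Z ⟶ X⟦(1 : ℤ)⟧}
    (h : Triangle.mk f g δ ∈ distTriang 𝒯) (h₀ : ∀ k : T ⟶ X, k = 0)
    (h₁ : ∀ k : T ⟶ X⟦(1 : ℤ)⟧, k = 0) : Function.Bijective fun k : T ⟶ Y => k ≫ g := by
  constructor
  · intro k k' hk
    rw [← sub_eq_zero]
    obtain ⟨l, hl⟩ := Triangle.coyoneda_exact₂ _ h (k - k')
      ((Preadditive.sub_comp _ _ _).trans (sub_eq_zero.2 hk))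
    exact hl.trans ((congrArg (· ≫ f) (h₀ l)).trans Limits.zero_comp)
  · intro k
    obtain ⟨l, hl⟩ := Triangle.coyoneda_exact₃ _ h k (h₁ _)
    exact ⟨l, hl.symm⟩

/-- Homotopy classes of maps from a totally acyclic complex to a complex of projective modules
do not change under brutal truncation of the target. -/
theorem IsTotallyAcyclic.bijective_comp_toStupidTrunc {T X : CochainComplex (ModuleCat.{u} A) ℤ}
    (hT : IsTotallyAcyclic T) (hX : ∀ n, Module.Projective A (X.X n)) (N : ℤ) :
    Function.Bijective fun g : toK T ⟶ toK X =>
      g ≫ (HomotopyCategory.quotient _ _).map (toStupidTrunc X N) := by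
  let X₁ : CochainComplex (ModuleCat.{u} A) ℤ :=
    X.stupidTrunc (ComplexShape.embeddingUpIntGE (N + 1))
  have hproj (n : ℤ) : Module.Projective A (X₁.X n) := by
    by_cases h : n < N + 1
    · have := (isZero_stupidTrunc_GE X h).projective
      exact ModuleCat.projective_of_module_projective _
    · have := isIso_fromStupidTrunc_f X (N := N + 1) (m := n) (by lia)
      have := hX n
      exact Module.Projective.of_equiv
        (asIso ((fromStupidTrunc X (N + 1)).f n)).symm.toLinearEquiv
  -- The kernel of the truncation and its shift are bounded below, so they receive no maps from `T`.
  refine bijective_comp_of_distinguished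
    (exists_distinguished (stupidShortComplex X N) (stupidSplitting X N))
    (fun k => hT.hom_eq_zero hproj (N + 1) (fun n hn => isZero_stupidTrunc_GE X hn) k)
    fun k => ?_
  have h := hT.hom_eq_zero (Z := X₁⟦(1 : ℤ)⟧) (fun n => hproj (n + 1)) N
    (fun n hn => isZero_stupidTrunc_GE X (m := n + 1) (by lia))
    (k ≫ (toKShiftIso X₁ 1).inv)
  exact (cancel_mono (toKShiftIso X₁ 1).inv).1 (h.trans Limits.zero_comp.symm)

/-- The comparison of a complete resolution with a projective resolution: it is invisible to
maps out of totally acyclic complexes. -/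
theorem IsCompleteResolution.exists_comparison {X : CochainComplex (ModuleCat.{u} A) ℤ}
    {M : ModuleCat.{u} A} (hX : IsCompleteResolution X M) (P : ProjectiveResolution M) :
    ∃ v : toK X ⟶ toK P.cochainComplex, ∀ T : CochainComplex (ModuleCat.{u} A) ℤ,
      IsTotallyAcyclic T → Function.Bijective fun g : toK T ⟶ toK X => g ≫ v := by
  obtain ⟨hX, P₀, i, ⟨h⟩⟩ := hX
  have hXp (n : ℤ) : Module.Projective A (X.X n) := have := hX.free; inferInstance
  have hP₀ (n : ℤ) : Module.Projective A (P₀.cochainComplex.X n) :=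
    ModuleCat.projective_of_module_projective _
  let e := HomotopyCategory.isoOfHomotopyEquiv h
  let π := (HomotopyCategory.quotient _ _).map (toStupidTrunc P₀.cochainComplex (-i - 1))
  obtain ⟨v, hv⟩ := (hX.bijective_comp_toStupidTrunc hP₀ (-i - 1)).2
    ((HomotopyCategory.quotient _ _).map (toStupidTrunc X (-i - 1)) ≫ e.hom)
  let eP : HomotopyEquiv P₀.cochainComplex P.cochainComplex :=
    { hom := HomologicalComplex.extendMap (P₀.homotopyEquiv P).hom _
      inv := HomologicalComplex.extendMap (P₀.homotopyEquiv P).inv _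
      homotopyHomInvId := (Homotopy.ofEq (HomologicalComplex.extendMap_comp _ _ _).symm).trans
        (((P₀.homotopyEquiv P).homotopyHomInvId.extend _).trans
          (.ofEq (HomologicalComplex.extendMap_id _ _)))
      homotopyInvHomId := (Homotopy.ofEq (HomologicalComplex.extendMap_comp _ _ _).symm).trans
        (((P₀.homotopyEquiv P).homotopyInvHomId.extend _).trans
          (.ofEq (HomologicalComplex.extendMap_id _ _))) }
  let e' := HomotopyCategory.isoOfHomotopyEquiv eP
  refine ⟨v ≫ e'.hom, fun T hT => ?_⟩
  have h1 := hT.bijective_comp_toStupidTrunc hP₀ (-i - 1)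
  have h2 := hT.bijective_comp_toStupidTrunc hXp (-i - 1)
  have h3 : Function.Bijective fun g : toK T ⟶ toK X => g ≫ v := by
    rw [← h1.of_comp_iff']
    have : (fun g : toK T ⟶ toK P₀.cochainComplex => g ≫ π) ∘ (fun g : toK T ⟶ toK X => g ≫ v) =
        (fun g => g ≫ e.hom) ∘ fun g => g ≫ (HomotopyCategory.quotient _ _).map
          (toStupidTrunc X (-i - 1)) := by
      ext g
      simp only [Function.comp_apply, Category.assoc]
      exact congrArg (g ≫ ·) hv
    change Function.Bijective ((fun g : toK T ⟶ toK P₀.cochainComplex => g ≫ π) ∘ _)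
    rw [this]
    exact (e.homToEquiv.bijective).comp h2
  have h4 := (e'.homToEquiv (Z := toK T)).bijective.comp h3
  convert h4 using 2 with g
  simp

/-- A complete resolution is unique up to homotopy equivalence. -/
theorem IsCompleteResolution.nonempty_iso {X X' : CochainComplex (ModuleCat.{u} A) ℤ}
    {M : ModuleCat.{u} A} (hX : IsCompleteResolution X M) (hX' : IsCompleteResolution X' M) :
    Nonempty (toK X ≅ toK X') := by
  obtain ⟨-, P, -⟩ := id hX
  obtain ⟨v, hv⟩ := hX.exists_comparison P
  obtain ⟨v', hv'⟩ := hX'.exists_comparison P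
  obtain ⟨a, ha⟩ := (hv' X hX.1).2 v
  obtain ⟨b, hb⟩ := (hv X' hX'.1).2 v'
  dsimp only at ha hb
  exact ⟨⟨a, b, (hv X hX.1).1 (by simp [ha, hb]), (hv' X' hX'.1).1 (by simp [ha, hb])⟩⟩

/-- A ring element that annihilates a module annihilates its complete resolution in the
homotopy category. -/
theorem IsCompleteResolution.smul_id_eq_zero {X : CochainComplex (ModuleCat.{u} A) ℤ}
    {M : ModuleCat.{u} A} (hX : IsCompleteResolution X M) (r : A) (hr : ∀ m : M, r • m = 0) :
    r • 𝟙 (toK X) = 0 := by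
  obtain ⟨-, P, -⟩ := id hX
  obtain ⟨v, hv⟩ := hX.exists_comparison P
  have hP : r • 𝟙 (toK P.cochainComplex) = 0 := by
    have H : Homotopy (r • 𝟙 P.complex) 0 := P.liftHomotopyZero _ (by
      refine HomologicalComplex.to_single_hom_ext ?_
      ext x
      exact ((P.π.f 0).hom.map_smul r x).trans (hr _))
    have H' := H.extend ComplexShape.embeddingDownNat
    have h1 : r • 𝟙 (P.complex.extend ComplexShape.embeddingDownNat) =
        HomologicalComplex.extendMap (r • 𝟙 P.complex) ComplexShape.embeddingDownNat := by
      rw [← HomologicalComplex.extendMap_id]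
      ext1 n
      by_cases hn : ∃ i, ComplexShape.embeddingDownNat.f i = n
      · obtain ⟨i, hi⟩ := hn
        rw [HomologicalComplex.smul_f_apply, HomologicalComplex.extendMap_f _ _ hi,
          HomologicalComplex.extendMap_f _ _ hi]
        simp
      · exact (P.complex.isZero_extend_X _ _ (by simpa using hn)).eq_of_src _ _
    have h2 := HomotopyCategory.eq_of_homotopy _ _ H'
    rw [← h1, HomologicalComplex.extendMap_zero, Functor.map_zero, Functor.map_smul] at h2
    exact (congrArg (r • ·) ((HomotopyCategory.quotient _ _).map_id _).symm).trans h2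
  refine (hv X hX.1).1 ?_
  simp only [Linear.smul_comp, Category.id_comp, Limits.zero_comp]
  rw [← Category.comp_id v, ← Linear.comp_smul, hP, Limits.comp_zero]

theorem exact_transpose_smul {L M N : Type u} [AddCommGroup L] [Module A L] [AddCommGroup M]
    [Module A M] [AddCommGroup N] [Module A N] (ε : ℤˣ) {d : L →ₗ[A] M} {d' : M →ₗ[A] N}
    (h : Function.Exact (Module.Dual.transpose (R := A) d') (Module.Dual.transpose (R := A) d)) :
    Function.Exact (Module.Dual.transpose (R := A) (ε • d'))
      (Module.Dual.transpose (R := A) (ε • d)) := by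
  obtain rfl | rfl := Int.units_eq_one_or ε
  · simpa using h
  · intro φ
    have h1 : Module.Dual.transpose (R := A) (-1 • d) φ = -Module.Dual.transpose (R := A) d φ := by
      ext; simp
    have h2 (ψ : Module.Dual A N) : Module.Dual.transpose (R := A) (-1 • d') ψ =
        Module.Dual.transpose (R := A) d' (-ψ) := by
      ext; simp
    have h3 := h φ
    constructor
    · intro hφ
      obtain ⟨ψ, hψ⟩ := h3.1 (by rwa [Units.neg_smul, one_smul, ← neg_one_smul ℤ, h1,
        neg_eq_zero] at hφ)
      exact ⟨-ψ, by rw [Units.neg_smul, one_smul, ← neg_one_smul ℤ, h2, neg_neg, hψ]⟩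
    · rintro ⟨ψ, hψ⟩
      rw [Units.neg_smul, one_smul, ← neg_one_smul ℤ, h1, neg_eq_zero]
      rw [Units.neg_smul, one_smul, ← neg_one_smul ℤ, h2] at hψ
      exact h3.2 ⟨_, hψ⟩

theorem IsTotallyAcyclic.shift {X : CochainComplex (ModuleCat.{u} A) ℤ}
    (hX : IsTotallyAcyclic X) (i : ℤ) : IsTotallyAcyclic (X⟦i⟧) where
  finite n := hX.finite (n + i)
  free n := hX.free (n + i)
  acyclic := by
    rw [← HomotopyCategory.quotient_obj_mem_subcategoryAcyclic_iff_acyclic]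
    have h := (HomotopyCategory.quotient_obj_mem_subcategoryAcyclic_iff_acyclic X).2 hX.acyclic
    exact ObjectProperty.prop_of_iso _ (toKShiftIso X i).symm
      ((HomotopyCategory.subcategoryAcyclic _).le_shift i _ h)
  dual_exact n := by
    have key : ∀ a b c : ℤ, a + 1 = b → a + 2 = c → ∀ φ : Module.Dual A (X.X b),
        φ ∘ₗ (X.d a b).hom = 0 ↔ ∃ ψ : Module.Dual A (X.X c), ψ ∘ₗ (X.d b c).hom = φ := by
      rintro a _ _ rfl rfl
      exact hX.dual_exact a
    exact exact_transpose_smul i.negOnePow (key (n + i) (n + 1 + i) (n + 2 + i) (by lia) (by lia))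

/-- Over a noetherian ring, homotopy classes of maps between totally acyclic complexes form a
finitely generated module: a class is determined by its component in a single degree. -/
theorem IsTotallyAcyclic.finite_hom [IsNoetherianRing A]
    {X Y : CochainComplex (ModuleCat.{u} A) ℤ}
    (hX : IsTotallyAcyclic X) (hY : IsTotallyAcyclic Y) : Module.Finite A (toK X ⟶ toK Y) := by
  have := hX.free 0
  have := hX.finite 0
  have := hY.finite 0
  -- `Hom(X, Y)` is a quotient of the image of `F`.
  let F : (X ⟶ Y) →ₗ[A] (X.X 0 →ₗ[A] Y.X 0) :=
    { toFun := fun φ => (φ.f 0).hom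
      map_add' := fun φ ψ => by simp
      map_smul' := fun r φ => by simp }
  let G : (X ⟶ Y) →ₗ[A] (toK X ⟶ toK Y) := (HomotopyCategory.quotient _ _).mapLinearMap A
  have hFG : LinearMap.ker F ≤ LinearMap.ker G := fun φ hφ =>
    hX.map_eq_zero_of_f_eq_zero hY φ 0 (ModuleCat.hom_ext hφ)
  have hG : Function.Surjective G := (HomotopyCategory.quotient _ _).map_surjective
  have h1 : Module.Finite A ((X ⟶ Y) ⧸ LinearMap.ker F) :=
    Module.Finite.equiv F.quotKerEquivRange.symm
  exact Module.Finite.of_surjective ((LinearMap.ker F).liftQ G hFG) fun y => by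
    obtain ⟨φ, rfl⟩ := hG y
    exact ⟨Submodule.Quotient.mk φ, rfl⟩

/-- The shifted version of `IsTotallyAcyclic.finite_hom`. -/
theorem IsTotallyAcyclic.finite_hom_shift [IsNoetherianRing A]
    {X Y : CochainComplex (ModuleCat.{u} A) ℤ}
    (hX : IsTotallyAcyclic X) (hY : IsTotallyAcyclic Y) (i : ℤ) :
    Module.Finite A (toK X ⟶ (toK Y)⟦i⟧) :=
  have := hX.finite_hom (hY.shift i)
  Module.Finite.of_surjective (Linear.rightComp A (toK X) (toKShiftIso Y i).hom) fun g =>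
    ⟨g ≫ (toKShiftIso Y i).inv, by simp⟩

end

end

noncomputable section

variable {Q : Type u} [CommRing Q] {c : ℕ}

/-! ### Initial segments of a regular sequence -/

/-- The ideal generated by the first `j` elements of a sequence. -/
def initialIdeal (f : Fin c → Q) (j : ℕ) : Ideal Q := Ideal.span (f '' {k | (k : ℕ) < j})

theorem initialIdeal_zero (f : Fin c → Q) : initialIdeal f 0 = ⊥ := by
  simp [initialIdeal]

theorem initialIdeal_length (f : Fin c → Q) : initialIdeal f c = Ideal.span (Set.range f) := by
  simp [initialIdeal]

theorem initialIdeal_mono (f : Fin c → Q) {i j : ℕ} (h : i ≤ j) :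
    initialIdeal f i ≤ initialIdeal f j :=
  Ideal.span_mono (Set.image_mono fun _ (hk : _ < i) => hk.trans_le h)

section

variable {f : Fin c → Q} {j : ℕ} {M N : Type u} [AddCommGroup M] [Module Q M]
  [AddCommGroup N] [Module Q N]

theorem smul_mem_initialIdeal {k : Fin c} (hk : (k : ℕ) < j) (x : M) :
    f k • x ∈ initialIdeal f j • (⊤ : Submodule Q M) :=
  Submodule.smul_mem_smul (Ideal.subset_span ⟨k, hk, rfl⟩) trivial

theorem map_mem_smul_top (J : Ideal Q) (g : M →ₗ[Q] N) {x : M}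
    (hx : x ∈ J • (⊤ : Submodule Q M)) : g x ∈ J • (⊤ : Submodule Q N) :=
  (Submodule.map_smul'' J ⊤ g).le.trans (Submodule.smul_mono le_rfl le_top) ⟨x, hx, rfl⟩

theorem prod_mem_smul_top (J : Ideal Q) {x : M × N} :
    x ∈ J • (⊤ : Submodule Q (M × N)) ↔
      x.1 ∈ J • (⊤ : Submodule Q M) ∧ x.2 ∈ J • (⊤ : Submodule Q N) := by
  refine ⟨fun h => ⟨map_mem_smul_top J (LinearMap.fst Q M N) h,
    map_mem_smul_top J (LinearMap.snd Q M N) h⟩, fun ⟨h₁, h₂⟩ => ?_⟩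
  have := add_mem (map_mem_smul_top J (LinearMap.inl Q M N) h₁)
    (map_mem_smul_top J (LinearMap.inr Q M N) h₂)
  simpa using this

/-- Each element of a regular sequence is regular on a free module modulo the previous ones. -/
theorem mem_of_smul_mem_initialIdeal (hf : RingTheory.Sequence.IsRegular Q (List.ofFn f))
    [Module.Free Q M] (hj : j < c) {x : M}
    (hx : f ⟨j, hj⟩ • x ∈ initialIdeal f j • (⊤ : Submodule Q M)) :
    x ∈ initialIdeal f j • (⊤ : Submodule Q M) := by
  have hM : RingTheory.Sequence.IsWeaklyRegular M (List.ofFn f) :=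
    ((TensorProduct.rid Q M).isWeaklyRegular_congr _).1
      (RingTheory.Sequence.IsWeaklyRegular.isWeaklyRegular_lTensor (M₂ := M)
        hf.toIsWeaklyRegular)
  have hi := hM.regular_mod_prev j (by simpa using hj)
  have hI : Ideal.ofList ((List.ofFn f).take j) = initialIdeal f j := by
    rw [Ideal.ofList, initialIdeal]
    congr 1
    ext y
    simp only [Set.mem_ofPred_eq, List.mem_take_iff_getElem, List.getElem_ofFn, Set.mem_image]
    constructor
    · rintro ⟨k, hk, rfl⟩
      simp only [List.length_ofFn, lt_inf_iff] at hk
      exact ⟨⟨k, hk.2⟩, hk.1, rfl⟩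
    · rintro ⟨k, hk, rfl⟩
      exact ⟨k, by simp [hk], rfl⟩
  rw [← hI] at hx ⊢
  rw [← Submodule.Quotient.mk_eq_zero] at hx ⊢
  apply hi
  simpa using hx

/-- A linear map out of a free module with values in the submodule generated by the first `j`
elements of a sequence is a combination of these elements. -/
theorem exists_eq_sum_smul_initialIdeal [Module.Free Q M] (g : M →ₗ[Q] N)
    (hg : ∀ x, g x ∈ initialIdeal f j • (⊤ : Submodule Q N)) :
    ∃ τ : Fin c → M →ₗ[Q] N, (∀ k : Fin c, j ≤ k → τ k = 0) ∧ g = ∑ k, f k • τ k := by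
  let f' : Fin c → Q := fun k => if (k : ℕ) < j then f k else 0
  have hle : initialIdeal f j ≤ Ideal.span (Set.range f') := by
    refine Ideal.span_mono ?_
    rintro _ ⟨k, hk, rfl⟩
    exact ⟨k, if_pos hk⟩
  obtain ⟨τ, hτ⟩ := exists_eq_sum_smul f' g fun x => Submodule.smul_mono_left hle (hg x)
  refine ⟨fun k => if (k : ℕ) < j then τ k else 0, fun k hk => if_neg (not_lt.2 hk),
    hτ.trans (Finset.sum_congr rfl fun k _ => ?_)⟩
  by_cases hk : (k : ℕ) < j <;> simp [f', hk]

theorem sum_sub_mem_initialIdeal (hj : j < c) (y : Fin c → M)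
    (hy : ∀ k : Fin c, j + 1 ≤ k → y k = 0) :
    ∑ k, f k • y k - f ⟨j, hj⟩ • y ⟨j, hj⟩ ∈ initialIdeal f j • (⊤ : Submodule Q M) := by
  rw [← Finset.add_sum_erase _ _ (Finset.mem_univ ⟨j, hj⟩), add_sub_cancel_left]
  refine Submodule.sum_mem _ fun k hk => ?_
  by_cases hkj : (k : ℕ) < j
  · exact smul_mem_initialIdeal hkj _
  · rw [hy k (by
      have : (k : ℕ) ≠ j := fun h => (Finset.mem_erase.1 hk).1 (Fin.ext h)
      lia), smul_zero]
    exact zero_mem _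

/-- A linear map out of a free module with values in the submodule generated by the first
`j + 1` elements of a sequence is, modulo the first `j` elements, a multiple of the last one. -/
theorem exists_sub_smul_mem_initialIdeal [Module.Free Q M] (hj : j < c) (g : M →ₗ[Q] N)
    (hg : ∀ x, g x ∈ initialIdeal f (j + 1) • (⊤ : Submodule Q N)) :
    ∃ τ : M →ₗ[Q] N, ∀ x, g x - f ⟨j, hj⟩ • τ x ∈ initialIdeal f j • (⊤ : Submodule Q N) := by
  obtain ⟨τ, hτ, rfl⟩ := exists_eq_sum_smul_initialIdeal g hg
  refine ⟨τ ⟨j, hj⟩, fun x => ?_⟩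
  simpa using sum_sub_mem_initialIdeal hj (fun k => τ k x) fun k hk => by
    rw [hτ k hk, LinearMap.zero_apply]

theorem mem_initialIdeal_succ (hj : j < c) {x y : N}
    (h : x - f ⟨j, hj⟩ • y ∈ initialIdeal f j • (⊤ : Submodule Q N)) :
    x ∈ initialIdeal f (j + 1) • (⊤ : Submodule Q N) := by
  have h1 := Submodule.smul_mono_left (N := (⊤ : Submodule Q N))
    (initialIdeal_mono f (Nat.le_succ j)) h
  have h2 : f ⟨j, hj⟩ • y ∈ initialIdeal f (j + 1) • (⊤ : Submodule Q N) :=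
    smul_mem_initialIdeal (Nat.lt_succ_self j) y
  simpa using add_mem h1 h2

theorem exists_sub_smul_mem_of_mem (hj : j < c) {x : N}
    (hx : x ∈ initialIdeal f (j + 1) • (⊤ : Submodule Q N)) :
    ∃ y : N, x - f ⟨j, hj⟩ • y ∈ initialIdeal f j • (⊤ : Submodule Q N) := by
  obtain ⟨τ, hτ⟩ := exists_sub_smul_mem_initialIdeal hj (LinearMap.toSpanSingleton Q N x)
    (fun a => by simpa using Submodule.smul_mem _ a hx)
  exact ⟨τ 1, by simpa using hτ 1⟩

end

/-! ### Complexes up to a sequence, and their cones -/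

/-- A sequence of maps `d` between finitely generated free modules whose square is a combination
`d ∘ d = ∑ k, f k • t k` of the first `j` elements of `f`, so that it is a complex modulo these;
for `j = 0` it is a complex. It carries projections `e` whose images are preserved by the maps;
the quotients by these images are a truncation of it. As in `Lift`, only the values
`d i j` with `j = i + 1` and `t k i j` with `j = i + 2` are relevant. -/
structure CurvedComplex (f : Fin c → Q) (j : ℕ) where
  X : ℤ → Type u
  [addCommGroup : ∀ n, AddCommGroup (X n)]
  [module : ∀ n, Module Q (X n)]
  [free : ∀ n, Module.Free Q (X n)]
  [finite : ∀ n, Module.Finite Q (X n)]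
  d : ∀ m n, X m →ₗ[Q] X n
  t : Fin c → ∀ m n, X m →ₗ[Q] X n
  e : ∀ n, X n →ₗ[Q] X n
  t_eq_zero : ∀ k : Fin c, j ≤ k → ∀ m n, t k m n = 0
  d_d : ∀ l m n, l + 1 = m → m + 1 = n → ∀ x, d m n (d l m x) = ∑ k, f k • t k l n x
  e_e : ∀ n x, e n (e n x) = e n x
  e_d_e : ∀ m n, m + 1 = n → ∀ x, e n (d m n (e m x)) = d m n (e m x)
  e_t_e : ∀ k m n, m + 2 = n → ∀ x, e n (t k m n (e m x)) = t k m n (e m x)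

namespace CurvedComplex

attribute [instance] addCommGroup module free finite

variable {f : Fin c → Q} {j : ℕ}

/-- The identity between two terms of equal index, and zero otherwise. -/
def cast (A : CurvedComplex f j) (m n : ℤ) : A.X m →ₗ[Q] A.X n :=
  if h : m = n then h ▸ LinearMap.id else 0

@[simp]
theorem cast_self (A : CurvedComplex f j) (n : ℤ) : A.cast n n = LinearMap.id := by
  simp [cast]

section Step

variable (hf : RingTheory.Sequence.IsRegular Q (List.ofFn f)) (hj : j < c)
  (A : CurvedComplex f (j + 1))

include hf in
theorem exists_homotopy (l o : ℤ) : ∃ s : Fin c → A.X l →ₗ[Q] A.X o,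
    (∀ k : Fin c, j ≤ k → s k = 0) ∧ (l + 3 = o → (∀ m n, l + 1 = m → n + 1 = o → ∀ x,
      A.d n o (A.t ⟨j, hj⟩ l n x) - A.t ⟨j, hj⟩ m o (A.d l m x) = ∑ k, f k • s k x) ∧
      ∀ k x, A.e o (s k (A.e l x)) = s k (A.e l x)) := by
  by_cases hlo : l + 3 = o
  swap
  · exact ⟨0, by simp, fun h => absurd h hlo⟩
  let g (k : Fin c) : A.X l →ₗ[Q] A.X o :=
    A.d (l + 2) o ∘ₗ A.t k l (l + 2) - A.t k (l + 1) o ∘ₗ A.d l (l + 1)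
  have hg0 (k : Fin c) (hk : j + 1 ≤ k) : g k = 0 := by simp [g, A.t_eq_zero k hk]
  have hg (x : A.X l) : ∑ k, f k • g k x = 0 := by
    have h1 := congrArg (A.d (l + 2) o) (A.d_d l (l + 1) (l + 2) rfl (by lia) x)
    have h2 := A.d_d (l + 1) (l + 2) o (by lia) (by lia) (A.d l (l + 1) x)
    rw [map_sum, h2] at h1
    simp only [g, LinearMap.sub_apply, LinearMap.comp_apply, smul_sub, Finset.sum_sub_distrib, h1]
    simp
  obtain ⟨s, hs0, hs⟩ := exists_eq_sum_smul_initialIdeal (f := f) (j := j) (g ⟨j, hj⟩) fun x => by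
    refine mem_of_smul_mem_initialIdeal hf hj ?_
    have h := hg x
    have h' := sum_sub_mem_initialIdeal (f := f) hj (fun k => g k x) fun k hk => by
      rw [hg0 k hk, LinearMap.zero_apply]
    rw [h, zero_sub] at h'
    simpa using neg_mem h'
  -- The homotopies are made compatible with the projections.
  refine ⟨fun k => A.e o ∘ₗ s k ∘ₗ A.e l + s k ∘ₗ (LinearMap.id - A.e l),
    fun k hk => by simp [hs0 k hk], fun _ => ⟨?_, fun k x => ?_⟩⟩
  · rintro m n rfl hn x
    obtain rfl : n = l + 2 := by lia
    have h1 (y : A.X l) : g ⟨j, hj⟩ y = ∑ k, f k • s k y := by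
      conv_lhs => rw [hs]
      simp
    have h2 : A.e o (g ⟨j, hj⟩ (A.e l x)) = g ⟨j, hj⟩ (A.e l x) := by
      simp only [g, LinearMap.sub_apply, LinearMap.comp_apply, map_sub]
      rw [← A.e_t_e _ l (l + 2) rfl, ← A.e_d_e l (l + 1) rfl, A.e_d_e _ _ (by lia),
        A.e_t_e _ _ _ (by lia), A.e_t_e _ (l + 1) o (by lia)]
    have h3 := h1 (A.e l x)
    rw [← h2, h1, map_sum] at h3
    simp only [map_smul] at h3
    change g ⟨j, hj⟩ x = _
    rw [h1]
    simp only [LinearMap.add_apply, LinearMap.comp_apply, LinearMap.sub_apply, LinearMap.id_apply,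
      map_sub, smul_add, smul_sub, Finset.sum_add_distrib, Finset.sum_sub_distrib, h3]
    abel
  · simp [A.e_e]

/-- A choice of homotopies, modulo the first `j` elements of the sequence, between
`d ∘ t j` and `t j ∘ d`. -/
def s (k : Fin c) (l o : ℤ) : A.X l →ₗ[Q] A.X o := (A.exists_homotopy hf hj l o).choose k

theorem s_eq_zero (k : Fin c) (hk : j ≤ k) (l o : ℤ) : A.s hf hj k l o = 0 :=
  (A.exists_homotopy hf hj l o).choose_spec.1 k hk

theorem d_t_sub (l m n o : ℤ) (hm : l + 1 = m) (hn : n + 1 = o) (ho : l + 3 = o) (x : A.X l) :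
    A.d n o (A.t ⟨j, hj⟩ l n x) - A.t ⟨j, hj⟩ m o (A.d l m x) =
      ∑ k, f k • A.s hf hj k l o x :=
  ((A.exists_homotopy hf hj l o).choose_spec.2 ho).1 m n hm hn x

theorem e_s_e (k : Fin c) (l o : ℤ) (ho : l + 3 = o) (x : A.X l) :
    A.e o (A.s hf hj k l o (A.e l x)) = A.s hf hj k l o (A.e l x) :=
  ((A.exists_homotopy hf hj l o).choose_spec.2 ho).2 k x

/-- The cone of `t j` over the sequence without its last element `f j`: its terms are
`X n × X (n + 1)`, with `(x, y) ↦ (d x + f j • y, - t j x - d y)`. For `j = 0` this is the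
complex over `Q` attached to a lift along `Q → Q / (f 0)`. -/
abbrev step : CurvedComplex f j where
  X n := A.X n × A.X (n + 1)
  d m n := (A.d m n ∘ₗ LinearMap.fst Q _ _ +
      f ⟨j, hj⟩ • A.cast (m + 1) n ∘ₗ LinearMap.snd Q _ _).prod
    (-(A.t ⟨j, hj⟩ m (n + 1) ∘ₗ LinearMap.fst Q _ _) -
      A.d (m + 1) (n + 1) ∘ₗ LinearMap.snd Q _ _)
  t k m n := if (k : ℕ) < j then
      (A.t k m n ∘ₗ LinearMap.fst Q _ _).prod
        (A.s hf hj k m (n + 1) ∘ₗ LinearMap.fst Q _ _ +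
          A.t k (m + 1) (n + 1) ∘ₗ LinearMap.snd Q _ _)
    else 0
  e n := (A.e n).prodMap (A.e (n + 1))
  t_eq_zero k hk m n := if_neg (not_lt.2 hk)
  d_d := by
    rintro l _ _ rfl rfl ⟨x, y⟩
    have hsum {M : Type u} [AddCommGroup M] [Module Q M] (u : Fin c → M)
        (hu : ∀ k : Fin c, j + 1 ≤ k → u k = 0) :
        ∑ k, f k • u k = f ⟨j, hj⟩ • u ⟨j, hj⟩ +
          ∑ k, f k • if (k : ℕ) < j then u k else 0 := by
      rw [← Finset.add_sum_erase _ _ (Finset.mem_univ ⟨j, hj⟩),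
        ← Finset.add_sum_erase (a := ⟨j, hj⟩) _ (fun k => f k • if (k : ℕ) < j then u k else 0)
          (Finset.mem_univ _)]
      simp only [lt_irrefl, if_false, smul_zero, zero_add]
      refine congrArg _ (Finset.sum_congr rfl fun k hk => ?_)
      by_cases hkj : (k : ℕ) < j
      · rw [if_pos hkj]
      · rw [if_neg hkj, hu k (by
          have : (k : ℕ) ≠ j := fun h => (Finset.mem_erase.1 hk).1 (Fin.ext h)
          lia)]
    have h1 := A.d_d l (l + 1) (l + 1 + 1) rfl rfl x
    rw [hsum _ fun k hk => by rw [A.t_eq_zero k hk, LinearMap.zero_apply]] at h1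
    have h2 := A.d_d (l + 1) (l + 1 + 1) (l + 1 + 1 + 1) rfl rfl y
    rw [hsum _ fun k hk => by rw [A.t_eq_zero k hk, LinearMap.zero_apply]] at h2
    have h3 := A.d_t_sub hf hj l (l + 1) (l + 1 + 1) (l + 1 + 1 + 1) rfl rfl (by lia) x
    rw [hsum _ fun k hk => by rw [A.s_eq_zero hf hj k (by lia), LinearMap.zero_apply],
      A.s_eq_zero hf hj ⟨j, hj⟩ le_rfl, LinearMap.zero_apply, smul_zero, zero_add] at h3
    have key (k : Fin c) : (if (k : ℕ) < j then
        (A.t k l (l + 1 + 1) ∘ₗ LinearMap.fst Q (A.X l) (A.X (l + 1))).prod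
          (A.s hf hj k l (l + 1 + 1 + 1) ∘ₗ LinearMap.fst Q _ _ +
            A.t k (l + 1) (l + 1 + 1 + 1) ∘ₗ LinearMap.snd Q _ _) else 0) (x, y) =
        (if (k : ℕ) < j then A.t k l (l + 1 + 1) x else 0,
          (if (k : ℕ) < j then A.s hf hj k l (l + 1 + 1 + 1) x else 0) +
            if (k : ℕ) < j then A.t k (l + 1) (l + 1 + 1 + 1) y else 0) := by
      by_cases hk : (k : ℕ) < j
      · simp [hk]
      · simp only [hk, if_false, add_zero]
        rfl
    simp only [key]
    ext
    · simp only [Prod.fst_sum, Prod.smul_fst]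
      simp [h1, smul_sub]
    · simp only [Prod.snd_sum, Prod.smul_snd, smul_add, Finset.sum_add_distrib, ← h3]
      simp [h2]
      abel
  e_e := by
    rintro n ⟨x, y⟩
    simp [A.e_e]
  e_d_e := by
    rintro m _ rfl ⟨x, y⟩
    simp [A.e_e, A.e_d_e, A.e_t_e _ m (m + 1 + 1) (by lia)]
  e_t_e := by
    rintro k m _ rfl ⟨x, y⟩
    by_cases hk : (k : ℕ) < j
    · simp [hk, A.e_t_e, A.e_s_e hf hj k m (m + 2 + 1) (by lia),
        A.e_t_e k (m + 1) (m + 2 + 1) (by lia)]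
    · simp [hk]

theorem step_d (n : ℤ) (x : A.X n) (y : A.X (n + 1)) :
    (A.step hf hj).d n (n + 1) (x, y) = (A.d n (n + 1) x + f ⟨j, hj⟩ • y,
      -A.t ⟨j, hj⟩ n (n + 1 + 1) x - A.d (n + 1) (n + 1 + 1) y) := by
  simp

end Step

theorem d_d_sub_mem (hj : j < c) (A : CurvedComplex f (j + 1)) (n : ℤ) (x : A.X n) :
    A.d (n + 1) (n + 1 + 1) (A.d n (n + 1) x) - f ⟨j, hj⟩ • A.t ⟨j, hj⟩ n (n + 1 + 1) x ∈
      initialIdeal f j • (⊤ : Submodule Q (A.X (n + 1 + 1))) := by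
  rw [A.d_d n (n + 1) (n + 1 + 1) rfl rfl]
  exact sum_sub_mem_initialIdeal hj _ fun k hk => by
    rw [A.t_eq_zero k hk, LinearMap.zero_apply]

end CurvedComplex

end

noncomputable section

variable {Q : Type u} [CommRing Q]

/-! ### Exactness modulo one element less -/

/-- `P = V + g M`, and `g` is regular modulo `V`. It is applied with `V` the elements that vanish
modulo the first `j` elements of a regular sequence, and `P` those that vanish modulo one more. -/
structure IsRegularStep (g : Q) {M : Type*} [AddCommGroup M] [Module Q M]
    (V P : Submodule Q M) : Prop where
  mem_of_smul_mem : ∀ x, g • x ∈ V → x ∈ V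
  mem_iff : ∀ x, x ∈ P ↔ ∃ y, x - g • y ∈ V

section Chase

variable {g : Q} {E₀ E₁ E₂ E₃ : Type*} [AddCommGroup E₀] [Module Q E₀] [AddCommGroup E₁]
  [Module Q E₁] [AddCommGroup E₂] [Module Q E₂] [AddCommGroup E₃] [Module Q E₃]
  (d₀ : E₀ →ₗ[Q] E₁) (d₁ : E₁ →ₗ[Q] E₂) (d₂ : E₂ →ₗ[Q] E₃) (t₀ : E₀ →ₗ[Q] E₂) (t₁ : E₁ →ₗ[Q] E₃)
  {V₁ P₁ : Submodule Q E₁} {V₂ P₂ : Submodule Q E₂} {V₃ P₃ : Submodule Q E₃}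

/-- If `d ∘ d = g • t` modulo `V` and `d` is exact modulo `P = V + (g)`, then the cone differential
`(x, y) ↦ (d x + g • y, - t x - d y)` is exact modulo `V`. -/
theorem IsRegularStep.exact_cone (h₁ : IsRegularStep g V₁ P₁) (h₂ : IsRegularStep g V₂ P₂)
    (hd : ∀ x ∈ V₁, d₁ x ∈ V₂) (hdd : ∀ u, d₁ (d₀ u) - g • t₀ u ∈ V₂)
    (hex : ∀ x, d₁ x ∈ P₂ → ∃ u, x - d₀ u ∈ P₁) (x : E₁) (y : E₂)
    (hxy : d₁ x + g • y ∈ V₂) :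
    ∃ u v, x - (d₀ u + g • v) ∈ V₁ ∧ y - (-t₀ u - d₁ v) ∈ V₂ := by
  obtain ⟨u, hu⟩ := hex x ((h₂.mem_iff _).2 ⟨-y, by rwa [smul_neg, sub_neg_eq_add]⟩)
  obtain ⟨v, hv⟩ := (h₁.mem_iff _).1 hu
  refine ⟨u, v, by rwa [← sub_sub], h₂.mem_of_smul_mem _ ?_⟩
  have h := sub_mem hxy (add_mem (hd _ hv) (hdd u))
  convert h using 1
  simp only [map_sub, map_smul, smul_sub, smul_neg]
  abel

/-- The converse of `IsRegularStep.exact_cone`. -/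
theorem IsRegularStep.exact_of_exact_cone (h₁ : IsRegularStep g V₁ P₁)
    (h₂ : IsRegularStep g V₂ P₂) (h₃ : IsRegularStep g V₃ P₃)
    (hd : ∀ x ∈ V₂, d₂ x ∈ V₃) (hdd : ∀ x, d₂ (d₁ x) - g • t₁ x ∈ V₃)
    (hex : ∀ x y, d₁ x + g • y ∈ V₂ → -t₁ x - d₂ y ∈ V₃ → ∃ u v, x - (d₀ u + g • v) ∈ V₁)
    (x : E₁) (hx : d₁ x ∈ P₂) : ∃ u, x - d₀ u ∈ P₁ := by
  obtain ⟨y, hy⟩ := (h₂.mem_iff _).1 hx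
  obtain ⟨u, v, huv⟩ := hex x (-y) (by rwa [smul_neg, ← sub_eq_add_neg]) (h₃.mem_of_smul_mem _ (by
    have h := sub_mem (hdd x) (hd _ hy)
    convert h using 1
    simp only [map_sub, map_smul, smul_sub, smul_neg, map_neg]
    abel))
  exact ⟨u, (h₁.mem_iff _).2 ⟨v, by rwa [sub_sub]⟩⟩

end Chase

/-- The linear maps with values in `J N`. -/
def valuedIn (J : Ideal Q) (M N : Type*) [AddCommGroup M] [Module Q M] [AddCommGroup N]
    [Module Q N] : Submodule Q (M →ₗ[Q] N) where
  carrier := {φ | ∀ x, φ x ∈ J • (⊤ : Submodule Q N)}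
  add_mem' h h' x := add_mem (h x) (h' x)
  zero_mem' _ := zero_mem _
  smul_mem' r _ h x := Submodule.smul_mem _ r (h x)

variable {c : ℕ} {f : Fin c → Q} {j : ℕ}

theorem isRegularStep_valuedIn (hf : RingTheory.Sequence.IsRegular Q (List.ofFn f)) (hj : j < c)
    (M N : Type u) [AddCommGroup M] [Module Q M] [Module.Free Q M] [AddCommGroup N] [Module Q N]
    [Module.Free Q N] :
    IsRegularStep (f ⟨j, hj⟩) (valuedIn (initialIdeal f j) M N)
      (valuedIn (initialIdeal f (j + 1)) M N) where
  mem_of_smul_mem _ h x := mem_of_smul_mem_initialIdeal hf hj (h x)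
  mem_iff φ := ⟨exists_sub_smul_mem_initialIdeal hj φ,
    fun ⟨_, h⟩ x => mem_initialIdeal_succ hj (h x)⟩

namespace CurvedComplex

/-- The vectors that vanish modulo the first `i` elements of the sequence after applying
`1 - θ • e`. For `θ = 0` these are the vectors that vanish modulo these elements, for `θ = 1`
those that do so in the truncation, that is, modulo the image of `e`. -/
def vanishing (θ : Q) (i : ℕ) (A : CurvedComplex f j) (n : ℤ) : Submodule Q (A.X n) :=
  (initialIdeal f i • (⊤ : Submodule Q (A.X n))).comap (LinearMap.id - θ • A.e n)

theorem mem_vanishing {θ : Q} {i : ℕ} {A : CurvedComplex f j} {n : ℤ} {x : A.X n} :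
    x ∈ A.vanishing θ i n ↔ x - θ • A.e n x ∈ initialIdeal f i • (⊤ : Submodule Q (A.X n)) :=
  Iff.rfl

theorem mem_vanishing_of_mem (θ : Q) {i : ℕ} (A : CurvedComplex f j) {n : ℤ} {x : A.X n}
    (h : x ∈ initialIdeal f i • (⊤ : Submodule Q (A.X n))) : x ∈ A.vanishing θ i n :=
  map_mem_smul_top _ (LinearMap.id - θ • A.e n) h

theorem d_mem_vanishing {θ : Q} (hθ : θ * θ = θ) {i : ℕ} (A : CurvedComplex f j) (n : ℤ)
    {x : A.X n} (hx : x ∈ A.vanishing θ i n) : A.d n (n + 1) x ∈ A.vanishing θ i (n + 1) := by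
  rw [mem_vanishing] at hx ⊢
  have h := map_mem_smul_top _ ((LinearMap.id - θ • A.e (n + 1)) ∘ₗ A.d n (n + 1)) hx
  convert h using 1
  simp only [LinearMap.comp_apply, LinearMap.sub_apply, LinearMap.id_apply, map_sub, map_smul,
    LinearMap.smul_apply, A.e_d_e n (n + 1) rfl, smul_smul, hθ, sub_self, sub_zero, smul_sub]

theorem step_vanishing {θ : Q} (hf : RingTheory.Sequence.IsRegular Q (List.ofFn f)) (hj : j < c)
    (A : CurvedComplex f (j + 1)) {n : ℤ} {x : A.X n} {y : A.X (n + 1)} :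
    ((x, y) : (A.step hf hj).X n) ∈ (A.step hf hj).vanishing θ j n ↔
      x ∈ A.vanishing θ j n ∧ y ∈ A.vanishing θ j (n + 1) :=
  mem_vanishing.trans (prod_mem_smul_top _)

theorem isRegularStep_vanishing {θ : Q} (hθ : θ * θ = θ)
    (hf : RingTheory.Sequence.IsRegular Q (List.ofFn f)) (hj : j < c)
    (A : CurvedComplex f (j + 1)) (n : ℤ) :
    IsRegularStep (f ⟨j, hj⟩) (A.vanishing θ j n) (A.vanishing θ (j + 1) n) where
  mem_of_smul_mem x h := by
    rw [mem_vanishing, map_smul, smul_comm, ← smul_sub] at h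
    exact mem_of_smul_mem_initialIdeal hf hj h
  mem_iff x := by
    refine ⟨fun h => ?_, fun ⟨y, hy⟩ => ?_⟩
    · obtain ⟨y, hy⟩ := exists_sub_smul_mem_of_mem hj h
      refine ⟨y, ?_⟩
      have h := map_mem_smul_top _ (LinearMap.id - θ • A.e n) hy
      rw [mem_vanishing]
      convert h using 1
      simp only [LinearMap.sub_apply, LinearMap.id_apply, map_sub, map_smul,
        LinearMap.smul_apply, smul_sub, A.e_e, smul_smul, hθ, mul_comm θ]
      abel
    · refine mem_initialIdeal_succ (y := y - θ • A.e n y) hj ?_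
      rw [mem_vanishing] at hy
      convert hy using 1
      simp only [LinearMap.sub_apply, LinearMap.id_apply, map_sub, map_smul,
        LinearMap.smul_apply, smul_sub, smul_comm θ (f _)]
      abel

/-- Exactness at degree `n + 1`, modulo the first `j` elements of the sequence, of `A` (for
`θ = 0`) or of its truncation (for `θ = 1`). -/
def ExactMod (θ : Q) (A : CurvedComplex f j) (n : ℤ) : Prop :=
  ∀ x, A.d (n + 1) (n + 1 + 1) x ∈ A.vanishing θ j (n + 1 + 1) →
    ∃ u, x - A.d n (n + 1) u ∈ A.vanishing θ j (n + 1)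

theorem ExactMod.step {θ : Q} (hθ : θ * θ = θ)
    (hf : RingTheory.Sequence.IsRegular Q (List.ofFn f)) (hj : j < c)
    {A : CurvedComplex f (j + 1)} {n : ℤ} (h : A.ExactMod θ n) : (A.step hf hj).ExactMod θ n := by
  rintro ⟨x, y⟩ hxy
  rw [step_d] at hxy
  have h1 := (step_vanishing hf hj A).1 hxy
  obtain ⟨u, v, huv⟩ := (isRegularStep_vanishing hθ hf hj A (n + 1)).exact_cone
    (A.d n (n + 1)) (A.d (n + 1) (n + 1 + 1)) (A.t ⟨j, hj⟩ n (n + 1 + 1))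
    (isRegularStep_vanishing hθ hf hj A (n + 1 + 1)) (fun x hx => A.d_mem_vanishing hθ _ hx)
    (fun u => A.mem_vanishing_of_mem θ (d_d_sub_mem hj A n u)) h x y h1.1
  refine ⟨(u, v), ?_⟩
  rw [step_d]
  exact (step_vanishing hf hj A).2 huv

/-- Exactness at degree `n + 1`, modulo the first `j` elements of the sequence, of the dual. -/
def DualExactMod (A : CurvedComplex f j) (n : ℤ) : Prop :=
  ∀ α : Module.Dual Q (A.X (n + 1)), α ∘ₗ A.d n (n + 1) ∈ valuedIn (initialIdeal f j) _ _ →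
    ∃ β : Module.Dual Q (A.X (n + 1 + 1)),
      α - β ∘ₗ A.d (n + 1) (n + 1 + 1) ∈ valuedIn (initialIdeal f j) _ _

theorem DualExactMod.step (hf : RingTheory.Sequence.IsRegular Q (List.ofFn f)) (hj : j < c)
    {A : CurvedComplex f (j + 1)} {n : ℤ} (h : A.DualExactMod (n + 1)) :
    (A.step hf hj).DualExactMod n := by
  intro Φ hΦ
  let α : Module.Dual Q (A.X (n + 1)) := Φ ∘ₗ LinearMap.inl Q _ _
  let β : Module.Dual Q (A.X (n + 1 + 1)) := Φ ∘ₗ LinearMap.inr Q _ _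
  have hΦ' (x : A.X (n + 1)) (y : A.X (n + 1 + 1)) : Φ (x, y) = α x + β y := by
    simp only [α, β, LinearMap.comp_apply, LinearMap.inl_apply, LinearMap.inr_apply]
    rw [← map_add, Prod.mk_add_mk, add_zero, zero_add]
  -- In the dual of the cone the two components change places.
  obtain ⟨γ, δ, h1, h2⟩ := (isRegularStep_valuedIn hf hj (A.X (n + 1 + 1)) Q).exact_cone
    (-LinearMap.lcomp Q Q (A.d (n + 1 + 1) (n + 1 + 1 + 1)))
    (-LinearMap.lcomp Q Q (A.d (n + 1) (n + 1 + 1)))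
    (LinearMap.lcomp Q Q (A.t ⟨j, hj⟩ (n + 1) (n + 1 + 1 + 1)))
    (isRegularStep_valuedIn hf hj (A.X (n + 1)) Q)
    (fun φ hφ x => neg_mem (hφ _))
    (fun φ x => by
      have := map_mem_smul_top _ φ (d_d_sub_mem hj A (n + 1) x)
      simpa using this)
    (fun φ hφ => by
      obtain ⟨γ, hγ⟩ := h φ (fun x => by simpa using neg_mem (hφ x))
      exact ⟨-γ, by rw [LinearMap.neg_apply, map_neg, neg_neg]; exact hγ⟩)
    β α (fun y => by
      have := hΦ (0, y)
      rw [LinearMap.comp_apply, step_d, map_zero, map_zero, hΦ'] at this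
      simpa [add_comm] using this)
  refine ⟨LinearMap.coprod δ γ, ?_⟩
  rintro ⟨x, y⟩
  rw [LinearMap.sub_apply, LinearMap.comp_apply, step_d, hΦ']
  have h3 := add_mem (h2 x) (h1 y)
  convert h3 using 1
  simp [LinearMap.coprod_apply]
  abel

section Hom

variable (W : CochainComplex (ModuleCat.{u} Q) ℤ)

/-- The differential `φ ↦ d ∘ φ - σ • φ ∘ d` on families of maps from the terms of a complex to
the terms of another one. -/
def homD {Y : ℤ → Type u} [∀ n, AddCommGroup (Y n)] [∀ n, Module Q (Y n)]
    (d : ∀ q, Y q →ₗ[Q] Y (q + 1)) (σ : Q) :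
    (∀ p q, W.X p →ₗ[Q] Y q) →ₗ[Q] ∀ p q, W.X p →ₗ[Q] Y (q + 1) where
  toFun φ p q := d q ∘ₗ φ p q - σ • φ (p + 1) (q + 1) ∘ₗ (W.d p (p + 1)).hom
  map_add' φ ψ := by
    ext
    simp [LinearMap.comp_add, LinearMap.add_comp]
    abel
  map_smul' r φ := by
    ext
    simp [smul_sub, smul_comm r]

/-- The families of maps whose components in the relevant degrees have values in `J Y`. The other
components are unconstrained: they do not enter the relevant components of `homD`. -/
def familiesValuedIn (J : Ideal Q) (Y : ℤ → Type u) [∀ n, AddCommGroup (Y n)]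
    [∀ n, Module Q (Y n)] (m : ℤ) : Submodule Q (∀ p q, W.X p →ₗ[Q] Y q) where
  carrier := {φ | ∀ p q, p = q + m → φ p q ∈ valuedIn J _ _}
  add_mem' h h' p q hpq := add_mem (h p q hpq) (h' p q hpq)
  zero_mem' _ _ _ := zero_mem _
  smul_mem' r _ h p q hpq := Submodule.smul_mem _ r (h p q hpq)

variable {W}

theorem isRegularStep_familiesValuedIn (hf : RingTheory.Sequence.IsRegular Q (List.ofFn f))
    (hj : j < c) [∀ n, Module.Free Q (W.X n)] (Y : ℤ → Type u) [∀ n, AddCommGroup (Y n)]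
    [∀ n, Module Q (Y n)] [∀ n, Module.Free Q (Y n)] (m : ℤ) :
    IsRegularStep (f ⟨j, hj⟩) (familiesValuedIn W (initialIdeal f j) Y m)
      (familiesValuedIn W (initialIdeal f (j + 1)) Y m) where
  mem_of_smul_mem φ h p q hpq :=
    (isRegularStep_valuedIn hf hj _ _).mem_of_smul_mem _ (h p q hpq)
  mem_iff φ := by
    refine ⟨fun h => ?_, fun ⟨ψ, h⟩ p q hpq =>
      ((isRegularStep_valuedIn hf hj _ _).mem_iff _).2 ⟨ψ p q, h p q hpq⟩⟩
    have h' (p q : ℤ) : ∃ ψ, p = q + m → φ p q - f ⟨j, hj⟩ • ψ ∈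
        valuedIn (initialIdeal f j) (W.X p) (Y q) := by
      by_cases hpq : p = q + m
      · obtain ⟨ψ, hψ⟩ := ((isRegularStep_valuedIn hf hj _ _).mem_iff _).1 (h p q hpq)
        exact ⟨ψ, fun _ => hψ⟩
      · exact ⟨0, fun h => absurd h hpq⟩
    choose ψ hψ using h'
    exact ⟨ψ, hψ⟩

/-- Exactness, modulo the first `j` elements of the sequence, of the complex of maps from `W` to
`A`: it concerns families of maps `W.X p → A.X (q + 1)` with `p = q + m`, and `σ` is the sign in
the differential. -/
def HomExactMod (W : CochainComplex (ModuleCat.{u} Q) ℤ) (A : CurvedComplex f j) (σ : Q)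
    (m : ℤ) : Prop :=
  ∀ φ, homD W (fun q => A.d (q + 1) (q + 1 + 1)) σ φ ∈
      familiesValuedIn W (initialIdeal f j) (fun q => A.X (q + 1 + 1)) m →
    ∃ u, φ - homD W (fun q => A.d q (q + 1)) (-σ) u ∈
      familiesValuedIn W (initialIdeal f j) (fun q => A.X (q + 1)) m

theorem d_d_apply (W : CochainComplex (ModuleCat.{u} Q) ℤ) (l m n : ℤ) (x : W.X l) :
    (W.d m n).hom ((W.d l m).hom x) = 0 :=
  LinearMap.congr_fun (congrArg ModuleCat.Hom.hom (W.d_comp_d l m n)) x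

theorem homD_mem {Y : ℤ → Type u} [∀ n, AddCommGroup (Y n)] [∀ n, Module Q (Y n)]
    (d : ∀ q, Y q →ₗ[Q] Y (q + 1)) (σ : Q) (J : Ideal Q) (m : ℤ) {φ}
    (hφ : φ ∈ familiesValuedIn W J Y m) :
    homD W d σ φ ∈ familiesValuedIn W J (fun q => Y (q + 1)) m := fun p q hpq x =>
  sub_mem (map_mem_smul_top _ (d q) (hφ p q hpq x))
    (Submodule.smul_mem _ σ (hφ (p + 1) (q + 1) (by lia) _))

variable (W) in
/-- Postcomposition of families of maps with maps of degree two. -/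
def homT (Y : ℤ → Type u) [∀ n, AddCommGroup (Y n)] [∀ n, Module Q (Y n)]
    (t : ∀ q, Y q →ₗ[Q] Y (q + 1 + 1)) :
    (∀ p q, W.X p →ₗ[Q] Y q) →ₗ[Q] ∀ p q, W.X p →ₗ[Q] Y (q + 1 + 1) where
  toFun φ p q := t q ∘ₗ φ p q
  map_add' φ ψ := by ext; simp
  map_smul' r φ := by ext; simp

theorem HomExactMod.step (hf : RingTheory.Sequence.IsRegular Q (List.ofFn f)) (hj : j < c)
    [∀ n, Module.Free Q (W.X n)] {A : CurvedComplex f (j + 1)} {σ : Q} {m : ℤ}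
    (h : HomExactMod W A σ m) : HomExactMod W (A.step hf hj) σ m := by
  intro Φ hΦ
  let x (p q : ℤ) : W.X p →ₗ[Q] A.X (q + 1) := LinearMap.fst Q _ _ ∘ₗ Φ p q
  let y (p q : ℤ) : W.X p →ₗ[Q] A.X (q + 1 + 1) := LinearMap.snd Q _ _ ∘ₗ Φ p q
  obtain ⟨u, v, h1, h2⟩ := (isRegularStep_familiesValuedIn (W := W) hf hj
      (fun q => A.X (q + 1)) m).exact_cone
    (homD W (fun q => A.d q (q + 1)) (-σ)) (homD W (fun q => A.d (q + 1) (q + 1 + 1)) σ)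
    (homT W A.X fun q => A.t ⟨j, hj⟩ q (q + 1 + 1))
    (isRegularStep_familiesValuedIn (W := W) hf hj (fun q => A.X (q + 1 + 1)) m)
    (fun φ hφ => homD_mem _ σ _ m hφ)
    (fun φ p q hpq x => by
      have h := d_d_sub_mem hj A q (φ p q x)
      convert h using 1
      simp [homD, homT, d_d_apply]) h x y
    (fun p q hpq z => by
      have h := ((prod_mem_smul_top _).1 (hΦ p q hpq z)).1
      convert h using 1
      simp [homD, x]
      abel)
  refine ⟨fun p q => (u p q).prod (v p q), fun p q hpq z => (prod_mem_smul_top _).2 ⟨?_, ?_⟩⟩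
  · have h := h1 p q hpq z
    convert h using 1
    simp [homD, x]
    abel
  · have h := h2 p q hpq z
    convert h using 1
    simp [homD, homT, y]
    abel

theorem HomExactMod.of_step (hf : RingTheory.Sequence.IsRegular Q (List.ofFn f)) (hj : j < c)
    [∀ n, Module.Free Q (W.X n)] {A : CurvedComplex f (j + 1)} {σ : Q} {m : ℤ}
    (h : HomExactMod W (A.step hf hj) σ m) : HomExactMod W A σ m := by
  refine (isRegularStep_familiesValuedIn (W := W) hf hj
      (fun q => A.X (q + 1)) m).exact_of_exact_cone
    (homD W (fun q => A.d q (q + 1)) (-σ)) (homD W (fun q => A.d (q + 1) (q + 1 + 1)) σ)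
    (homD W (fun q => A.d (q + 1 + 1) (q + 1 + 1 + 1)) (-σ))
    (homT W (fun q => A.X (q + 1)) fun q => A.t ⟨j, hj⟩ (q + 1) (q + 1 + 1 + 1))
    (isRegularStep_familiesValuedIn (W := W) hf hj (fun q => A.X (q + 1 + 1)) m)
    (isRegularStep_familiesValuedIn (W := W) hf hj (fun q => A.X (q + 1 + 1 + 1)) m)
    (fun φ hφ => homD_mem _ (-σ) _ m hφ)
    (fun φ p q hpq x => by
      have h := d_d_sub_mem hj A (q + 1) (φ p q x)
      convert h using 1
      simp [homD, homT, d_d_apply]) fun x y h1 h2 => ?_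
  obtain ⟨u, hu⟩ := h (fun p q => (x p q).prod (y p q)) fun p q hpq z =>
    (prod_mem_smul_top _).2 ⟨by
      have h := h1 p q hpq z
      convert h using 1
      simp [homD]
      abel, by
      have h := h2 p q hpq z
      convert h using 1
      simp [homD, homT]
      abel⟩
  refine ⟨fun p q => LinearMap.fst Q _ _ ∘ₗ u p q, fun p q => LinearMap.snd Q _ _ ∘ₗ u p q,
    fun p q hpq z => ?_⟩
  have h := ((prod_mem_smul_top _).1 (hu p q hpq z)).1
  convert h using 1
  simp [homD]
  abel

end Hom

/-- An augmentation, modulo the first `j` elements of the sequence, of the truncation of `A` in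
degrees `≤ 0`. -/
structure IsAugmentation {M : Type u} [AddCommGroup M] [Module Q M] (A : CurvedComplex f j)
    (ε : A.X 0 →ₗ[Q] M) : Prop where
  surjective : Function.Surjective ε
  apply_d : ∀ u, ε (A.d (-1) 0 u) = 0
  apply_e : ∀ x, ε (A.e 0 x) = 0
  exact : ∀ x, ε x = 0 → ∃ u, x - A.d (-1) 0 u ∈ A.vanishing 1 j 0

/-- The second summand of the cone in degree `0` has degree `1`, so the truncation does not
see it. -/
theorem IsAugmentation.step {M : Type u} [AddCommGroup M] [Module Q M]
    (hf : RingTheory.Sequence.IsRegular Q (List.ofFn f)) (hj : j < c) {A : CurvedComplex f (j + 1)}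
    (hM : ∀ k, ∀ m : M, f k • m = 0) (he : ∀ n, 0 < n → ∀ x, A.e n x = x) {ε : A.X 0 →ₗ[Q] M}
    (h : A.IsAugmentation ε) :
    (A.step hf hj).IsAugmentation (ε ∘ₗ LinearMap.fst Q _ _) where
  surjective m := by
    obtain ⟨x, rfl⟩ := h.surjective m
    exact ⟨(x, 0), rfl⟩
  apply_d := by
    rintro ⟨x, y⟩
    refine (congrArg ε (congrArg Prod.fst (A.step_d hf hj (-1) x y))).trans ?_
    refine (map_add ε _ _).trans ?_
    rw [map_smul, hM]
    exact (add_zero _).trans (h.apply_d x)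
  apply_e := by
    rintro ⟨x, y⟩
    exact h.apply_e x
  exact := by
    rintro ⟨x, y⟩ hx
    obtain ⟨u, hu⟩ := h.exact x hx
    obtain ⟨v, hv⟩ := ((isRegularStep_vanishing (one_mul 1) hf hj A 0).mem_iff _).1 hu
    refine ⟨(u, v), ?_⟩
    refine (congrArg (· ∈ (A.step hf hj).vanishing 1 j 0) (congrArg ((x, y) - ·)
      (A.step_d hf hj (-1) u v))).mpr ((step_vanishing hf hj A).2 ⟨?_, ?_⟩)
    · change x - (A.d (-1) 0 u + f ⟨j, hj⟩ • v) ∈ _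
      rwa [← sub_sub]
    · have h1 (z : A.X (0 + 1)) : z ∈ A.vanishing 1 j (0 + 1) := by
        rw [mem_vanishing, one_smul, he _ (by simp), sub_self]
        exact zero_mem _
      exact h1 _

/-- The complex over `Q` obtained from `A` by iterating `step`. -/
def resolve (hf : RingTheory.Sequence.IsRegular Q (List.ofFn f)) :
    ∀ j, j ≤ c → CurvedComplex f j → CurvedComplex f 0
  | 0, _, A => A
  | j + 1, hj, A => resolve hf j (Nat.le_of_succ_le hj) (A.step hf hj)

theorem resolve_induction (hf : RingTheory.Sequence.IsRegular Q (List.ofFn f))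
    (p : ∀ j, CurvedComplex f j → Prop)
    (h : ∀ j (hj : j < c) (A : CurvedComplex f (j + 1)), p (j + 1) A → p j (A.step hf hj))
    (hj : j ≤ c) (A : CurvedComplex f j) (hA : p j A) : p 0 (A.resolve hf j hj) := by
  induction j with
  | zero => exact hA
  | succ j ih => exact ih _ _ (h j hj A hA)

theorem of_resolve (hf : RingTheory.Sequence.IsRegular Q (List.ofFn f))
    (p : ∀ j, CurvedComplex f j → Prop)
    (h : ∀ j (hj : j < c) (A : CurvedComplex f (j + 1)), p j (A.step hf hj) → p (j + 1) A)
    (hj : j ≤ c) (A : CurvedComplex f j) (hA : p 0 (A.resolve hf j hj)) : p j A := by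
  induction j with
  | zero => exact hA
  | succ j ih => exact h j hj A (ih _ _ hA)

section Resolve

variable (hf : RingTheory.Sequence.IsRegular Q (List.ofFn f)) (hj : j ≤ c) (A : CurvedComplex f j)

theorem ExactMod.resolve {θ : Q} (hθ : θ * θ = θ) {n : ℤ} {A : CurvedComplex f j}
    (h : A.ExactMod θ n) : (A.resolve hf j hj).ExactMod θ n :=
  resolve_induction hf (fun _ A => A.ExactMod θ n) (fun _ hj _ h => h.step hθ hf hj) hj A h

theorem DualExactMod.resolve {A : CurvedComplex f j} (h : ∀ n, A.DualExactMod n) (n : ℤ) :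
    (A.resolve hf j hj).DualExactMod n :=
  resolve_induction hf (fun _ A => ∀ n, A.DualExactMod n)
    (fun _ hj _ h n => (h (n + 1)).step hf hj) hj A h n

theorem homExactMod_resolve_iff {W : CochainComplex (ModuleCat.{u} Q) ℤ}
    [∀ n, Module.Free Q (W.X n)] {σ : Q} {m : ℤ} :
    HomExactMod W (A.resolve hf j hj) σ m ↔ HomExactMod W A σ m :=
  ⟨of_resolve hf (fun _ A => HomExactMod W A σ m) (fun _ hj _ h => h.of_step hf hj) hj A,
    resolve_induction hf (fun _ A => HomExactMod W A σ m) (fun _ hj _ h => h.step hf hj) hj A⟩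

/-- Each `step` moves the truncation by one degree. -/
theorem resolve_e_of_le (he : ∀ n ≤ 0, ∀ x, A.e n x = 0) (n : ℤ) (hn : n ≤ -j)
    (x : (A.resolve hf j hj).X n) : (A.resolve hf j hj).e n x = 0 :=
  resolve_induction hf (fun i A => ∀ n : ℤ, n ≤ i - j → ∀ x, A.e n x = 0)
    (fun _ _ _ h n hn _ => Prod.ext (h n (by push_cast; lia) _)
      (h (n + 1) (by push_cast; lia) _)) hj A (fun n hn => he n (by lia)) n (by simpa using hn) x

theorem IsAugmentation.exists_resolve {M : Type u} [AddCommGroup M] [Module Q M]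
    (hM : ∀ k, ∀ m : M, f k • m = 0) {A : CurvedComplex f j}
    (he : ∀ n, 0 < n → ∀ x, A.e n x = x) {ε : A.X 0 →ₗ[Q] M} (h : A.IsAugmentation ε) :
    ∃ ε : (A.resolve hf j hj).X 0 →ₗ[Q] M, (A.resolve hf j hj).IsAugmentation ε :=
  (resolve_induction hf
    (fun _ A => (∀ n, 0 < n → ∀ x, A.e n x = x) ∧ ∃ ε : A.X 0 →ₗ[Q] M, A.IsAugmentation ε)
    (fun _ hj _ ⟨he, _, h⟩ => ⟨fun n hn _ => Prod.ext (he n hn _) (he (n + 1) (by lia) _),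
      _, h.step hf hj hM he⟩) hj A ⟨he, ε, h⟩).2

end Resolve

end CurvedComplex

end

noncomputable section

variable {Q : Type u} [CommRing Q] {c : ℕ} {f : Fin c → Q}

/-! ### Complexes over `Q` as complete resolutions -/

theorem isIso_stupidTruncMap {V : Type*} [Category* V] [Limits.HasZeroMorphisms V]
    [Limits.HasZeroObject V] {ι ι' : Type*} {c : ComplexShape ι} {c' : ComplexShape ι'}
    (e : c.Embedding c') [e.IsRelIff] {K L : HomologicalComplex V c'} (φ : K ⟶ L)
    (h : ∀ i i', e.f i = i' → IsIso (φ.f i')) :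
    IsIso (HomologicalComplex.stupidTruncMap φ e) := by
  have (i' : ι') : IsIso ((HomologicalComplex.stupidTruncMap φ e).f i') := by
    by_cases hi : ∃ i, e.f i = i'
    · obtain ⟨i, hi⟩ := hi
      have := h i i' hi
      have h1 := HomologicalComplex.stupidTruncMap_stupidTruncXIso_hom φ e hi
      rw [← Iso.eq_comp_inv] at h1
      rw [h1]
      infer_instance
    · push Not at hi
      exact (K.isZero_stupidTrunc_X e i' hi).isIso (L.isZero_stupidTrunc_X e i' hi) _
  exact HomologicalComplex.Hom.isIso_of_components _

theorem projective_quotient_range {X : Type u} [AddCommGroup X] [Module Q X]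
    [Module.Projective Q X] (e : X →ₗ[Q] X) (he : ∀ x, e (e x) = e x) :
    Module.Projective Q (X ⧸ LinearMap.range e) :=
  Module.Projective.of_split
    ((LinearMap.range e).liftQ (LinearMap.id - e) (by
      rintro _ ⟨x, rfl⟩
      simp [he]))
    (LinearMap.range e).mkQ (by
      ext x
      simp)

namespace CurvedComplex

variable (A : CurvedComplex f 0)

include A in
theorem d_d_zero {l m n : ℤ} (hm : l + 1 = m) (hn : m + 1 = n) (x : A.X l) :
    A.d m n (A.d l m x) = 0 := by
  rw [A.d_d l m n hm hn]
  simp [A.t_eq_zero _ (Nat.zero_le _)]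

theorem mem_vanishing_zero {n : ℤ} {x : A.X n} : x ∈ A.vanishing 0 0 n ↔ x = 0 := by
  rw [mem_vanishing, initialIdeal_zero]
  simp

theorem mem_vanishing_one {n : ℤ} {x : A.X n} :
    x ∈ A.vanishing 1 0 n ↔ x ∈ LinearMap.range (A.e n) := by
  rw [mem_vanishing, initialIdeal_zero, one_smul]
  simp only [Submodule.bot_smul, Submodule.mem_bot, sub_eq_zero]
  exact ⟨fun h => ⟨x, h.symm⟩, by rintro ⟨y, rfl⟩; rw [A.e_e]⟩

/-- A `CurvedComplex` without curvature, as a complex. -/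
@[simps]
def toComplex : CochainComplex (ModuleCat.{u} Q) ℤ where
  X n := ModuleCat.of Q (A.X n)
  d m n := if m + 1 = n then ModuleCat.ofHom (A.d m n) else 0
  shape m n h := if_neg h
  d_comp_d' l m n hm hn := by
    rw [if_pos (show l + 1 = m from hm), if_pos (show m + 1 = n from hn)]
    ext x
    exact A.d_d_zero hm hn x

theorem toComplex_d_apply {m n : ℤ} (h : m + 1 = n) (x : A.X m) :
    (A.toComplex.d m n).hom x = A.d m n x := by
  rw [toComplex_d, if_pos h]
  rfl

theorem toComplex_d_hom (n : ℤ) : (A.toComplex.d n (n + 1)).hom = A.d n (n + 1) :=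
  LinearMap.ext (A.toComplex_d_apply rfl)

theorem isTotallyAcyclic_toComplex (h : ∀ n, A.ExactMod 0 n) (h' : ∀ n, A.DualExactMod n) :
    IsTotallyAcyclic A.toComplex where
  finite n := A.finite n
  free n := A.free n
  acyclic n := by
    obtain ⟨n, rfl⟩ : ∃ m, n = m + 1 := ⟨n - 1, by lia⟩
    rw [HomologicalComplex.exactAt_iff' _ n (n + 1) (n + 1 + 1) (by simp) (by simp),
      ShortComplex.moduleCat_exact_iff]
    intro x hx
    obtain ⟨u, hu⟩ := h n x (A.mem_vanishing_zero.2 ((A.toComplex_d_apply rfl x).symm.trans hx))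
    exact ⟨u, (A.toComplex_d_apply rfl u).trans (sub_eq_zero.1 (A.mem_vanishing_zero.1 hu)).symm⟩
  dual_exact n := by
    have hval {M N : Type u} [AddCommGroup M] [Module Q M] [AddCommGroup N] [Module Q N]
        (φ : M →ₗ[Q] N) : φ ∈ valuedIn (initialIdeal f 0) M N ↔ φ = 0 := by
      rw [LinearMap.ext_iff]
      refine forall_congr' fun x => ?_
      rw [initialIdeal_zero]
      simp
    have key (m : ℤ) (hm : m = n + 1 + 1) : Function.Exact
        (Module.Dual.transpose (R := Q) (A.toComplex.d (n + 1) m).hom)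
        (Module.Dual.transpose (R := Q) (A.toComplex.d n (n + 1)).hom) := by
      subst hm
      intro α
      constructor
      · intro hα
        obtain ⟨β, hβ⟩ := h' n α ((hval _).2 (by rw [← A.toComplex_d_hom]; exact hα))
        refine ⟨β, ?_⟩
        refine LinearMap.ext fun x => (congrArg β (A.toComplex_d_apply rfl x)).trans ?_
        exact (sub_eq_zero.1 (LinearMap.congr_fun ((hval _).1 hβ) x)).symm
      · rintro ⟨β, rfl⟩
        ext x
        exact (congrArg β (d_d_apply A.toComplex _ _ _ x)).trans (map_zero β)
    exact key _ (by lia)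

/-- The truncation of the complex `A` in degrees `≤ 0`, as a chain complex. -/
def truncation : ChainComplex (ModuleCat.{u} Q) ℕ where
  X n := ModuleCat.of Q (A.X (-n) ⧸ LinearMap.range (A.e (-n)))
  d m n := if h : n + 1 = m then
      ModuleCat.ofHom (Submodule.mapQ (LinearMap.range (A.e (-m))) (LinearMap.range (A.e (-n)))
        (A.d (-m) (-n)) (by
          rintro _ ⟨x, rfl⟩
          exact ⟨_, A.e_d_e _ _ (by lia) x⟩))
    else 0
  shape m n h := dif_neg h
  d_comp_d' l m n hm hn := by
    have hm : m + 1 = l := hm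
    have hn : n + 1 = m := hn
    rw [dif_pos hm, dif_pos hn]
    ext x
    exact congrArg (Submodule.mkQ _) (A.d_d_zero (by lia) (by lia) x)

theorem truncation_d (n : ℕ) (x : A.X (-(n + 1 : ℕ))) :
    (A.truncation.d (n + 1) n).hom (Submodule.Quotient.mk x) =
      Submodule.Quotient.mk (A.d (-(n + 1 : ℕ)) (-n) x) := by
  have h : A.truncation.d (n + 1) n = ModuleCat.ofHom (Submodule.mapQ _ _ _ _) := dif_pos rfl
  exact LinearMap.congr_fun (congrArg ModuleCat.Hom.hom h) _

/-- The map induced by an augmentation on the truncation. -/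
def IsAugmentation.desc {A : CurvedComplex f 0} {M : Type u} [AddCommGroup M] [Module Q M]
    {ε : A.X 0 →ₗ[Q] M} (hε : A.IsAugmentation ε) : (A.X 0 ⧸ LinearMap.range (A.e 0)) →ₗ[Q] M :=
  Submodule.liftQ (LinearMap.range (A.e 0)) ε (by
    rintro _ ⟨x, rfl⟩
    exact hε.apply_e x)

theorem IsAugmentation.desc_d {A : CurvedComplex f 0} {M : Type u} [AddCommGroup M] [Module Q M]
    {ε : A.X 0 →ₗ[Q] M} (hε : A.IsAugmentation ε) (x : A.truncation.X 1) :
    hε.desc ((A.truncation.d 1 0).hom x) = 0 := by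
  obtain ⟨x, rfl⟩ := Submodule.mkQ_surjective _ x
  exact (congrArg hε.desc (A.truncation_d 0 x)).trans (hε.apply_d x)

theorem truncation_exactAt (h : ∀ n, n + 1 < 0 → A.ExactMod 1 n) (n : ℕ) :
    A.truncation.ExactAt (n + 1) := by
  rw [HomologicalComplex.exactAt_iff' _ (n + 2) (n + 1) n (by simp) (by simp),
      ShortComplex.moduleCat_exact_iff]
  intro x hx
  obtain ⟨x, rfl⟩ := Submodule.mkQ_surjective _ x
  have key : ∀ l m o : ℤ, l + 1 = m → m + 1 = o → m < 0 → ∀ x : A.X m,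
      A.d m o x ∈ LinearMap.range (A.e o) → ∃ u, x - A.d l m u ∈ LinearMap.range (A.e m) := by
    rintro l _ _ rfl rfl hl x hx
    obtain ⟨u, hu⟩ := h l hl x (A.mem_vanishing_one.2 hx)
    exact ⟨u, A.mem_vanishing_one.1 hu⟩
  obtain ⟨u, hu⟩ := key (-(n + 1 + 1 : ℕ)) (-(n + 1 : ℕ)) (-n) (by lia) (by lia) (by lia) x
    ((Submodule.Quotient.mk_eq_zero _).1 ((A.truncation_d n x).symm.trans hx))
  exact ⟨Submodule.Quotient.mk u, (A.truncation_d (n + 1) u).trans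
    ((Submodule.Quotient.eq _).2 (by simpa using neg_mem hu))⟩

/-- The truncation of `A` is a projective resolution of the augmentation module. -/
def projectiveResolution {M : ModuleCat.{u} Q} (h : ∀ n, n + 1 < 0 → A.ExactMod 1 n)
    {ε : A.X 0 →ₗ[Q] M} (hε : A.IsAugmentation ε) : ProjectiveResolution M where
  complex := A.truncation
  projective n := by
    have := projective_quotient_range (A.e (-n)) (A.e_e _)
    exact ModuleCat.projective_of_categoryTheory_projective
      (ModuleCat.of Q (A.X (-n) ⧸ LinearMap.range (A.e (-n))))
  π := (ChainComplex.toSingle₀Equiv _ _).symm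
    ⟨ModuleCat.ofHom hε.desc, ModuleCat.hom_ext (LinearMap.ext hε.desc_d)⟩
  quasiIso := ⟨fun n => by
    cases n with
    | zero =>
      rw [ChainComplex.quasiIsoAt₀_iff, ShortComplex.quasiIso_iff_of_zeros' _ rfl rfl rfl]
      rw [ShortComplex.moduleCat_exact_iff, ModuleCat.epi_iff_surjective]
      refine ⟨fun x hx => ?_, fun m => ?_⟩
      · have hx' : hε.desc x = 0 := hx
        obtain ⟨x, rfl⟩ := Submodule.mkQ_surjective _ x
        obtain ⟨u, hu⟩ := hε.exact x hx'
        refine ⟨Submodule.Quotient.mk u,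
          (A.truncation_d 0 u).trans ((Submodule.Quotient.eq _).2 ?_)⟩
        rw [mem_vanishing_one] at hu
        have := neg_mem hu
        rwa [neg_sub] at this
      · obtain ⟨x, hx⟩ := hε.surjective m
        exact ⟨Submodule.Quotient.mk x, hx⟩
    | succ n =>
      rw [quasiIsoAt_iff_exactAt' _ _ (ChainComplex.exactAt_succ_single_obj _ _)]
      exact A.truncation_exactAt h n⟩

/-- The projection to the truncation. -/
def toTruncation : A.toComplex ⟶ A.truncation.extend ComplexShape.embeddingDownNat :=
  ComplexShape.embeddingDownNat.liftExtend
    { f := fun n => ModuleCat.ofHom (Submodule.mkQ (LinearMap.range (A.e (-n))))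
      comm' := by
        rintro _ n rfl
        ext x
        refine (A.truncation_d n x).trans ?_
        refine congrArg (Submodule.mkQ _) (A.toComplex_d_apply ?_ x).symm
        change -((n + 1 : ℕ) : ℤ) + 1 = -n
        lia }
    fun _ hj => hj.false_of_isTruncLE.elim

theorem isIso_toTruncation_f {n : ℤ} (hn : n ≤ 0) (he : ∀ x, A.e n x = 0) :
    IsIso (A.toTruncation.f n) := by
  obtain ⟨m, rfl⟩ : ∃ m : ℕ, n = -m := ⟨(-n).toNat, by lia⟩
  refine (ComplexShape.Embedding.isIso_liftExtend_f_iff _ _ _ (i := m) rfl).2 ?_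
  rw [ConcreteCategory.isIso_iff_bijective]
  refine ⟨?_, Submodule.mkQ_surjective _⟩
  refine LinearMap.ker_eq_bot.1 ((Submodule.ker_mkQ (LinearMap.range (A.e (-m)))).trans ?_)
  exact LinearMap.range_eq_bot.2 (LinearMap.ext he)

/-- The truncation is visible only in degrees `> -b`, so below these the complex is the projective
resolution. -/
theorem isCompleteResolution_toComplex {M : ModuleCat.{u} Q} (h : ∀ n, A.ExactMod 0 n)
    (h' : ∀ n, A.DualExactMod n) (h'' : ∀ n, n + 1 < 0 → A.ExactMod 1 n)
    {ε : A.X 0 →ₗ[Q] M} (hε : A.IsAugmentation ε) (b : ℕ)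
    (hb : ∀ n : ℤ, n ≤ -b → ∀ x, A.e n x = 0) :
    IsCompleteResolution A.toComplex M := by
  refine ⟨A.isTotallyAcyclic_toComplex h h', A.projectiveResolution h'' hε, b, ⟨?_⟩⟩
  let φ : A.toComplex.stupidTrunc (ComplexShape.embeddingUpIntLE (-b - 1)) ⟶
      (A.projectiveResolution h'' hε).cochainComplex.stupidTrunc
        (ComplexShape.embeddingUpIntLE (-b - 1)) :=
    HomologicalComplex.stupidTruncMap A.toTruncation _
  have : IsIso φ := isIso_stupidTruncMap (ComplexShape.embeddingUpIntLE (-b - 1)) A.toTruncation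
    (fun i i' hi => by
      rw [ComplexShape.embeddingUpIntLE_f] at hi
      exact A.isIso_toTruncation_f (by lia) (hb _ (by lia)))
  exact HomotopyEquiv.ofIso (asIso φ)

end CurvedComplex

end

noncomputable section

variable {Q : Type u} [CommRing Q] {R : Type u} [CommRing R] [Algebra Q R] {c : ℕ} {f : Fin c → Q}

/-! ### The complete resolution over `Q` attached to a lift -/

theorem IsRegularQuotient.nontrivial (h : IsRegularQuotient f R) : Nontrivial R := by
  by_contra hR
  rw [not_nontrivial_iff_subsingleton] at hR
  have h1 : (1 : Q) ∈ Ideal.span (Set.range f) := by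
    rw [← h.ker_eq, RingHom.mem_ker]
    exact Subsingleton.elim _ _
  refine h.regular.top_ne_smul ?_
  have : Ideal.ofList (List.ofFn f) = ⊤ := by
    rw [Ideal.eq_top_iff_one, Ideal.ofList]
    convert h1 using 3
    ext
    simp
  rw [this, smul_eq_mul, Ideal.top_mul]

theorem IsRegularQuotient.algebraMap_eq_zero_iff (h : IsRegularQuotient f R) {q : Q} :
    algebraMap Q R q = 0 ↔ q ∈ Ideal.span (Set.range f) := by
  rw [← h.ker_eq, RingHom.mem_ker]

theorem IsRegularQuotient.algebraMap_apply_eq_zero (h : IsRegularQuotient f R) (k : Fin c) :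
    algebraMap Q R (f k) = 0 :=
  h.algebraMap_eq_zero_iff.2 (Ideal.subset_span ⟨k, rfl⟩)

theorem IsRegularQuotient.exists_one_tmul (h : IsRegularQuotient f R) {M : Type u}
    [AddCommGroup M] [Module Q M] (z : R ⊗[Q] M) : ∃ x : M, (1 : R) ⊗ₜ[Q] x = z := by
  induction z using TensorProduct.induction_on with
  | zero => exact ⟨0, by simp⟩
  | tmul r x =>
    obtain ⟨q, rfl⟩ := h.surjective r
    exact ⟨q • x, by simp [Algebra.algebraMap_eq_smul_one, TensorProduct.smul_tmul]⟩
  | add a b ha hb =>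
    obtain ⟨a, rfl⟩ := ha
    obtain ⟨b, rfl⟩ := hb
    exact ⟨a + b, by simp [TensorProduct.tmul_add]⟩

namespace Lift

variable {C : CochainComplex (ModuleCat.{u} R) ℤ} (L : Lift f C)

/-- The reduction of elements, from the terms of a lift to those of the complex. -/
def residue (n : ℤ) : L.X n →ₛₗ[algebraMap Q R] C.X n where
  toFun x := L.e n (1 ⊗ₜ x)
  map_add' x y := by rw [TensorProduct.tmul_add, map_add]
  map_smul' q x := by
    rw [TensorProduct.tmul_smul, ← map_smul, algebraMap_smul]

theorem residue_apply (n : ℤ) (x : L.X n) : L.residue n x = L.e n (1 ⊗ₜ x) := rfl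

theorem residue_surjective (h : IsRegularQuotient f R) (n : ℤ) :
    Function.Surjective (L.residue n) := fun z => by
  obtain ⟨x, hx⟩ := h.exists_one_tmul ((L.e n).symm z)
  exact ⟨x, (congrArg (L.e n) hx).trans ((L.e n).apply_symm_apply z)⟩

theorem residue_eq_zero_iff (h : IsRegularQuotient f R) (n : ℤ) (x : L.X n) :
    L.residue n x = 0 ↔ x ∈ initialIdeal f c • (⊤ : Submodule Q (L.X n)) := by
  rw [initialIdeal_length, ← h.one_tmul_eq_zero_iff]
  exact (L.e n).map_eq_zero_iff

theorem d_residue {m n : ℤ} (h : m + 1 = n) (x : L.X m) :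
    (C.d m n).hom (L.residue m x) = L.residue n (L.d m n x) := by
  have := LinearMap.congr_fun (L.comm m n h) (1 ⊗ₜ x)
  simpa [residue_apply] using this.symm

include L in
theorem finite (h : IsRegularQuotient f R) (hC : ∀ n, Module.Finite R (C.X n)) (n : ℤ) :
    Module.Finite Q (L.X n) := by
  have := h.nontrivial
  have := hC n
  have : Module.Finite R (R ⊗[Q] L.X n) := Module.Finite.equiv (L.e n).symm
  let b := Module.Free.chooseBasis Q (L.X n)
  have := Module.Finite.finite_basis (b.baseChange R)
  exact Module.Finite.of_basis b

/-- A lift, with its truncation in degrees `≤ 0`. -/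
abbrev curved (h : IsRegularQuotient f R) (hC : ∀ n, Module.Finite R (C.X n)) :
    CurvedComplex f c where
  X n := L.X n
  finite n := L.finite h hC n
  d := L.d
  t := L.t
  e n := if 0 < n then LinearMap.id else 0
  t_eq_zero k hk := absurd k.2 (not_lt.2 hk)
  d_d l m n hm hn x := by
    have := LinearMap.congr_fun (L.d_comp_d l m n hm hn) x
    simpa using this
  e_e n x := by by_cases hn : 0 < n <;> simp [hn]
  e_d_e := by
    rintro m _ rfl x
    by_cases hn : 0 < m
    · simp [hn, show 0 < m + 1 by lia]
    · simp [hn]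
  e_t_e := by
    rintro k m _ rfl x
    by_cases hn : 0 < m
    · simp [hn, show 0 < m + 2 by lia]
    · simp [hn]

section

variable (h : IsRegularQuotient f R) (hC : IsTotallyAcyclic C)

include h hC in
theorem exists_sub_d_mem {l m n : ℤ} (hm : l + 1 = m) (hn : m + 1 = n) (x : L.X m)
    (hx : (C.d m n).hom (L.residue m x) = 0) :
    ∃ u, x - L.d l m u ∈ initialIdeal f c • (⊤ : Submodule Q (L.X m)) := by
  have hex := (C.exactAt_iff' l m n (by simp [← hm]) (by simp [← hn])).1 (hC.acyclic m)
  obtain ⟨z, hz⟩ := (ShortComplex.moduleCat_exact_iff _).1 hex _ hx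
  obtain ⟨u, rfl⟩ := L.residue_surjective h l z
  refine ⟨u, (L.residue_eq_zero_iff h m _).1 ?_⟩
  rw [map_sub, ← L.d_residue hm]
  exact sub_eq_zero.2 hz.symm

/-- The truncation (`θ = 1`) need not be exact in degree `0`, where its homology is the image of
`d_0`. -/
theorem exactMod_curved (θ : Q) (n : ℤ) (hn : θ = 0 ∨ n + 1 < 0) :
    (L.curved h hC.finite).ExactMod θ n := by
  have key (m : ℤ) (hm : m ≤ n + 1 + 1) (x : L.X m) :
      x ∈ (L.curved h hC.finite).vanishing θ c m ↔ L.residue m x = 0 := by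
    rw [L.residue_eq_zero_iff h, CurvedComplex.mem_vanishing]
    obtain rfl | hn := hn
    · simp
    · simp [show ¬ 0 < m by lia]
  intro x hx
  obtain ⟨u, hu⟩ := L.exists_sub_d_mem h hC (l := n) rfl rfl x
    ((L.d_residue rfl x).trans ((key _ le_rfl _).1 hx))
  exact ⟨u, (key _ (by lia) _).2 ((L.residue_eq_zero_iff h _ _).2 hu)⟩

theorem dualExactMod_curved (n : ℤ) : (L.curved h hC.finite).DualExactMod n := by
  have hval {M : Type u} [AddCommGroup M] [Module Q M] (φ : M →ₗ[Q] Q) :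
      φ ∈ valuedIn (initialIdeal f c) M Q ↔ ∀ x, algebraMap Q R (φ x) = 0 := by
    refine forall_congr' fun x => ?_
    rw [initialIdeal_length, h.algebraMap_eq_zero_iff, smul_eq_mul, Ideal.mul_top]
  intro α hα
  rw [hval] at hα
  -- The functional that `α` induces on the complex over `R`.
  let α' (n : ℤ) (α : Module.Dual Q (L.X n)) : Module.Dual R (C.X n) :=
    α.baseChange R ∘ₗ (L.e n).symm.toLinearMap
  have hα' (n : ℤ) (α : Module.Dual Q (L.X n)) (x : L.X n) :
      α' n α (L.residue n x) = algebraMap Q R (α x) := by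
    simp [α', residue_apply, Algebra.algebraMap_eq_smul_one]
  have key (p : ℤ) (hp : n + 1 + 1 = p) : ∃ β : Module.Dual R (C.X p),
      β ∘ₗ (C.d (n + 1) p).hom = α' _ α := by
    obtain rfl : p = n + 2 := by lia
    refine (hC.dual_exact n (α' _ α)).1 (LinearMap.ext fun z => ?_)
    obtain ⟨z, rfl⟩ := L.residue_surjective h n z
    refine (congrArg (α' _ α) (L.d_residue rfl z)).trans ?_
    rw [hα']
    exact hα z
  obtain ⟨β, hβ⟩ := key _ rfl
  obtain ⟨γ, hγ⟩ := Module.projective_lifting_property (Algebra.linearMap Q R)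
    ({ toFun := fun x => β (L.residue _ x)
       map_add' := fun x y => by rw [map_add, map_add]
       map_smul' := fun q x => by
        rw [map_smulₛₗ, map_smul, algebraMap_smul]
        rfl } :
      L.X (n + 1 + 1) →ₗ[Q] R) h.surjective
  refine ⟨γ, (hval _).2 fun x => ?_⟩
  have h1 := LinearMap.congr_fun hγ (L.d _ _ x)
  have h2 := LinearMap.congr_fun hβ (L.residue _ x)
  rw [hα'] at h2
  rw [LinearMap.sub_apply, map_sub, ← h2, sub_eq_zero]
  exact (congrArg β (L.d_residue rfl x)).trans h1.symm

/-- The augmentation of a lift to the image of `d_0`. -/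
def augmentation : L.X 0 →ₗ[Q] imageZero Q C where
  toFun x := ⟨(C.d 0 1).hom (L.residue 0 x), _, rfl⟩
  map_add' x y := Subtype.ext ((congrArg (C.d 0 1).hom (map_add (L.residue 0) x y)).trans
    (map_add (C.d 0 1).hom _ _))
  map_smul' q x := Subtype.ext ((congrArg (C.d 0 1).hom (map_smulₛₗ (L.residue 0) q x)).trans
    (map_smul (C.d 0 1).hom (algebraMap Q R q) _))

theorem augmentation_eq_zero_iff (x : L.X 0) :
    L.augmentation x = 0 ↔ (C.d 0 1).hom (L.residue 0 x) = 0 :=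
  Subtype.ext_iff

theorem isAugmentation_curved :
    (L.curved h hC.finite).IsAugmentation (M := imageZero Q C) L.augmentation where
  surjective := by
    rintro ⟨_, z, rfl⟩
    obtain ⟨x, rfl⟩ := L.residue_surjective h 0 z
    exact ⟨x, rfl⟩
  apply_d u := (L.augmentation_eq_zero_iff _).2 <|
    (congrArg (C.d 0 1).hom (L.d_residue (m := -1) (n := 0) rfl u)).symm.trans
      (LinearMap.congr_fun (congrArg ModuleCat.Hom.hom (C.d_comp_d (-1) 0 1)) (L.residue (-1) u))
  apply_e x := by simp
  exact x hx := by
    obtain ⟨u, hu⟩ := L.exists_sub_d_mem h hC (l := -1) (m := 0) rfl rfl x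
      ((L.augmentation_eq_zero_iff x).1 hx)
    refine ⟨u, ?_⟩
    rw [CurvedComplex.mem_vanishing]
    simpa using hu

include h in
theorem smul_imageZero (C : CochainComplex (ModuleCat.{u} R) ℤ) (k : Fin c)
    (m : imageZero Q C) : f k • m = 0 := by
  have key (x : LinearMap.range (C.d 0 1).hom) : algebraMap Q R (f k) • x = 0 := by
    rw [h.algebraMap_apply_eq_zero, zero_smul]
  exact key m

/-- The complex over `Q` attached to a lift of a totally acyclic complex over `R`. -/
def resolution : CurvedComplex f 0 :=
  (L.curved h hC.finite).resolve h.regular c le_rfl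

/-- The complex attached to a lift is a complete resolution of the image of `d_0`. -/
theorem isT_resolution : IsT Q C (L.resolution h hC).toComplex := by
  obtain ⟨ε, hε⟩ := (L.isAugmentation_curved h hC).exists_resolve h.regular le_rfl
    (fun k m => smul_imageZero h C k m) (fun n hn x => by simp [hn])
  exact CurvedComplex.isCompleteResolution_toComplex _
    (fun n => (L.exactMod_curved h hC 0 n (.inl rfl)).resolve h.regular le_rfl (zero_mul 0))
    (CurvedComplex.DualExactMod.resolve h.regular le_rfl (L.dualExactMod_curved h hC))
    (fun n hn => (L.exactMod_curved h hC 1 n (.inr hn)).resolve h.regular le_rfl (one_mul 1))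
    hε c (CurvedComplex.resolve_e_of_le h.regular le_rfl _ fun n hn x => by
      simp [not_lt.2 hn])

end

end Lift

end

noncomputable section

/-! ### Vanishing of homotopy classes of maps -/

section

open CochainComplex CochainComplex.HomComplex

theorem forall_hom_shift_eq_zero_iff {S : Type u} [CommRing S]
    (K L : CochainComplex (ModuleCat.{u} S) ℤ) (n : ℤ) :
    (∀ g : toK K ⟶ (toK L)⟦n⟧, g = 0) ↔
      ∀ z : Cochain K L n, δ n (n + 1) z = 0 → ∃ u : Cochain K L (n - 1), δ (n - 1) n u = z := by
  have h1 : (∀ g : toK K ⟶ (toK L)⟦n⟧, g = 0) ↔ ∀ g : toK K ⟶ toK (L⟦n⟧), g = 0 := by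
    constructor
    · intro h g
      exact (cancel_mono (toKShiftIso L n).hom).1 ((h _).trans Limits.zero_comp.symm)
    · intro h g
      exact (cancel_mono (toKShiftIso L n).inv).1 ((h _).trans Limits.zero_comp.symm)
  rw [h1]
  constructor
  · intro h z hz
    exact (mem_coboundaries_iff _ (n - 1) (by lia)).1
      ((CohomologyClass.toHom_mk_eq_zero_iff (Cocycle.mk z (n + 1) rfl hz)).1 (h _))
  · intro h g
    obtain ⟨x, rfl⟩ := (CohomologyClass.toHom_bijective K L n).2 g
    obtain ⟨x, rfl⟩ := x.mk_surjective
    rw [CohomologyClass.toHom_mk_eq_zero_iff, mem_coboundaries_iff _ (n - 1) (by lia)]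
    exact h x.1 (x.δ_eq_zero _)

/-- A cochain from its components, indexed without a condition on the degrees. -/
theorem exists_cochain {S : Type u} [CommRing S] {K L : CochainComplex (ModuleCat.{u} S) ℤ}
    (n : ℤ) (ψ : ∀ p q : ℤ, K.X p ⟶ L.X (q + 1)) :
    ∃ z : Cochain K L n, ∀ p q h, z.v p (q + 1) h = ψ p q := by
  refine ⟨Cochain.mk fun p q _ => ψ p (q - 1) ≫ eqToHom (by simp), fun p q h => ?_⟩
  have key (q' : ℤ) (h : q' + 1 = q + 1) : ψ p q' ≫ eqToHom (by rw [h]) = ψ p q := by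
    obtain rfl : q' = q := by lia
    simp
  rw [Cochain.mk_v]
  exact key _ (by lia)

variable {Q : Type u} [CommRing Q] {c : ℕ} {f : Fin c → Q} {j : ℕ}

/-- If the maps of complexes over a ring `S` are, in all degrees, the maps from `W` to `A` over `Q`
modulo the first `j` elements of the sequence, then `CurvedComplex.HomExactMod` means that
homotopy classes of maps over `S` vanish. -/
theorem CurvedComplex.homExactMod_iff {S : Type u} [CommRing S]
    {W : CochainComplex (ModuleCat.{u} Q) ℤ} (A : CurvedComplex f j)
    {K L : CochainComplex (ModuleCat.{u} S) ℤ}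
    (ρ : ∀ p q, (W.X p →ₗ[Q] A.X q) →+ (K.X p ⟶ L.X q))
    (hsurj : ∀ p q, Function.Surjective (ρ p q))
    (hker : ∀ p q φ, ρ p q φ = 0 ↔ φ ∈ valuedIn (initialIdeal f j) _ _)
    (hA : ∀ p q φ, ρ p (q + 1) (A.d q (q + 1) ∘ₗ φ) = ρ p q φ ≫ L.d q (q + 1))
    (hW : ∀ p q φ, ρ p q (φ ∘ₗ (W.d p (p + 1)).hom) = K.d p (p + 1) ≫ ρ (p + 1) q φ) (n : ℤ) :
    HomExactMod W A ((n.negOnePow : ℤ) : Q) (1 - n) ↔ ∀ g : toK K ⟶ (toK L)⟦n⟧, g = 0 := by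
  have e₀ {p q : ℤ} (h : p = q + (1 - n)) : p + (n - 1) = q := by lia
  have e₁ {p q : ℤ} (h : p = q + (1 - n)) : p + n = q + 1 := by lia
  have e₂ {p q : ℤ} (h : p = q + (1 - n)) : p + (n + 1) = q + 1 + 1 := by lia
  have e₀' {p q : ℤ} (h : p + (n - 1) = q) : p = q + (1 - n) := by lia
  have e₁' {p q : ℤ} (h : p + n = q + 1) : p = q + (1 - n) := by lia
  have e₂' {p q : ℤ} (h : p + (n + 1) = q + 1 + 1) : p = q + (1 - n) := by lia
  have e₃ {p q : ℤ} (h : p = q + (1 - n)) : p + 1 = q + 1 + (1 - n) := by lia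
  rw [forall_hom_shift_eq_zero_iff]
  have hρ (σ : ℤ) (p q : ℤ) (φ) (ψ) : ρ p (q + 1) (A.d q (q + 1) ∘ₗ φ -
      (σ : Q) • ψ ∘ₗ (W.d p (p + 1)).hom) =
      ρ p q φ ≫ L.d q (q + 1) - σ • K.d p (p + 1) ≫ ρ (p + 1) (q + 1) ψ := by
    rw [map_sub, hA, Int.cast_smul_eq_zsmul, map_zsmul, hW]
  have hδ (z : Cochain K L n) (p q : ℤ) (hpq : p = q + (1 - n)) :
      (δ n (n + 1) z).v p (q + 1 + 1) (e₂ hpq) =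
        z.v p (q + 1) (e₁ hpq) ≫ L.d (q + 1) (q + 1 + 1) -
        (n.negOnePow : ℤ) • K.d p (p + 1) ≫ z.v (p + 1) (q + 1 + 1) (e₁ (e₃ hpq)) := by
    rw [δ_v n (n + 1) rfl z p (q + 1 + 1) (e₂ hpq) (q + 1) (p + 1) (add_sub_cancel_right _ _).symm
      rfl, Int.negOnePow_succ, Units.smul_def, Units.val_neg, neg_smul]
    exact (sub_eq_add_neg _ _).symm
  have hδ' (u : Cochain K L (n - 1)) (p q : ℤ) (hpq : p = q + (1 - n)) :
      (δ (n - 1) n u).v p (q + 1) (e₁ hpq) = u.v p q (e₀ hpq) ≫ L.d q (q + 1) -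
        (-(n.negOnePow : ℤ)) • K.d p (p + 1) ≫ u.v (p + 1) (q + 1) (e₀ (e₃ hpq)) := by
    rw [δ_v (n - 1) n (sub_add_cancel n 1) u p (q + 1) (e₁ hpq) q (p + 1)
      (add_sub_cancel_right _ _).symm rfl, Units.smul_def, neg_smul]
    exact (sub_neg_eq_add _ _).symm
  constructor
  · intro h z hz
    have hφ (p q : ℤ) : ∃ φ, ∀ hpq : p = q + (1 - n), ρ p (q + 1) φ = z.v p (q + 1) (e₁ hpq) := by
      by_cases hpq : p = q + (1 - n)
      · obtain ⟨φ, hφ⟩ := hsurj p (q + 1) (z.v p (q + 1) (e₁ hpq))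
        exact ⟨φ, fun _ => hφ⟩
      · exact ⟨0, fun h => absurd h hpq⟩
    choose φ hφ using hφ
    obtain ⟨u, hu⟩ := h φ fun p q hpq => (hker _ _ _).1 ((hρ _ _ _ _ _).trans (by
      rw [hφ p q hpq, hφ (p + 1) (q + 1) (e₃ hpq), ← hδ z p q hpq, hz, Cochain.zero_v]))
    refine ⟨Cochain.mk fun p q _ => ρ p q (u p q), ?_⟩
    refine Cochain.ext _ _ fun p q' hpq => ?_
    obtain ⟨q, rfl⟩ : ∃ q, q' = q + 1 := ⟨q' - 1, (sub_add_cancel _ _).symm⟩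
    have h1 := (hker _ _ _).2 (hu p q (e₁' hpq))
    rw [Pi.sub_apply, Pi.sub_apply, map_sub, sub_eq_zero, hφ p q (e₁' hpq)] at h1
    rw [h1, hδ' _ p q (e₁' hpq), Cochain.mk_v, Cochain.mk_v]
    refine (hρ _ _ _ _ _).symm.trans ?_
    rw [Int.cast_neg]
    rfl
  · intro h φ hφ
    obtain ⟨z, hz⟩ := exists_cochain n fun p q => ρ p (q + 1) (φ p q)
    obtain ⟨u, hu⟩ := h z (by
      refine Cochain.ext _ _ fun p q' hpq => ?_
      obtain ⟨q, rfl⟩ : ∃ q, q' = q + 1 + 1 := ⟨q' - 1 - 1, by simp⟩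
      rw [hδ z p q (e₂' hpq), hz, hz, Cochain.zero_v, ← hρ]
      exact (hker _ _ _).2 (hφ p q (e₂' hpq)))
    have hv (p q : ℤ) : ∃ v, ∀ hpq : p = q + (1 - n), ρ p q v = u.v p q (e₀ hpq) := by
      by_cases hpq : p = q + (1 - n)
      · obtain ⟨φ, hφ⟩ := hsurj p q (u.v p q (e₀ hpq))
        exact ⟨φ, fun _ => hφ⟩
      · exact ⟨0, fun h => absurd h hpq⟩
    choose v hv using hv
    refine ⟨v, fun p q hpq => (hker _ _ _).1 ?_⟩
    have h1 := hδ' u p q hpq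
    rw [hu, hz, ← hv p q hpq, ← hv (p + 1) (q + 1) (e₃ hpq), ← hρ] at h1
    rw [Pi.sub_apply, Pi.sub_apply, map_sub, sub_eq_zero, h1, Int.cast_neg]
    rfl

theorem CurvedComplex.homExactMod_toComplex_iff {W : CochainComplex (ModuleCat.{u} Q) ℤ}
    (A : CurvedComplex f 0) (n : ℤ) :
    HomExactMod W A ((n.negOnePow : ℤ) : Q) (1 - n) ↔
      ∀ g : toK W ⟶ (toK A.toComplex)⟦n⟧, g = 0 := by
  refine A.homExactMod_iff (fun p q => (ModuleCat.homAddEquiv (M := W.X p)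
    (N := A.toComplex.X q)).symm.toAddMonoidHom) (fun p q => AddEquiv.surjective _)
    (fun p q φ => ?_) (fun p q φ => ?_) (fun p q φ => rfl) n
  · have key {M N : Type u} [AddCommGroup M] [Module Q M] [AddCommGroup N] [Module Q N]
        (φ : M →ₗ[Q] N) : φ = 0 ↔ φ ∈ valuedIn (initialIdeal f 0) M N := by
      rw [LinearMap.ext_iff]
      refine forall_congr' fun x => ?_
      rw [initialIdeal_zero]
      simp
    exact (AddEquiv.map_eq_zero_iff _).trans (key φ)
  · ext x
    exact (A.toComplex_d_apply rfl _).symm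

end

end

noncomputable section

variable {Q : Type u} [CommRing Q] {R : Type u} [CommRing R] [Algebra Q R] {c : ℕ} {f : Fin c → Q}

/-! ### Naturality of the operators -/

namespace Lift

variable {C D E : CochainComplex (ModuleCat.{u} R) ℤ}
  (L : Lift f C) (L' : Lift f D) (L'' : Lift f E)

/-- A map between terms of two lifts, reduced to `R`. -/
def reduceTo (i j : ℤ) : (L.X i →ₗ[Q] L'.X j) →+ (C.X i ⟶ D.X j) where
  toFun g := ModuleCat.ofHom ((L'.e j).toLinearMap ∘ₗ g.baseChange R ∘ₗ (L.e i).symm.toLinearMap)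
  map_zero' := by
    ext x
    simp
  map_add' g g' := by
    ext x
    simp [LinearMap.baseChange_add]

theorem reduceTo_residue {i j : ℤ} (g : L.X i →ₗ[Q] L'.X j) (x : L.X i) :
    (L.reduceTo L' i j g).hom (L.residue i x) = L'.residue j (g x) := by
  simp [reduceTo, residue_apply]

theorem reduceTo_self {i j : ℤ} (g : L.X i →ₗ[Q] L.X j) : L.reduceTo L i j g = L.reduce g := rfl

theorem reduceTo_d {i j : ℤ} (h : i + 1 = j) : L.reduceTo L i j (L.d i j) = C.d i j :=
  L.reduce_d h

theorem reduceTo_comp {i j l : ℤ} (g : L.X i →ₗ[Q] L'.X j) (g' : L'.X j →ₗ[Q] L''.X l) :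
    L.reduceTo L'' i l (g' ∘ₗ g) = L.reduceTo L' i j g ≫ L'.reduceTo L'' j l g' := by
  ext x
  simp [reduceTo, LinearMap.baseChange_comp]

theorem reduceTo_eq_zero_iff (h : IsRegularQuotient f R) {i j : ℤ} (g : L.X i →ₗ[Q] L'.X j) :
    L.reduceTo L' i j g = 0 ↔ g ∈ valuedIn (initialIdeal f c) _ _ := by
  constructor
  · intro hg x
    rw [← L'.residue_eq_zero_iff h, ← L.reduceTo_residue L' g, hg]
    rfl
  · intro hg
    ext z
    obtain ⟨x, rfl⟩ := L.residue_surjective h i z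
    rw [reduceTo_residue]
    exact (L'.residue_eq_zero_iff h _ _).2 (hg x)

theorem reduceTo_surjective (h : IsRegularQuotient f R) (i j : ℤ) :
    Function.Surjective (L.reduceTo L' i j) := by
  intro φ
  have hsurj : Function.Surjective (TensorProduct.mk Q R (L'.X j) 1) := h.exists_one_tmul
  obtain ⟨g, hg⟩ := Module.projective_lifting_property (TensorProduct.mk Q R (L'.X j) 1)
    (((L'.e j).symm.toLinearMap ∘ₗ φ.hom ∘ₗ (L.e i).toLinearMap).restrictScalars Q ∘ₗ
      TensorProduct.mk Q R (L.X i) 1) hsurj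
  refine ⟨g, ?_⟩
  ext z
  obtain ⟨x, rfl⟩ := L.residue_surjective h i z
  rw [reduceTo_residue]
  have h1 := congrArg (L'.e j) (LinearMap.congr_fun hg x)
  simpa [residue_apply] using h1

theorem reduceTo_eq_zero_of_sum (h : IsRegularQuotient f R) {i j : ℤ}
    (g : Fin c → L.X i →ₗ[Q] L'.X j) (hg : ∑ k, f k • g k = 0) (k : Fin c) :
    L.reduceTo L' i j (g k) = 0 := by
  ext x
  simp [reduceTo, h.baseChange_eq_zero_of_sum g hg k]

theorem exists_sum_of_reduceTo_eq_zero (h : IsRegularQuotient f R) {i j : ℤ}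
    (g : L.X i →ₗ[Q] L'.X j) (hg : L.reduceTo L' i j g = 0) :
    ∃ τ : Fin c → L.X i →ₗ[Q] L'.X j, g = ∑ k, f k • τ k := by
  refine exists_eq_sum_smul f g fun x => ?_
  rw [← initialIdeal_length]
  exact (L.reduceTo_eq_zero_iff L' h g).1 hg x

theorem shiftedHom_comp_f {a b m : ℤ} (α : ShiftedHom C D a) (β : ShiftedHom D E b)
    (h : b + a = m) (i : ℤ) : (α.comp β h).f i =
      α.f i ≫ β.f (i + a) ≫ (E.XIsoOfEq (show i + a + b = i + m by lia)).hom := by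
  simp only [ShiftedHom.comp, HomologicalComplex.comp_f, CochainComplex.shiftFunctor_map_f']
  rw [CochainComplex.shiftFunctorAdd'_inv_app_f']
  rfl

theorem shiftedHom_comm {n : ℤ} (α : ShiftedHom C D n) {i i' l l' : ℤ} (hi : i + 1 = i')
    (hl : i + n = l) (hl' : i' + n = l') :
    C.d i i' ≫ α.f i' ≫ (D.XIsoOfEq hl').hom =
      (n.negOnePow : ℤ) • (α.f i ≫ (D.XIsoOfEq hl).hom) ≫ D.d l l' := by
  subst hi hl hl'
  have key (x : C.X i ⟶ D.X (i + n)) (y : C.X (i + 1) ⟶ D.X (i + 1 + n))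
      (hxy : x ≫ (n.negOnePow • D.d (i + n) (i + 1 + n)) = C.d i (i + 1) ≫ y) :
      C.d i (i + 1) ≫ y ≫ (D.XIsoOfEq (rfl : i + 1 + n = i + 1 + n)).hom =
        (n.negOnePow : ℤ) • (x ≫ (D.XIsoOfEq (rfl : i + n = i + n)).hom) ≫
          D.d (i + n) (i + 1 + n) := by
    simp [Units.smul_def, ← hxy]
  exact key _ _ (α.comm i (i + 1))

/-- A chain map lifts to maps `a` between the lifts, which commute with the differentials up to a
combination of the `f k`. -/
theorem exists_lift_shiftedHom (h : IsRegularQuotient f R) {n : ℤ} (α : ShiftedHom C D n) :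
    ∃ a : ∀ i l, L.X i →ₗ[Q] L'.X l,
      (∀ i l (hl : i + n = l), L.reduceTo L' i l (a i l) = α.f i ≫ (D.XIsoOfEq hl).hom) ∧
      ∃ τ : ∀ i l : ℤ, Fin c → L.X i →ₗ[Q] L'.X l,
        ∀ i i' l l', i + 1 = i' → l + 1 = l' → i + n = l →
        a i' l' ∘ₗ L.d i i' - (n.negOnePow : ℤ) • L'.d l l' ∘ₗ a i l = ∑ m, f m • τ i l' m := by
  have ha (i l : ℤ) : ∃ a, ∀ hl : i + n = l,
      L.reduceTo L' i l a = α.f i ≫ (D.XIsoOfEq hl).hom := by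
    by_cases hl : i + n = l
    · obtain ⟨a, ha⟩ := L.reduceTo_surjective L' h i l (α.f i ≫ (D.XIsoOfEq hl).hom)
      exact ⟨a, fun _ => ha⟩
    · exact ⟨0, fun h => absurd h hl⟩
  choose a ha using ha
  refine ⟨a, ha, ?_⟩
  have hτ (i l' : ℤ) : ∃ τ : Fin c → L.X i →ₗ[Q] L'.X l', ∀ i' l, i + 1 = i' → l + 1 = l' →
      i + n = l → a i' l' ∘ₗ L.d i i' - (n.negOnePow : ℤ) • L'.d l l' ∘ₗ a i l =
        ∑ m, f m • τ m := by
    by_cases hl : i + n + 1 = l'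
    swap
    · exact ⟨0, fun i' l _ h1 h2 => absurd (by lia) hl⟩
    subst hl
    obtain ⟨τ, hτ⟩ := L.exists_sum_of_reduceTo_eq_zero L' h
      (a (i + 1) (i + n + 1) ∘ₗ L.d i (i + 1) -
        (n.negOnePow : ℤ) • L'.d (i + n) (i + n + 1) ∘ₗ a i (i + n)) (by
      rw [map_sub, map_zsmul, L.reduceTo_comp L L', L.reduceTo_comp L' L', L.reduceTo_d rfl,
        L'.reduceTo_d rfl, ha _ _ (by lia), ha _ _ rfl, sub_eq_zero]
      exact shiftedHom_comm α rfl rfl (by lia))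
    refine ⟨τ, ?_⟩
    rintro _ l rfl h1 rfl
    exact hτ
  choose τ hτ using hτ
  exact ⟨τ, fun i i' l l' hi hl h => hτ i l' i' l hi hl h⟩

/-- The operators of two lifts are intertwined by chain maps, up to homotopy: comparing the squares
of the differentials, the maps `τ` that measure the failure of a lift of `α` to be a chain map are
the homotopies. -/
theorem nonempty_homotopy_chainMap_comp (h : IsRegularQuotient f R) (k : Fin c) (n m : ℤ)
    (hm : n + 2 = m) (hm' : 2 + n = m) (α : ShiftedHom C D n) :
    Nonempty (Homotopy ((L.chainMap h k).comp α hm) (α.comp (L'.chainMap h k) hm')) := by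
  obtain ⟨a, ha, τ, hτ⟩ := L.exists_lift_shiftedHom L' h α
  have hl1 (i : ℤ) : ((L.chainMap h k).comp α hm).f i =
      L.reduceTo L' i (i + m) (a (i + 2) (i + m) ∘ₗ L.t k i (i + 2)) := by
    rw [shiftedHom_comp_f, L.reduceTo_comp L L', ha _ _ (by lia)]
    rfl
  have hl2 (i : ℤ) : (α.comp (L'.chainMap h k) hm').f i =
      L.reduceTo L' i (i + m) (L'.t k (i + n) (i + m) ∘ₗ a i (i + n)) := by
    have key (l : ℤ) (hl : i + n + 2 = l) :
        L'.reduce (L'.t k (i + n) (i + n + 2)) ≫ (D.XIsoOfEq hl).hom =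
          L'.reduce (L'.t k (i + n) l) := by
      subst hl
      simp
    rw [shiftedHom_comp_f, L.reduceTo_comp L' L', ha _ _ rfl, reduceTo_self, ← key (i + m) (by lia)]
    have key' (x : C.X i ⟶ D.X (i + n)) (y : D.X (i + n) ⟶ D.X (i + n + 2))
        (z : D.X (i + n + 2) ⟶ D.X (i + m)) :
        x ≫ y ≫ z = (x ≫ (D.XIsoOfEq (rfl : i + n = i + n)).hom) ≫ y ≫ z := by
      simp
    exact key' _ _ _
  let s (i l : ℤ) : C.X i ⟶ D.X (l + m) :=
    if i = l + 1 then L.reduceTo L' _ _ (τ i (l + m) k) else 0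
  have hs (i l : ℤ) (hl : i = l + 1) : s i l = L.reduceTo L' _ _ (τ i (l + m) k) := if_pos hl
  refine ⟨{ hom := s
            zero := fun i l hil => if_neg fun hl => hil hl.symm
            comm := fun i => ?_ }⟩
  have hd : (D⟦m⟧).d (i - 1) i = (n.negOnePow : ℤ) • D.d (i - 1 + m) (i + m) := by
    subst hm
    change ((n + 2).negOnePow • D.d (i - 1 + (n + 2)) (i + (n + 2))) = _
    rw [Int.negOnePow_add, Int.negOnePow_even 2 (by decide), mul_one, Units.smul_def]
  refine (hl1 i).trans (Eq.trans ?_ (congrArg₂ (· + ·)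
    (congrArg₂ (· + ·) (dNext_eq _ (show i + 1 = i + 1 from rfl))
      (prevD_eq _ (show (i - 1) + 1 = i by omega))) (hl2 i)).symm)
  rw [hd]
  suffices H : L.reduceTo L' i (i + m) (a (i + 2) (i + m) ∘ₗ L.t k i (i + 2)) =
      C.d i (i + 1) ≫ s (i + 1) i +
        s i (i - 1) ≫ ((n.negOnePow : ℤ) • D.d (i - 1 + m) (i + m)) +
      L.reduceTo L' i (i + m) (L'.t k (i + n) (i + m) ∘ₗ a i (i + n)) from H
  rw [hs _ _ rfl, hs _ _ (by lia), Preadditive.comp_zsmul, ← L.reduceTo_d (i := i) rfl,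
    ← L'.reduceTo_d (i := i - 1 + m) (j := i + m) (by lia), ← reduceTo_comp, ← reduceTo_comp,
    ← map_zsmul, ← map_add, ← map_add, ← sub_eq_zero, ← map_sub]
  -- It suffices to check the sum of these identities with the coefficients `f k`, as the sequence
  -- is regular.
  refine L.reduceTo_eq_zero_of_sum L' h (fun k =>
    a (i + 2) (i + m) ∘ₗ L.t k i (i + 2) -
      (τ (i + 1) (i + m) k ∘ₗ L.d i (i + 1) +
        (n.negOnePow : ℤ) • L'.d (i - 1 + m) (i + m) ∘ₗ τ i (i - 1 + m) k +
      L'.t k (i + n) (i + m) ∘ₗ a i (i + n))) ?_ k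
  have h1 := L.d_comp_d i (i + 1) (i + 2) rfl (by lia)
  have h2 := L'.d_comp_d (i + n) (i - 1 + m) (i + m) (by lia) (by lia)
  have h3 := hτ (i + 1) (i + 2) (i - 1 + m) (i + m) (by lia) (by lia) (by lia)
  have h4 := hτ i (i + 1) (i + n) (i - 1 + m) (by lia) (by lia) (by lia)
  ext x
  have h1 := congrArg (a (i + 2) (i + m)) (LinearMap.congr_fun h1 x)
  have h2 := LinearMap.congr_fun h2 (a i (i + n) x)
  have h3 := LinearMap.congr_fun h3 (L.d i (i + 1) x)
  have h4 := congrArg (L'.d (i - 1 + m) (i + m)) (LinearMap.congr_fun h4 x)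
  have hσ : (n.negOnePow : ℤ) * (n.negOnePow : ℤ) = 1 := by
    rw [← Units.val_mul, Int.units_mul_self, Units.val_one]
  generalize (n.negOnePow : ℤ) = σ at h3 h4 hσ ⊢
  simp only [LinearMap.comp_apply, LinearMap.sub_apply, LinearMap.coe_sum, LinearMap.smul_apply,
    Finset.sum_apply, map_sum, map_smul, map_zsmul, map_sub, LinearMap.add_apply,
    LinearMap.zero_apply, smul_sub, smul_add, Finset.sum_sub_distrib,
    Finset.sum_add_distrib] at h1 h2 h3 h4 ⊢
  have h5 : ∑ k, f k • σ • L'.d (i - 1 + m) (i + m) (τ i (i - 1 + m) k x) =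
      σ • ∑ k, f k • L'.d (i - 1 + m) (i + m) (τ i (i - 1 + m) k x) := by
    rw [Finset.smul_sum]
    exact Finset.sum_congr rfl fun k _ => smul_comm _ _ _
  rw [h5, ← h1, ← h2, ← h3, ← h4, smul_sub, smul_smul, hσ, one_smul]
  abel

/-- The operators of two lifts are intertwined by maps in the homotopy category. -/
theorem operator_comp (h : IsRegularQuotient f R) (k : Fin c) (n m : ℤ) (hm : n + 2 = m)
    (hm' : 2 + n = m) (α : ShiftedHom (toK C) (toK D) n) :
    (L.operator h k).comp α hm = α.comp (L'.operator h k) hm' := by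
  obtain ⟨α, rfl⟩ : ∃ α' : ShiftedHom C D n, α'.map (HomotopyCategory.quotient _ _) = α := by
    obtain ⟨α', hα'⟩ := (HomotopyCategory.quotient _ _).map_surjective (α ≫ (toKShiftIso D n).inv)
    refine ⟨α', ?_⟩
    unfold ShiftedHom.map
    rw [hα']
    simp
  obtain ⟨H⟩ := L.nonempty_homotopy_chainMap_comp L' h k n m hm hm' α
  unfold Lift.operator
  rw [← ShiftedHom.map_comp, ← ShiftedHom.map_comp]
  unfold ShiftedHom.map
  rw [HomotopyCategory.eq_of_homotopy _ _ H]

end Lift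

end

noncomputable section

/-! ### Graded modules with operators of degree two -/

section

variable {R : Type u} [CommRing R]

theorem finite_directSum_iff {N : ℕ → Type u} [∀ i, AddCommGroup (N i)] [∀ i, Module R (N i)]
    (hN : ∀ i, Module.Finite R (N i)) :
    Module.Finite R (⨁ i, N i) ↔ ∃ p, ∀ i, p ≤ i → ∀ x : N i, x = 0 := by
  classical
  constructor
  · rintro ⟨s, hs⟩
    refine ⟨s.sup (fun y => y.support.sup id + 1), fun i hi x => ?_⟩
    have hle : Submodule.span R (s : Set (⨁ i, N i)) ≤
        LinearMap.ker (DirectSum.component R ℕ N i) := by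
      rw [Submodule.span_le]
      intro y hy
      by_contra h
      have h1 : i ≤ y.support.sup id :=
        Finset.le_sup (f := id) (DFinsupp.mem_support_iff.2 h)
      have h2 := (Finset.le_sup (f := fun y : ⨁ i, N i => y.support.sup id + 1) hy).trans hi
      lia
    have h1 := hle (hs ▸ Submodule.mem_top (x := lof R ℕ N i x))
    simpa using h1
  · rintro ⟨p, hp⟩
    refine ⟨?_⟩
    have h : (⊤ : Submodule R (⨁ i, N i)) =
        ⨆ i ∈ Finset.range p, LinearMap.range (lof R ℕ N i) := by
      refine (eq_top_iff.2 fun y _ => ?_).symm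
      rw [← DirectSum.sum_support_of y]
      refine Submodule.sum_mem _ fun i _ => ?_
      by_cases hi : i < p
      · exact Submodule.mem_iSup_of_mem i
          (Submodule.mem_iSup_of_mem (Finset.mem_range.2 hi) ⟨y i, rfl⟩)
      · rw [hp i (by lia) (y i), map_zero]
        exact zero_mem _
    rw [h]
    exact Submodule.fg_biSup _ _ fun i _ => by
      rw [LinearMap.range_eq_map]
      exact (hN i).fg_top.map _

end

section Operators

variable {R : Type u} [CommRing R] {c : ℕ} {N : ℤ → Type u} [∀ i, AddCommGroup (N i)]
  [∀ i, Module R (N i)]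

/-- In large degrees, the elements of `B` are combinations of values of the operators `χ k`
on elements of `B`. -/
def EventuallyGenerated (χ : Fin c → ∀ i j : ℤ, i + 2 = j → N i →ₗ[R] N j)
    (B : ∀ i, Submodule R (N i)) : Prop :=
  ∃ p : ℕ, ∀ (i j : ℤ) (h : i + 2 = j), p ≤ i → B j ≤ ⨆ k, (B i).map (χ k i j h)

variable {χ : Fin c → ∀ i j : ℤ, i + 2 = j → N i →ₗ[R] N j}

section Module

/-- The operators `χ` act on `M`, the sum of the terms of `N` in degrees `≥ 0`, as the
variables of a polynomial ring. -/
structure IsOperatorSum (χ : Fin c → ∀ i j : ℤ, i + 2 = j → N i →ₗ[R] N j) {M : Type*}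
    [AddCommGroup M] [Module (MvPolynomial (Fin c) R) M]
    (e : (⨁ i : ℕ, N i) ≃+ M) : Prop where
  C_smul : ∀ (r : R) (x : ⨁ i : ℕ, N i), MvPolynomial.C (σ := Fin c) r • e x = e (r • x)
  X_smul : ∀ (k : Fin c) (i : ℕ) (x : N i),
    MvPolynomial.X (R := R) k • e (lof R ℕ (fun i : ℕ => N i) i x) =
    e (lof R ℕ (fun i : ℕ => N i) (i + 2) (χ k i (i + 2 : ℕ) (by push_cast; rfl) x))

variable {M : Type*} [AddCommGroup M] [Module (MvPolynomial (Fin c) R) M]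
  {e : (⨁ i : ℕ, N i) ≃+ M}

/-- The terms of degree `i + 2` of multiples by variables come from those of degree `i`. -/
theorem X_smul_component_mem (he : IsOperatorSum χ e) {B : ∀ i : ℤ, Submodule R (N i)}
    (P : ∀ i : ℤ, Submodule R (N i))
    (hP : ∀ k i j h, (B i).map (χ k i j h) ≤ P j) (k : Fin c) (x : ⨁ i : ℕ, N i)
    (hx : ∀ n : ℕ, x n ∈ B n) (n : ℕ) :
    e.symm (MvPolynomial.X (R := R) k • e x) n ∈ P n := by
  classical
  have hx' : x = ∑ i ∈ x.support, lof R ℕ (fun i : ℕ => N i) i (x i) :=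
    (DirectSum.sum_support_of x).symm
  rw [hx', map_sum, Finset.smul_sum, map_sum, DFinsupp.finsetSum_apply]
  refine Submodule.sum_mem _ fun i _ => ?_
  rw [he.X_smul, AddEquiv.symm_apply_apply]
  by_cases hin : i + 2 = n
  · subst hin
    rw [DirectSum.lof_apply]
    exact hP k i _ _ (Submodule.mem_map_of_mem (hx i))
  · rw [DirectSum.lof_eq_of, DirectSum.of_eq_of_ne _ _ _ (Ne.symm hin)]
    exact zero_mem _

/-- The homogeneous submodule with the given components, which are preserved by the operators. -/
def homogeneousSubmodule (he : IsOperatorSum χ e) (B : ∀ i : ℤ, Submodule R (N i))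
    (hB : ∀ k i j h, (B i).map (χ k i j h) ≤ B j) :
    Submodule (MvPolynomial (Fin c) R) M where
  carrier := {y | ∀ n : ℕ, e.symm y n ∈ B n}
  add_mem' {x y} hx hy n := by
    rw [map_add]
    exact add_mem (hx n) (hy n)
  zero_mem' n := by
    rw [map_zero]
    exact zero_mem _
  smul_mem' s y hy := by
    induction s using MvPolynomial.induction_on generalizing y with
    | C r =>
      intro n
      obtain ⟨x, rfl⟩ := e.surjective y
      rw [he.C_smul, AddEquiv.symm_apply_apply]
      have := hy n
      rw [AddEquiv.symm_apply_apply] at this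
      exact Submodule.smul_mem _ r this
    | add s t hs ht =>
      intro n
      rw [add_smul, map_add]
      exact add_mem (hs _ hy n) (ht _ hy n)
    | mul_X s k hs =>
      rw [mul_smul]
      refine hs _ fun n => ?_
      obtain ⟨x, rfl⟩ := e.surjective y
      exact X_smul_component_mem he B hB k x
        (fun m => by simpa using hy m) n

theorem mem_homogeneousSubmodule {he : IsOperatorSum χ e} {B : ∀ i : ℤ, Submodule R (N i)}
    {hB : ∀ k i j h, (B i).map (χ k i j h) ≤ B j} {y : M} :
    y ∈ homogeneousSubmodule he B hB ↔ ∀ n : ℕ, e.symm y n ∈ B n := Iff.rfl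

theorem EventuallyGenerated.of_fg (he : IsOperatorSum χ e) {B : ∀ i : ℤ, Submodule R (N i)}
    (hB : ∀ k i j h, (B i).map (χ k i j h) ≤ B j)
    (hfg : (homogeneousSubmodule he B hB).FG) : EventuallyGenerated χ B := by
  classical
  obtain ⟨s, hs⟩ := hfg
  obtain ⟨p, hp⟩ : ∃ p : ℕ, ∀ y ∈ s, ∀ n, p ≤ n → e.symm y n = 0 := by
    refine ⟨s.sup fun y => (e.symm y).support.sup id + 1, fun y hy n hn => ?_⟩
    by_contra h
    have h1 : n ≤ (e.symm y).support.sup id :=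
      Finset.le_sup (f := id) (DFinsupp.mem_support_iff.2 h)
    have h2 := (Finset.le_sup (f := fun y => (e.symm y).support.sup id + 1) hy).trans hn
    lia
  -- The elements of `B` which, in degrees `≥ p`, are values of the operators.
  let P (j : ℤ) : Submodule R (N j) :=
    if p ≤ j then ⨆ k, (B (j - 2)).map (χ k (j - 2) j (by lia)) else ⊤
  have hP (k i j h) : (B i).map (χ k i j h) ≤ P j := by
    obtain rfl : i = j - 2 := by lia
    unfold P
    split_ifs
    · exact le_iSup (fun k => (B (j - 2)).map (χ k (j - 2) j h)) k
    · exact le_top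
  have hBP (k i j h) : (B i ⊓ P i).map (χ k i j h) ≤ B j ⊓ P j :=
    le_inf ((Submodule.map_mono inf_le_left).trans (hB k i j h))
      ((Submodule.map_mono inf_le_left).trans (hP k i j h))
  have hle : homogeneousSubmodule he B hB ≤
      homogeneousSubmodule he (fun i => B i ⊓ P i) hBP := by
    rw [← hs, Submodule.span_le]
    intro y hy n
    refine ⟨(mem_homogeneousSubmodule.1 (hs ▸ Submodule.subset_span hy)) n, ?_⟩
    unfold P
    split_ifs with h
    · rw [hp y hy n (by exact_mod_cast h)]
      exact zero_mem _
    · exact Submodule.mem_top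
  refine ⟨p, fun i j h hpi x hx => ?_⟩
  obtain ⟨n, rfl⟩ : ∃ n : ℕ, j = n := ⟨j.toNat, by lia⟩
  have hx' : e (lof R ℕ (fun i : ℕ => N i) n x) ∈ homogeneousSubmodule he B hB := by
    intro m
    rw [AddEquiv.symm_apply_apply]
    by_cases hnm : n = m
    · subst hnm
      rwa [DirectSum.lof_apply]
    · rw [DirectSum.lof_eq_of, DirectSum.of_eq_of_ne _ _ _ (Ne.symm hnm)]
      exact zero_mem _
  have h2 := (hle hx' n).2
  rw [AddEquiv.symm_apply_apply, DirectSum.lof_apply] at h2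
  unfold P at h2
  rw [if_pos (by lia)] at h2
  obtain rfl : i = n - 2 := by lia
  exact h2

theorem finite_of_eventuallyGenerated (he : IsOperatorSum χ e)
    (hfin : ∀ i, Module.Finite R (N i)) (h : EventuallyGenerated χ fun _ => ⊤) :
    Module.Finite (MvPolynomial (Fin c) R) M := by
  classical
  obtain ⟨p, hp⟩ := h
  choose s hs using fun i => (hfin i).fg_top
  let T : Submodule (MvPolynomial (Fin c) R) M := Submodule.span _
    ↑((Finset.range (p + 2)).biUnion fun i =>
      (s i).image fun x => e (lof R ℕ (fun i : ℕ => N i) i x))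
  have hT (n : ℕ) (x : N n) : e (lof R ℕ (fun i : ℕ => N i) n x) ∈ T := by
    induction n using Nat.strong_induction_on with
    | _ n ih =>
    -- The elements of degree `n` of `T`.
    let T' : Submodule R (N n) :=
      { carrier := {x | e (lof R ℕ (fun i : ℕ => N i) n x) ∈ T}
        add_mem' := fun {x y} hx hy => by
          simp only [Set.mem_ofPred_eq, map_add] at hx hy ⊢
          exact add_mem hx hy
        zero_mem' := by simp
        smul_mem' := fun r x hx => by
          simp only [Set.mem_ofPred_eq, map_smul] at hx ⊢
          rw [← he.C_smul]
          exact Submodule.smul_mem _ _ hx }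
    suffices H : (⊤ : Submodule R (N n)) ≤ T' from H Submodule.mem_top
    by_cases hn : n < p + 2
    · rw [← hs, Submodule.span_le]
      intro x hx
      refine Submodule.subset_span ?_
      simp only [Finset.coe_biUnion, Set.mem_iUnion, Finset.coe_image]
      exact ⟨n, by simpa using hn, x, hx, rfl⟩
    · obtain ⟨m, rfl⟩ := Nat.exists_eq_add_of_le' (show 2 ≤ n by lia)
      refine (hp m _ (by push_cast; rfl) (by lia)).trans (iSup_le fun k => ?_)
      rintro _ ⟨y, -, rfl⟩
      change e (lof R ℕ (fun i : ℕ => N i) (m + 2) _) ∈ T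
      rw [← he.X_smul]
      exact Submodule.smul_mem _ _ (ih m (by lia) y)
  refine ⟨⟨_, eq_top_iff.2 fun y _ => (?_ : y ∈ T)⟩⟩
  obtain ⟨x, rfl⟩ := e.surjective y
  rw [← DirectSum.sum_support_of x, map_sum]
  exact Submodule.sum_mem _ fun i _ => hT i (x i)

/-- The variables of the polynomial ring act by given commuting operators. -/
theorem exists_isOperatorSum (hχ : ∀ k l i j m hij hjm, ∀ x,
    χ k j m hjm (χ l i j hij x) = χ l j m hjm (χ k i j hij x)) :
    ∃ _ : Module (MvPolynomial (Fin c) R) (⨁ i : ℕ, N i),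
      IsOperatorSum χ (AddEquiv.refl (⨁ i : ℕ, N i)) := by
  let X (k : Fin c) : Module.End R (⨁ i : ℕ, N i) :=
    DirectSum.toModule R ℕ _ fun i =>
      DirectSum.lof R ℕ (fun i : ℕ => N i) (i + 2) ∘ₗ χ k i (i + 2 : ℕ) (by push_cast; rfl)
  have hX (k : Fin c) (i : ℕ) (x : N i) : X k (lof R ℕ (fun i : ℕ => N i) i x) =
      lof R ℕ (fun i : ℕ => N i) (i + 2) (χ k i (i + 2 : ℕ) (by push_cast; rfl) x) := by
    simp [X]
  have hcomm (k l : Fin c) : X k * X l = X l * X k := by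
    refine DirectSum.linearMap_ext R fun i => LinearMap.ext fun x => ?_
    simp only [LinearMap.comp_apply, Module.End.mul_apply, hX]
    exact congrArg _ (hχ k l _ _ _ _ _ x)
  let : CommRing (Algebra.adjoin R (Set.range X)) :=
    { (Algebra.adjoin R (Set.range X)).toRing with
      mul_comm := (Algebra.isMulCommutative_adjoin R (by
        rintro _ ⟨k, rfl⟩ _ ⟨l, rfl⟩
        exact hcomm k l)).is_comm.comm }
  let φ : MvPolynomial (Fin c) R →ₐ[R] Module.End R (⨁ i : ℕ, N i) :=
    (Algebra.adjoin R (Set.range X)).val.comp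
      (MvPolynomial.aeval fun k => ⟨X k, Algebra.subset_adjoin ⟨k, rfl⟩⟩)
  let : Module (MvPolynomial (Fin c) R) (⨁ i : ℕ, N i) := Module.compHom _ φ.toRingHom
  refine ⟨this, ⟨fun r x => ?_, fun k i x => ?_⟩⟩
  · change φ (MvPolynomial.C r) x = r • x
    rw [← MvPolynomial.algebraMap_eq, AlgHom.commutes]
    rfl
  · refine Eq.trans ?_ (hX k i x)
    change φ (MvPolynomial.X k) _ = _
    simp [φ]

theorem finite_iff_eventuallyGenerated (he : IsOperatorSum χ e)
    (hfin : ∀ i, Module.Finite R (N i)) :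
    Module.Finite (MvPolynomial (Fin c) R) M ↔ EventuallyGenerated χ fun _ => ⊤ := by
  refine ⟨fun h => .of_fg he (fun _ _ _ _ => le_top) ?_, finite_of_eventuallyGenerated he hfin⟩
  convert h.fg_top
  exact eq_top_iff.2 fun y _ n => Submodule.mem_top

end Module

/-- The Hilbert basis theorem for modules with operators. -/
theorem EventuallyGenerated.mono [IsNoetherianRing R] (hχ : ∀ k l i j m hij hjm, ∀ x,
      χ k j m hjm (χ l i j hij x) = χ l j m hjm (χ k i j hij x))
    (hfin : ∀ i, Module.Finite R (N i)) (h : EventuallyGenerated χ fun _ => ⊤)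
    {B : ∀ i : ℤ, Submodule R (N i)} (hB : ∀ k i j h, (B i).map (χ k i j h) ≤ B j) :
    EventuallyGenerated χ B := by
  obtain ⟨_, he⟩ := exists_isOperatorSum hχ
  have := finite_of_eventuallyGenerated he hfin h
  exact .of_fg he hB (IsNoetherian.noetherian _)

section Exact

variable {P : ℤ → Type u} [∀ i, AddCommGroup (P i)] [∀ i, Module R (P i)]
  {ψ : Fin c → ∀ i j : ℤ, i + 2 = j → P i →ₗ[R] P j}
  (π : ∀ i, N i →ₗ[R] P i) (ι : ∀ i j : ℤ, i = j + 1 → P i →ₗ[R] N j)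

include π ι in
theorem finite_of_exact [IsNoetherianRing R] (hfin : ∀ i, Module.Finite R (N i))
    (hex : ∀ i j h x, ι i j h x = 0 → x ∈ LinearMap.range (π i)) (i : ℤ) :
    Module.Finite R (P i) := by
  have h1 : (LinearMap.ker (ι i (i - 1) (sub_add_cancel i 1).symm)).FG := by
    have : Submodule.FG (LinearMap.range (π i)) := 
      LinearMap.range_eq_map (π i) ▸ (hfin i).fg_top.map _
    have h2 : LinearMap.ker (ι i (i - 1) (sub_add_cancel i 1).symm) ≤ LinearMap.range (π i) :=
      fun x hx => hex _ _ _ x hx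
    have : IsNoetherian R (LinearMap.range (π i)) :=
      isNoetherian_of_isNoetherianRing_of_finite R _
    exact isNoetherian_submodule.1 this _ h2
  refine ⟨Submodule.fg_of_fg_map_of_fg_inf_ker (ι i (i - 1) (sub_add_cancel i 1).symm)
    (IsNoetherian.noetherian _) ?_⟩
  rwa [top_inf_eq]

/-- Let `N → P → N` be exact, where the second map has degree `-1`, and let the kernel of the first
map consist of values of `χ k₀`: then `P` is like a cone of `χ k₀`. It is eventually generated under
the operators if and only if `N` is. -/
theorem eventuallyGenerated_iff_of_exact [IsNoetherianRing R]
    (hχ : ∀ k l i j m hij hjm, ∀ x,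
      χ k j m hjm (χ l i j hij x) = χ l j m hjm (χ k i j hij x))
    (hψ : ∀ k l i j m hij hjm, ∀ x,
      ψ k j m hjm (ψ l i j hij x) = ψ l j m hjm (ψ k i j hij x))
    (hfin : ∀ i, Module.Finite R (N i)) (k₀ : Fin c)
    (hex : ∀ i j h x, ι i j h x = 0 → x ∈ LinearMap.range (π i))
    (hex' : ∀ i x, π i x = 0 → x ∈ LinearMap.range (χ k₀ (i - 2) i (sub_add_cancel i 2)))
    (hπχ : ∀ k i j h x, π j (χ k i j h x) = ψ k i j h (π i x))
    (hιχ : ∀ k i i' j j' hi hj h h' x, ι i' j' h' (ψ k i i' hi x) = χ k j j' hj (ι i j h x)) :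
    EventuallyGenerated χ (fun _ => ⊤) ↔ EventuallyGenerated ψ fun _ => ⊤ := by
  have hπχ' (k i j h) : ψ k i j h ∘ₗ π i = π j ∘ₗ χ k i j h :=
    LinearMap.ext fun x => (hπχ k i j h x).symm
  have hιχ' (k i i' j j' hi hj h h') : χ k j j' hj ∘ₗ ι i j h = ι i' j' h' ∘ₗ ψ k i i' hi :=
    LinearMap.ext fun x => (hιχ k i i' j j' hi hj h h' x).symm
  constructor
  · intro h
    obtain ⟨q, hq⟩ := h
    obtain ⟨p, hp⟩ := EventuallyGenerated.mono hχ hfin ⟨q, hq⟩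
      (B := fun i => LinearMap.range (ι (i + 1) i rfl)) (by
      rintro k i j h _ ⟨_, ⟨x, rfl⟩, rfl⟩
      exact ⟨ψ k (i + 1) (j + 1) (by omega) x, hιχ ..⟩)
    refine ⟨p + q + 1, fun i j hij hi x _ => ?_⟩
    obtain ⟨i, rfl⟩ : ∃ i', i = i' + 1 := ⟨i - 1, by omega⟩
    obtain ⟨j, rfl⟩ : ∃ j', j = j' + 1 := ⟨j - 1, by omega⟩
    -- `P` is an extension of a submodule of `N`, up to a shift, by a quotient of `N`.
    have h1 := hp i j (by omega) (by push_cast at hi; omega) ⟨x, rfl⟩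
    simp only [LinearMap.range_eq_map, ← Submodule.map_comp,
      hιχ' _ (i + 1) (j + 1) i j hij (by omega) rfl rfl] at h1
    simp only [Submodule.map_comp, ← Submodule.map_iSup] at h1
    obtain ⟨y, hy, hyx⟩ := h1
    rw [← sub_add_cancel x y]
    refine add_mem ?_ hy
    obtain ⟨z, hz⟩ := hex (j + 1) j rfl (x - y) (by rw [map_sub, hyx, sub_self])
    have h2 := Submodule.mem_map_of_mem (f := π (j + 1))
      (hq (i + 1) (j + 1) hij (by push_cast at hi; omega) (Submodule.mem_top (x := z)))
    simp only [Submodule.map_iSup, ← Submodule.map_comp, ← hπχ'] at h2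
    rw [hz] at h2
    simp only [Submodule.map_comp] at h2
    exact iSup_mono (fun k => Submodule.map_mono le_top) h2
  · intro h
    obtain ⟨p, hp⟩ := EventuallyGenerated.mono hψ (finite_of_exact π ι hfin hex) h
      (B := fun i => LinearMap.range (π i)) (by
      rintro k i j h _ ⟨_, ⟨x, rfl⟩, rfl⟩
      exact ⟨χ k i j h x, hπχ ..⟩)
    refine ⟨p, fun i j hij hi x _ => ?_⟩
    -- The image of `N` in `P` is a submodule, so it is eventually generated; and the kernel
    -- consists of values of `χ k₀`.
    have h1 := hp i j hij hi ⟨x, rfl⟩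
    simp only [LinearMap.range_eq_map, ← Submodule.map_comp, hπχ'] at h1
    simp only [Submodule.map_comp, ← Submodule.map_iSup] at h1
    obtain ⟨y, hy, hyx⟩ := h1
    rw [← sub_add_cancel x y]
    refine add_mem ?_ hy
    obtain rfl : i = j - 2 := by omega
    obtain ⟨z, hz⟩ := hex' j (x - y) (by rw [map_sub, hyx, sub_self])
    rw [← hz]
    exact Submodule.mem_iSup_of_mem k₀ ⟨z, trivial, rfl⟩

end Exact

theorem eventuallyGenerated_iff_of_eq_zero
    (hχ : ∀ k i j hij, χ k i j hij = 0) :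
    EventuallyGenerated χ (fun _ => ⊤) ↔ ∃ p : ℕ, ∀ i : ℕ, p ≤ i → ∀ x : N i, x = 0 := by
  constructor
  · rintro ⟨p, hp⟩
    refine ⟨p + 2, fun i hi x => ?_⟩
    have h1 := hp (i - 2) i (by lia) (by lia) (Submodule.mem_top (x := x))
    simpa [hχ] using h1
  · rintro ⟨p, hp⟩
    refine ⟨p, fun i j hij hi x _ => ?_⟩
    obtain ⟨n, rfl⟩ : ∃ n : ℕ, j = n := ⟨j.toNat, by lia⟩
    rw [hp n (by lia) x]
    exact zero_mem _

theorem EventuallyGenerated.of_equiv {P : ℤ → Type u} [∀ i, AddCommGroup (P i)]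
    [∀ i, Module R (P i)]
    {ψ : Fin c → ∀ i j : ℤ, i + 2 = j → P i →ₗ[R] P j} (φ : ∀ i, N i ≃ₗ[R] P i)
    (hφ : ∀ k i j h x, φ j (χ k i j h x) = ψ k i j h (φ i x))
    (h : EventuallyGenerated χ fun _ => ⊤) : EventuallyGenerated ψ fun _ => ⊤ := by
  obtain ⟨p, hp⟩ := h
  refine ⟨p, fun i j hij hi x _ => ?_⟩
  have hφ' (k) : (φ j).toLinearMap ∘ₗ χ k i j hij = ψ k i j hij ∘ₗ (φ i).toLinearMap :=
    LinearMap.ext fun x => hφ k i j hij x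
  have h1 := Submodule.mem_map_of_mem (f := (φ j).toLinearMap)
    (hp i j hij hi (Submodule.mem_top (x := (φ j).symm x)))
  simp only [Submodule.map_iSup, ← Submodule.map_comp, hφ', LinearEquiv.coe_coe,
    LinearEquiv.apply_symm_apply] at h1
  simp only [Submodule.map_comp] at h1
  exact iSup_mono (fun k => Submodule.map_mono le_top) h1

end Operators
end

noncomputable section

/-! ### Cones of operators in triangulated categories -/

section Triangulated

open Pretriangulated

variable {R : Type u} [CommRing R] {c : ℕ} {𝒯 : Type*} [Category.{u} 𝒯] [Preadditive 𝒯]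
  [Linear R 𝒯] [HasShift 𝒯 ℤ]

variable (R) in
/-- Composition with operators of degree two on the target. -/
def postcomp (X : 𝒯) {Y : 𝒯} (τ : Fin c → ShiftedHom Y Y (2 : ℤ)) (k : Fin c) (i j : ℤ)
    (h : i + 2 = j) : ShiftedHom X Y i →ₗ[R] ShiftedHom X Y j where
  toFun x := x.comp (τ k) ((add_comm 2 i).trans h)
  map_add' _ _ := ShiftedHom.add_comp ..
  map_smul' _ _ := ShiftedHom.smul_comp ..

theorem postcomp_apply (X : 𝒯) {Y : 𝒯} (τ : Fin c → ShiftedHom Y Y (2 : ℤ)) (k : Fin c) (i j : ℤ)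
    (h : i + 2 = j) (x : ShiftedHom X Y i) :
    postcomp R X τ k i j h x = x.comp (τ k) ((add_comm 2 i).trans h) := rfl

theorem postcomp_comm (X : 𝒯) {Y : 𝒯} {τ : Fin c → ShiftedHom Y Y (2 : ℤ)}
    (hτ : ∀ k l, (τ k).comp (τ l) (show (2 : ℤ) + 2 = 4 by norm_num) =
      (τ l).comp (τ k) (show (2 : ℤ) + 2 = 4 by norm_num)) (k l : Fin c) (i j m : ℤ)
    (hij : i + 2 = j) (hjm : j + 2 = m) (x : ShiftedHom X Y i) :
    postcomp R X τ k j m hjm (postcomp R X τ l i j hij x) =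
      postcomp R X τ l j m hjm (postcomp R X τ k i j hij x) := by
  simp only [postcomp_apply]
  rw [ShiftedHom.comp_assoc _ _ _ _ (show (2 : ℤ) + 2 = 4 by norm_num) (by omega),
    ShiftedHom.comp_assoc _ _ _ _ (show (2 : ℤ) + 2 = 4 by norm_num) (by omega), hτ]

variable [∀ n : ℤ, (shiftFunctor 𝒯 n).Additive] [∀ n : ℤ, (shiftFunctor 𝒯 n).Linear R]

/-- Precomposition with a map of degree `a`. -/
def precomp {X X' : 𝒯} {a : ℤ} (β : ShiftedHom X X' a) (Y : 𝒯) (i j : ℤ) (h : i + a = j) :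
    ShiftedHom X' Y i →ₗ[R] ShiftedHom X Y j where
  toFun x := β.comp x h
  map_add' _ _ := ShiftedHom.comp_add ..
  map_smul' _ _ := ShiftedHom.comp_smul ..

theorem precomp_apply {X X' : 𝒯} {a : ℤ} (β : ShiftedHom X X' a) (Y : 𝒯) (i j : ℤ)
    (h : i + a = j) (x : ShiftedHom X' Y i) :
    precomp (R := R) β Y i j h x = β.comp x h := rfl

theorem precomp_postcomp {X X' Y : 𝒯} {a : ℤ} (β : ShiftedHom X X' a)
    (τ : Fin c → ShiftedHom Y Y (2 : ℤ)) (k : Fin c) (i j i' j' : ℤ) (h : i + a = j)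
    (h' : i' + a = j') (hi : i + 2 = i') (hj : j + 2 = j') (x : ShiftedHom X' Y i) :
    precomp (R := R) β Y i' j' h' (postcomp R X' τ k i i' hi x) =
      postcomp R X τ k j j' hj (precomp (R := R) β Y i j h x) := by
  simp only [precomp_apply, postcomp_apply]
  rw [ShiftedHom.comp_assoc _ _ _ _ ((add_comm 2 i).trans hi) (by omega)]

theorem exists_shift_comp_eq_zero {K X : 𝒯} {ι : K⟦(1 : ℤ)⟧ ⟶ X} :
    ∃ β : ShiftedHom K X (-1 : ℤ), ∀ (Y : 𝒯) (i j : ℤ) (h : i + -1 = j) (x : ShiftedHom X Y i),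
      β.comp x h = 0 → ι ≫ x = 0 := by
  refine ⟨(shiftFunctorCompIsoId 𝒯 (1 : ℤ) (-1) (by norm_num)).inv.app K ≫ ι⟦(-1 : ℤ)⟧',
    fun Y i j h x hx => (shiftFunctor 𝒯 (-1 : ℤ)).map_injective ?_⟩
  unfold ShiftedHom.comp at hx
  rw [Functor.map_comp, Functor.map_zero]
  have h1 := congrArg (fun z => (shiftFunctorCompIsoId 𝒯 (1 : ℤ) (-1) (by norm_num)).hom.app K ≫
    z ≫ (shiftFunctorAdd' 𝒯 i (-1) j h).hom.app Y) hx
  simpa using h1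

variable [Limits.HasZeroObject 𝒯] [Pretriangulated 𝒯]

theorem exists_comp_of_comp_eq_zero {K X Y : 𝒯} {ι : K⟦(1 : ℤ)⟧ ⟶ X} {π : X ⟶ K}
    {δ : K ⟶ (K⟦(1 : ℤ)⟧)⟦(1 : ℤ)⟧} (hT : Triangle.mk ι π δ ∈ distTriang 𝒯) (i j : ℤ)
    (h : i + 2 = j) (x : ShiftedHom K Y j) (hx : π ≫ x = 0) :
    ∃ y : ShiftedHom K Y i, x =
      ShiftedHom.comp (δ ≫ (shiftFunctorAdd' 𝒯 1 1 2 rfl).inv.app K) y h := by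
  obtain ⟨w, hw⟩ := Triangle.yoneda_exact₃ _ hT x hx
  obtain ⟨y, hy⟩ := (shiftFunctor 𝒯 (2 : ℤ)).map_surjective
    ((shiftFunctorAdd' 𝒯 1 1 2 rfl).hom.app K ≫ w ≫ (shiftFunctorAdd' 𝒯 i 2 j h).hom.app Y)
  refine ⟨y, ?_⟩
  unfold ShiftedHom.comp
  rw [hy]
  simp only [Category.assoc, Iso.inv_hom_id_app_assoc]
  exact hw.trans (congrArg (δ ≫ ·) ((Category.assoc _ _ _).trans
    ((congrArg (w ≫ ·) (Iso.hom_inv_id_app _ _)).trans (Category.comp_id w))).symm)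

/-- If a multiple of the operator `τ k₀` on maps from `K` is induced by a map `δ` of degree two,
with cone `X`, then the maps from `K` are eventually generated under the operators if and only
if the maps from `X` are; and these are finitely generated if the maps from `K` are. -/
theorem eventuallyGenerated_iff_of_distinguished [IsNoetherianRing R] {K X Y : 𝒯}
    {ι : K⟦(1 : ℤ)⟧ ⟶ X} {π : X ⟶ K} {δ : K ⟶ (K⟦(1 : ℤ)⟧)⟦(1 : ℤ)⟧}
    (hT : Triangle.mk ι π δ ∈ distTriang 𝒯) {τ : Fin c → ShiftedHom Y Y (2 : ℤ)}
    (hτ : ∀ k l, (τ k).comp (τ l) (show (2 : ℤ) + 2 = 4 by norm_num) =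
      (τ l).comp (τ k) (show (2 : ℤ) + 2 = 4 by norm_num)) (k₀ : Fin c)
    (hδ : ∀ (i j : ℤ) (h : i + 2 = j) (y : ShiftedHom K Y i), ∃ r : R,
      ShiftedHom.comp (δ ≫ (shiftFunctorAdd' 𝒯 1 1 2 rfl).inv.app K) y h =
        y.comp (r • τ k₀) ((add_comm 2 i).trans h))
    (hfin : ∀ i : ℤ, Module.Finite R (ShiftedHom K Y i)) :
    (∀ i : ℤ, Module.Finite R (ShiftedHom X Y i)) ∧
      (EventuallyGenerated (postcomp R K τ) (fun _ => ⊤) ↔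
        EventuallyGenerated (postcomp R X τ) fun _ => ⊤) := by
  obtain ⟨β, hβ⟩ := exists_shift_comp_eq_zero (ι := ι)
  let ρ (i : ℤ) : ShiftedHom K Y i →ₗ[R] ShiftedHom X Y i := Linear.leftComp R _ π
  let σ (i j : ℤ) (h : i = j + 1) : ShiftedHom X Y i →ₗ[R] ShiftedHom K Y j :=
    precomp β Y i j (by omega)
  have hex (i j : ℤ) (h : i = j + 1) (x : ShiftedHom X Y i) (hx : σ i j h x = 0) :
      x ∈ LinearMap.range (ρ i) := by
    obtain ⟨z, hz⟩ := Triangle.yoneda_exact₂ _ hT x (hβ Y i j (by omega) x hx)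
    exact ⟨z, hz.symm⟩
  refine ⟨finite_of_exact ρ σ hfin hex, eventuallyGenerated_iff_of_exact ρ σ (postcomp_comm K hτ)
    (postcomp_comm X hτ) hfin k₀ hex (fun i x hx => ?_) (fun k i j h x => ?_) ?_⟩
  · obtain ⟨y, rfl⟩ := exists_comp_of_comp_eq_zero hT (i - 2) i (sub_add_cancel i 2) x hx
    obtain ⟨r, hr⟩ := hδ (i - 2) i (sub_add_cancel i 2) y
    refine ⟨r • y, ?_⟩
    rw [hr, ShiftedHom.comp_smul, map_smul]
    rfl
  · change π ≫ _ ≫ _ = (π ≫ _) ≫ _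
    rw [Category.assoc]
  · intro k i i' j j' hi hj h h' x
    exact precomp_postcomp β τ k i j i' j' _ _ hi hj x

end Triangulated

section

open Pretriangulated

theorem distinguished_of_iso₁ {𝒯 : Type*} [Category* 𝒯] [Preadditive 𝒯]
    [Limits.HasZeroObject 𝒯] [HasShift 𝒯 ℤ] [∀ n : ℤ, (shiftFunctor 𝒯 n).Additive]
    [Pretriangulated 𝒯] {X X' Y Z : 𝒯} {f : X ⟶ Y} {g : Y ⟶ Z} {δ : Z ⟶ X⟦(1 : ℤ)⟧}
    (h : Triangle.mk f g δ ∈ distTriang 𝒯) (e : X ≅ X') :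
    Triangle.mk (e.inv ≫ f) g (δ ≫ e.hom⟦(1 : ℤ)⟧') ∈ distTriang 𝒯 := by
  refine isomorphic_distinguished _ h _
    (Triangle.isoMk _ _ e.symm (Iso.refl _) (Iso.refl _) ?_ ?_ ?_)
  · exact Category.comp_id _
  · exact (Category.comp_id _).trans (Category.id_comp _).symm
  · change (δ ≫ e.hom⟦(1 : ℤ)⟧') ≫ e.inv⟦(1 : ℤ)⟧' = 𝟙 Z ≫ δ
    simp [← Functor.map_comp]

theorem map_eq_neg_map {𝒞 𝒟 : Type*} [Category* 𝒞] [Category* 𝒟] [Preadditive 𝒞]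
    [Preadditive 𝒟] [HasShift 𝒞 ℤ] [HasShift 𝒟 ℤ] (F : 𝒞 ⥤ 𝒟) [F.Additive] [F.CommShift ℤ]
    {X : 𝒞} (φ : X ⟶ (X⟦(1 : ℤ)⟧)⟦(1 : ℤ)⟧) (θ : ShiftedHom X X (2 : ℤ))
    (h : φ = -θ ≫ (shiftFunctorAdd' 𝒞 1 1 2 rfl).hom.app X) :
    ((F.map φ ≫ (F.commShiftIso (1 : ℤ)).hom.app (X⟦(1 : ℤ)⟧)) ≫
      ((F.commShiftIso (1 : ℤ)).hom.app X)⟦(1 : ℤ)⟧') ≫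
        (shiftFunctorAdd' 𝒟 1 1 2 rfl).inv.app (F.obj X) = -θ.map F := by
  unfold ShiftedHom.map
  rw [h, F.commShiftIso_add' (show (1 : ℤ) + 1 = 2 from rfl), Functor.CommShift.isoAdd'_hom_app]
  simp

end

end

noncomputable section

/-! ### Reductions of cones -/

variable {Q : Type u} [CommRing Q] {R : Type u} [CommRing R] [Algebra Q R] {c : ℕ} {f : Fin c → Q}

theorem IsRegularQuotient.baseChange_sum_smul (h : IsRegularQuotient f R) {X Y : Type u}
    [AddCommGroup X] [Module Q X] [AddCommGroup Y] [Module Q Y] (g : Fin c → X →ₗ[Q] Y) :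
    (∑ k, f k • g k).baseChange R = 0 := by
  refine h.baseChange_eq_zero _ fun x => ?_
  rw [LinearMap.sum_apply]
  exact Submodule.sum_mem _ fun k _ =>
    Submodule.smul_mem_smul (Ideal.subset_span ⟨k, rfl⟩) trivial

theorem IsRegularQuotient.baseChange_smul (h : IsRegularQuotient f R) (k : Fin c) {X Y : Type u}
    [AddCommGroup X] [Module Q X] [AddCommGroup Y] [Module Q Y] (g : X →ₗ[Q] Y) :
    (f k • g).baseChange R = 0 := by
  rw [LinearMap.baseChange_smul, ← IsScalarTower.algebraMap_smul R, h.algebraMap_apply_eq_zero,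
    zero_smul]

open Pretriangulated

namespace CurvedComplex

variable {j : ℕ}

/-- The complex over `R` obtained by base change from a complex up to `f`. -/
abbrev reduction (h : IsRegularQuotient f R) (A : CurvedComplex f j) :
    CochainComplex (ModuleCat.{u} R) ℤ where
  X n := ModuleCat.of R (R ⊗[Q] A.X n)
  d m n := if m + 1 = n then ModuleCat.ofHom ((A.d m n).baseChange R) else 0
  shape m n hmn := if_neg hmn
  d_comp_d' l m n hm hn := by
    change l + 1 = m at hm
    change m + 1 = n at hn
    rw [if_pos hm, if_pos hn, ← ModuleCat.ofHom_comp, ← LinearMap.baseChange_comp]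
    have : A.d m n ∘ₗ A.d l m = ∑ k, f k • A.t k l n := by
      ext x
      simp [A.d_d l m n hm hn]
    rw [this, h.baseChange_sum_smul]
    rfl

theorem reduction_d_eq (h : IsRegularQuotient f R) (A : CurvedComplex f j) {m n : ℤ}
    (hmn : m + 1 = n) : (A.reduction h).d m n = ModuleCat.ofHom ((A.d m n).baseChange R) :=
  if_pos hmn

/-- A complex up to `f` is a lift of its reduction. -/
abbrev reductionLift (h : IsRegularQuotient f R) (A : CurvedComplex f j) :
    Lift f (A.reduction h) where
  X n := ModuleCat.of Q (A.X n)
  free n := A.free n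
  d := A.d
  t := A.t
  e n := LinearEquiv.refl R (R ⊗[Q] A.X n)
  comm m n hmn := by
    rw [A.reduction_d_eq h hmn]
    rfl
  d_comp_d l m n hm hn := by
    refine LinearMap.ext fun x => (A.d_d l m n hm hn x).trans ?_
    simp

theorem reductionLift_reduce (h : IsRegularQuotient f R) (A : CurvedComplex f j) {m n : ℤ}
    (g : A.X m →ₗ[Q] A.X n) :
    (A.reductionLift h).reduce g = ModuleCat.ofHom (g.baseChange R) := rfl

section Step

variable (h : IsRegularQuotient f R) (hj : j < c) (A : CurvedComplex f (j + 1))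

/-- The inclusion of the second summands in the cone. -/
def stepInr : (A.reduction h)⟦(1 : ℤ)⟧ ⟶ (A.step h.regular hj).reduction h where
  f n := ModuleCat.ofHom ((LinearMap.inr Q (A.X n) (A.X (n + 1))).baseChange R)
  comm' m n hmn := by
    change m + 1 = n at hmn
    subst hmn
    rw [reduction_d_eq _ _ rfl]
    suffices H : ModuleCat.ofHom ((LinearMap.inr Q (A.X m) (A.X (m + 1))).baseChange R) ≫
        ModuleCat.ofHom (((A.step h.regular hj).d m (m + 1)).baseChange R) =
        ((1 : ℤ).negOnePow • (A.reduction h).d (m + 1) (m + 1 + 1)) ≫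
          ModuleCat.ofHom ((LinearMap.inr Q (A.X (m + 1)) (A.X (m + 1 + 1))).baseChange R) from H
    have h1 : (A.step h.regular hj).d m (m + 1) ∘ₗ LinearMap.inr Q (A.X m) (A.X (m + 1)) =
        f ⟨j, hj⟩ • LinearMap.inl Q _ _ -
          LinearMap.inr Q _ _ ∘ₗ A.d (m + 1) (m + 1 + 1) := by
      ext y
      · simp
      · simp
    have h2 : ((A.step h.regular hj).d m (m + 1) ∘ₗ
        LinearMap.inr Q (A.X m) (A.X (m + 1))).baseChange R =
          -(LinearMap.inr Q _ _ ∘ₗ A.d (m + 1) (m + 1 + 1)).baseChange R := by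
      rw [h1, LinearMap.baseChange_sub, h.baseChange_smul]
      exact LinearMap.ext fun z => zero_sub _
    rw [reduction_d_eq _ _ rfl, ← ModuleCat.ofHom_comp, ← LinearMap.baseChange_comp, h2,
      Int.negOnePow_one, Units.neg_smul, one_smul, Preadditive.neg_comp, ← ModuleCat.ofHom_comp,
      ← LinearMap.baseChange_comp]
    rfl

/-- The projection of the cone to the first summands. -/
def stepFst : (A.step h.regular hj).reduction h ⟶ A.reduction h where
  f n := ModuleCat.ofHom ((LinearMap.fst Q (A.X n) (A.X (n + 1))).baseChange R)
  comm' m n hmn := by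
    change m + 1 = n at hmn
    subst hmn
    rw [reduction_d_eq _ _ rfl, reduction_d_eq _ _ rfl]
    suffices H : ModuleCat.ofHom ((LinearMap.fst Q (A.X m) (A.X (m + 1))).baseChange R) ≫
        ModuleCat.ofHom ((A.d m (m + 1)).baseChange R) =
        ModuleCat.ofHom (((A.step h.regular hj).d m (m + 1)).baseChange R) ≫
        ModuleCat.ofHom ((LinearMap.fst Q (A.X (m + 1)) (A.X (m + 1 + 1))).baseChange R) from H
    have h1 : LinearMap.fst Q _ _ ∘ₗ (A.step h.regular hj).d m (m + 1) =
        A.d m (m + 1) ∘ₗ LinearMap.fst Q _ _ + f ⟨j, hj⟩ • LinearMap.snd Q _ _ := by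
      ext y
      · simp
      · simp
    rw [← ModuleCat.ofHom_comp, ← LinearMap.baseChange_comp, ← ModuleCat.ofHom_comp,
      ← LinearMap.baseChange_comp, h1, LinearMap.baseChange_add, h.baseChange_smul, add_zero]

/-- The short exact sequence of complexes given by the cone. -/
abbrev stepShortComplex : ShortComplex (CochainComplex (ModuleCat.{u} R) ℤ) :=
  .mk (A.stepInr h hj) (A.stepFst h hj) (by
    ext1 n
    refine ModuleCat.hom_ext ((LinearMap.baseChange_comp ..).symm.trans ?_)
    rw [LinearMap.fst_comp_inr]
    exact LinearMap.baseChange_zero)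

/-- The cone is the direct sum of its summands in each degree. -/
def stepSplitting (n : ℤ) :
    ((A.stepShortComplex h hj).map (HomologicalComplex.eval _ _ n)).Splitting where
  r := ModuleCat.ofHom ((LinearMap.snd Q (A.X n) (A.X (n + 1))).baseChange R)
  s := ModuleCat.ofHom ((LinearMap.inl Q (A.X n) (A.X (n + 1))).baseChange R)
  f_r := ModuleCat.hom_ext ((LinearMap.baseChange_comp ..).symm.trans
    ((congrArg _ (LinearMap.snd_comp_inr ..)).trans LinearMap.baseChange_id))
  s_g := ModuleCat.hom_ext ((LinearMap.baseChange_comp ..).symm.trans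
    ((congrArg _ (LinearMap.fst_comp_inl ..)).trans LinearMap.baseChange_id))
  id := ModuleCat.hom_ext ((congrArg₂ (· + ·) (LinearMap.baseChange_comp ..).symm
    (LinearMap.baseChange_comp ..).symm).trans ((LinearMap.baseChange_add ..).symm.trans
      ((congrArg _ (by ext <;> simp)).trans LinearMap.baseChange_id)))

theorem homOfDegreewiseSplit_step :
    CochainComplex.homOfDegreewiseSplit (A.stepShortComplex h hj) (A.stepSplitting h hj) =
      -((A.reductionLift h).chainMap h ⟨j, hj⟩) ≫
        (shiftFunctorAdd' (CochainComplex (ModuleCat.{u} R) ℤ) 1 1 2 rfl).hom.app _ := by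
  have key (n l : ℤ) (hl : n + 2 = l) :
      (A.reductionLift h).reduce (A.t ⟨j, hj⟩ n (n + 2)) ≫ ((A.reduction h).XIsoOfEq hl).hom =
        (A.reductionLift h).reduce (A.t ⟨j, hj⟩ n l) := by
    subst hl
    simp
  have h1 (n : ℤ) :
      LinearMap.snd Q _ _ ∘ₗ (A.step h.regular hj).d n (n + 1) ∘ₗ LinearMap.inl Q _ _ =
      -A.t ⟨j, hj⟩ n (n + 1 + 1) := by
    ext x
    simp
  ext1 n
  refine (CochainComplex.homOfDegreewiseSplit_f _ _ n).trans ?_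
  suffices H : ModuleCat.ofHom ((LinearMap.inl Q (A.X n) (A.X (n + 1))).baseChange R) ≫
      ((A.step h.regular hj).reduction h).d n (n + 1) ≫
      ModuleCat.ofHom ((LinearMap.snd Q (A.X (n + 1)) (A.X (n + 1 + 1))).baseChange R) =
      -(A.reductionLift h).reduce (A.t ⟨j, hj⟩ n (n + 1 + 1)) by
    refine Eq.trans H ?_
    rw [HomologicalComplex.neg_f_apply, HomologicalComplex.comp_f,
      CochainComplex.shiftFunctorAdd'_hom_app_f']
    exact (congrArg Neg.neg (key n (n + 1 + 1) (by lia))).symm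
  rw [reduction_d_eq _ _ rfl, reductionLift_reduce, ← ModuleCat.ofHom_comp,
    ← ModuleCat.ofHom_comp, ← LinearMap.baseChange_comp, ← LinearMap.baseChange_comp]
  exact congrArg ModuleCat.ofHom ((congrArg _ (h1 n)).trans (LinearMap.baseChange_neg ..))

/-- The cone of an operator on the reduction, as a distinguished triangle. -/
theorem exists_distinguished_step : ∃ (ι : (toK (A.reduction h))⟦(1 : ℤ)⟧ ⟶
      toK ((A.step h.regular hj).reduction h))
    (π : toK ((A.step h.regular hj).reduction h) ⟶ toK (A.reduction h))
    (δ : toK (A.reduction h) ⟶ ((toK (A.reduction h))⟦(1 : ℤ)⟧)⟦(1 : ℤ)⟧),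
    Triangle.mk ι π δ ∈ distTriang _ ∧
      δ ≫ (shiftFunctorAdd' _ 1 1 2 rfl).inv.app _ =
        -(A.reductionLift h).operator h ⟨j, hj⟩ :=
  ⟨_, _, _, distinguished_of_iso₁ (exists_distinguished (A.stepShortComplex h hj)
    (A.stepSplitting h hj)) (toKShiftIso (A.reduction h) 1),
    map_eq_neg_map _ _ _ (A.homOfDegreewiseSplit_step h hj)⟩

end Step

end CurvedComplex

end

noncomputable section

/-! ### Finite generation over the ring of cohomology operators -/

variable {Q : Type u} [CommRing Q] {R : Type u} [CommRing R] [Algebra Q R] {c : ℕ} {f : Fin c → Q}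
  (h : IsRegularQuotient f R)

section

variable {C D : CochainComplex (ModuleCat.{u} R) ℤ} (L : Lift f C) (L' : Lift f D)

/-- The reduction of a lift is the given complex. -/
def Lift.curvedIso (hC : ∀ n, Module.Finite R (C.X n)) : (L.curved h hC).reduction h ≅ C :=
  HomologicalComplex.Hom.isoOfComponents (fun n => (L.e n).toModuleIso) (by
    intro m n hmn
    change m + 1 = n at hmn
    rw [CurvedComplex.reduction_d_eq _ _ hmn]
    exact ModuleCat.hom_ext (L.comm m n hmn).symm)

/-- The reduction of `A.step` is, up to a shift, the cone of the operator `t j` on the reduction of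
`A`. By naturality this operator acts on maps to `D` as `L'.operator h j`, so passing to the cone
does not affect finite generation. -/
theorem eventuallyGenerated_step_iff [IsNoetherianRing R] {j : ℕ} (hj : j < c)
    (A : CurvedComplex f (j + 1))
    (hfin : ∀ i : ℤ, Module.Finite R (ShiftedHom (toK (A.reduction h)) (toK D) i)) :
    (∀ i : ℤ, Module.Finite R
        (ShiftedHom (toK ((A.step h.regular hj).reduction h)) (toK D) i)) ∧
      (EventuallyGenerated (postcomp R (toK (A.reduction h)) (L'.operator h)) (fun _ => ⊤) ↔
        EventuallyGenerated (postcomp R (toK ((A.step h.regular hj).reduction h))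
          (L'.operator h)) fun _ => ⊤) := by
  obtain ⟨ι, π, δ, hT, hδ⟩ := A.exists_distinguished_step h hj
  refine eventuallyGenerated_iff_of_distinguished hT (L'.operator_comm h) ⟨j, hj⟩
    (fun i l hil y => ⟨-1, ?_⟩) hfin
  rw [hδ, ShiftedHom.neg_comp, (A.reductionLift h).operator_comp L' h _ i l hil (by lia),
    ShiftedHom.comp_smul, neg_one_smul]

theorem eventuallyGenerated_resolve_iff [IsNoetherianRing R] {j : ℕ} (hj : j ≤ c)
    (A : CurvedComplex f j)
    (hfin : ∀ i : ℤ, Module.Finite R (ShiftedHom (toK (A.reduction h)) (toK D) i)) :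
    EventuallyGenerated (postcomp R (toK (A.reduction h)) (L'.operator h)) (fun _ => ⊤) ↔
      EventuallyGenerated (postcomp R (toK ((A.resolve h.regular j hj).reduction h))
        (L'.operator h)) fun _ => ⊤ :=
  (CurvedComplex.resolve_induction h.regular
    (fun _ B => (∀ i : ℤ, Module.Finite R (ShiftedHom (toK (B.reduction h)) (toK D) i)) ∧
      (EventuallyGenerated (postcomp R (toK (A.reduction h)) (L'.operator h)) (fun _ => ⊤) ↔
        EventuallyGenerated (postcomp R (toK (B.reduction h)) (L'.operator h)) fun _ => ⊤))
    (fun _ hj B hB =>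
      have h1 := eventuallyGenerated_step_iff h L' hj B hB.1
      ⟨h1.1, hB.2.trans h1.2⟩) hj A ⟨hfin, Iff.rfl⟩).2

/-- On maps from the reduction of a complex over `Q`, the operators vanish. -/
theorem postcomp_reduction_eq_zero (A : CurvedComplex f 0) (k : Fin c) (i j : ℤ)
    (hij : i + 2 = j) : postcomp R (toK (A.reduction h)) (L'.operator h) k i j hij = 0 := by
  have h0 : (A.reductionLift h).chainMap h k = 0 := by
    ext1 n
    change (A.reductionLift h).reduce (A.t k n (n + 2)) = 0
    rw [A.t_eq_zero k (Nat.zero_le _), CurvedComplex.reductionLift_reduce,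
      LinearMap.baseChange_zero]
    rfl
  refine LinearMap.ext fun x => ?_
  rw [postcomp_apply, ← (A.reductionLift h).operator_comp L' h k i j hij (by lia)]
  unfold Lift.operator
  rw [h0, ShiftedHom.map_zero, ShiftedHom.zero_comp]
  rfl

/-- Maps over `Q` to the complex attached to a lift of `C` vanish if and only if the maps over `R`
to `C` do. -/
theorem hom_toComplex_eq_zero_iff (hC : ∀ n, Module.Finite R (C.X n)) (A : CurvedComplex f 0)
    (L : Lift f C) (n : ℤ) :
    (∀ g : toK A.toComplex ⟶
      (toK ((L.curved h hC).resolve h.regular c le_rfl).toComplex)⟦n⟧, g = 0) ↔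
      ∀ g : toK (A.reduction h) ⟶ (toK C)⟦n⟧, g = 0 := by
  have hfree (n : ℤ) : Module.Free Q (A.toComplex.X n) := A.free n
  rw [← CurvedComplex.homExactMod_toComplex_iff, CurvedComplex.homExactMod_resolve_iff]
  refine CurvedComplex.homExactMod_iff _ ((A.reductionLift h).reduceTo L)
    ((A.reductionLift h).reduceTo_surjective L h)
    (fun p q φ => (A.reductionLift h).reduceTo_eq_zero_iff L h φ) (fun p q φ => ?_)
    (fun p q φ => ?_) n
  · refine ((A.reductionLift h).reduceTo_comp L L φ (L.d q (q + 1))).trans ?_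
    exact congrArg (_ ≫ ·) (L.reduceTo_d rfl)
  · rw [A.toComplex_d_hom]
    refine ((A.reductionLift h).reduceTo_comp (A.reductionLift h) L (A.d p (p + 1)) φ).trans ?_
    exact congrArg (· ≫ _) ((A.reductionLift h).reduceTo_d rfl)

/-- The action of `χ k`, defined by precomposition with the operator of the lift `L` of `C`, is also
postcomposition with the operator of any lift `L'` of `D`. -/
theorem isOperatorSum_operatorModule :
    IsOperatorSum (postcomp R (toK C) (L'.operator h))
      (M := OperatorModule h L D) (AddEquiv.refl (GradedHom C D)) where
  C_smul r x := OperatorModule.C_smul h L D r x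
  X_smul k i x := by
    refine (OperatorModule.X_smul h L D k _).trans ?_
    refine (L.chi_lof h D k i x).trans ?_
    rw [L.operator_comp L' h k i _ _ (by push_cast; ring)]
    rfl

/-- Finite generation over the ring of cohomology operators is vanishing over `Q` in large
degrees. -/
theorem finite_operatorModule_iff [IsNoetherianRing R] (hC : IsTotallyAcyclic C)
    (hD : IsTotallyAcyclic D) :
    Module.Finite (MvPolynomial (Fin c) R) (OperatorModule h L D) ↔
      ∃ p : ℕ, ∀ i : ℕ, p ≤ i → ∀ g : toK (L.resolution h hC).toComplex ⟶
        (toK (L'.resolution h hD).toComplex)⟦(i : ℤ)⟧, g = 0 := by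
  let e := (HomotopyCategory.quotient _ _).mapIso (L.curvedIso h hC.finite)
  let φ (i : ℤ) : ShiftedHom (toK C) (toK D) i ≃ₗ[R]
      ShiftedHom (toK ((L.curved h hC.finite).reduction h)) (toK D) i :=
    Linear.homCongr R e.symm (Iso.refl _)
  have hφ (k i j hij) (x : ShiftedHom (toK C) (toK D) i) :
      φ j (postcomp R _ (L'.operator h) k i j hij x) =
        postcomp R _ (L'.operator h) k i j hij (φ i x) := by
    have hφ' (i x) : φ i x = e.hom ≫ x := by
      refine (Linear.homCongr_apply ..).trans ?_
      simp
    rw [hφ', hφ']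
    exact (Category.assoc _ _ _).symm
  have hfin (i : ℤ) : Module.Finite R (ShiftedHom (toK C) (toK D) i) := hC.finite_hom_shift hD i
  rw [finite_iff_eventuallyGenerated (isOperatorSum_operatorModule h L L') hfin]
  have h1 : EventuallyGenerated (postcomp R (toK C) (L'.operator h)) (fun _ => ⊤) ↔
      EventuallyGenerated (postcomp R (toK ((L.curved h hC.finite).reduction h))
        (L'.operator h)) fun _ => ⊤ :=
    ⟨.of_equiv φ hφ, .of_equiv (fun i => (φ i).symm) fun k i j hij x => by
      rw [LinearEquiv.symm_apply_eq, hφ, LinearEquiv.apply_symm_apply]⟩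
  rw [h1, eventuallyGenerated_resolve_iff h L' le_rfl _ fun i =>
    Module.Finite.equiv (φ i), eventuallyGenerated_iff_of_eq_zero
      fun k i j hij => postcomp_reduction_eq_zero h L' _ k i j hij]
  exact exists_congr fun p => forall_congr' fun i => forall_congr' fun _ =>
    (hom_toComplex_eq_zero_iff h hD.finite _ L' i).symm

theorem smul_gradedHom {C D : CochainComplex (ModuleCat.{u} Q) ℤ} {q : Q}
    (hq : q • 𝟙 (toK C) = 0) (x : GradedHom C D) : q • x = 0 := by
  refine DFinsupp.ext fun i => ?_
  refine (DirectSum.smul_apply q x i).trans ?_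
  rw [← Category.id_comp (x i), ← Linear.smul_comp, hq, Limits.zero_comp]
  rfl

end

end

end TotallyAcyclic


open TotallyAcyclic in
theorem theorem4p4 {Q : Type u} [CommRing Q] [IsLocalRing Q] [IsNoetherianRing Q] {c : ℕ}
    (f : Fin c → Q) (hf : RingTheory.Sequence.IsRegular Q (List.ofFn f))
    (C D : CochainComplex (ModuleCat.{u} (Q ⧸ Ideal.span (Set.range f))) ℤ)
    (hC : TotallyAcyclic.IsTotallyAcyclic C) (hD : TotallyAcyclic.IsTotallyAcyclic D)
    (L : TotallyAcyclic.Lift f C) :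
    (∃ TC : CochainComplex (ModuleCat.{u} Q) ℤ, TotallyAcyclic.IsT Q C TC) ∧
    (∃ TD : CochainComplex (ModuleCat.{u} Q) ℤ, TotallyAcyclic.IsT Q D TD) ∧
    ∀ TC TD : CochainComplex (ModuleCat.{u} Q) ℤ,
      TotallyAcyclic.IsT Q C TC → TotallyAcyclic.IsT Q D TD →
      ∃ hI : Module.IsTorsionBySet Q (TotallyAcyclic.GradedHom TC TD)
          (Ideal.span (Set.range f) : Set Q),
        letI : Module (Q ⧸ Ideal.span (Set.range f)) (TotallyAcyclic.GradedHom TC TD) := hI.module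
        (Module.Finite (Q ⧸ Ideal.span (Set.range f)) (TotallyAcyclic.GradedHom TC TD) ↔
          Module.Finite (MvPolynomial (Fin c) (Q ⧸ Ideal.span (Set.range f)))
            (TotallyAcyclic.OperatorModule
              (TotallyAcyclic.IsRegularQuotient.quotient hf) L D)) := by
  have h := IsRegularQuotient.quotient hf
  obtain ⟨L'⟩ := Lift.nonempty (f := f) h hD.free
  refine ⟨⟨_, L.isT_resolution h hC⟩, ⟨_, L'.isT_resolution h hD⟩, fun TC TD hTC hTD => ?_⟩
  have hI : Module.IsTorsionBySet Q (GradedHom TC TD) (Ideal.span (Set.range f) : Set Q) := by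
    rw [Module.isTorsionBySet_iff_subset_annihilator, SetLike.coe_subset_coe, Ideal.span_le]
    rintro _ ⟨k, rfl⟩
    exact Module.mem_annihilator.2
      (smul_gradedHom (hTC.smul_id_eq_zero _ (Lift.smul_imageZero h C k)))
  refine ⟨hI, ?_⟩
  let : Module (Q ⧸ Ideal.span (Set.range f)) (GradedHom TC TD) := hI.module
  have : IsScalarTower Q (Q ⧸ Ideal.span (Set.range f)) (GradedHom TC TD) := hI.isScalarTower
  have h1 : Module.Finite (Q ⧸ Ideal.span (Set.range f)) (GradedHom TC TD) ↔
      Module.Finite Q (GradedHom TC TD) :=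
    ⟨fun _ => Module.Finite.trans (Q ⧸ Ideal.span (Set.range f)) _,
      fun _ => Module.Finite.of_restrictScalars_finite Q _ _⟩
  refine h1.trans (Iff.trans ?_ (finite_operatorModule_iff h L L' hC hD).symm)
  rw [finite_directSum_iff fun i => hTC.1.finite_hom_shift hTD.1 i]
  obtain ⟨e⟩ := hTC.nonempty_iso (L.isT_resolution h hC)
  obtain ⟨e'⟩ := hTD.nonempty_iso (L'.isT_resolution h hD)
  refine exists_congr fun p => forall_congr' fun i => forall_congr' fun _ => ?_
  let E := e.homCongr ((shiftFunctor _ (i : ℤ)).mapIso e')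
  have hE : E 0 = 0 := by
    refine (Iso.homCongr_apply ..).trans ?_
    rw [Limits.zero_comp, Limits.comp_zero]
  exact E.forall_congr fun g => by rw [← hE, E.apply_eq_iff_eq]
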